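/- Let $d\ge 1$, $r>0$, $\lambda>0$. Let $\Xi=\sum_{j\in\mathbb Z}\varepsilon_{\xi_j}$ be a homogeneous Poisson point process on $\mathbb R^d$ with rate $\lambda$, let $W^{(j)}$, $j\in\mathbb Z$, be independent standard $d$-dimensional Brownian motions, independent of $(\xi_j)_{j\in\mathbb Z}$, let $B=\{x\in\mathbb R^d:\|x\|\le r\}$, $\rho=\lambda\,\mathrm{vol}(B)$, and for $\sigma>0$ put $$N(t)=\sum_{j\in\mathbb Z}\mathbf 1\{\xi_j+\sigma W^{(j)}_t\in B\},\qquad t\ge 0 .$$ From the observation $\{N(t),\,0\le t\le T\}$ define, for $\alpha\in(0,\tfrac12)$ and $b>0$, $$\hat R(t)=\frac1{T-t}\int_0^{T-t}(N(s)-\rho)(N(s+t)-\rho)\,ds,\qquad \hat H(t)=\frac1\rho\max\{\hat R(t),0\},\qquad \hat\Psi_{\alpha,b}=\int_0^b\frac{\hat H(t)}{t^{1-\alpha}}\,dt .$$ Let $$J(t)=\frac{1}{\mathrm B(\frac{d+1}2,\frac12)\,\Gamma(\frac d2)}\int_0^1\gamma\Big(\frac d2;\frac{2r^2y}{t}\Big)(1-y)^{(d-1)/2}y^{-1/2}\,dy,\qquad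 J_\alpha=\int_0^\infty\frac{J(t)}{t^{1-\alpha}}\,dt,$$ where $\gamma(s;x)=\int_0^x u^{s-1}e^{-u}\,du$ and $\mathrm B$ is the beta function, and let $\hat\sigma^2_*=\big[J_{\alpha_*}/\hat\Psi_{\alpha_*,b_*}\big]^{1/\alpha_*}$ with $$\alpha_*=\frac1{\ln T},\qquad b_*=\begin{cases}(T/\ln^2T)^{1/d},&d>2,\\(T/\ln^3T)^{1/2},&d=2,\\ \sqrt T/\ln^2T,&d=1.\end{cases}$$ Let $\Delta(x,y)=|x-y|/(x+y)$; on the event $\hat\Psi_{\alpha_*,b_*}=0$ the loss $\Delta(\hat\sigma^2_*,\sigma^2)$ is $1$. Then $\hat\sigma_*^2$ is a random variable (measurable up to null sets) for all $T>e^2$ (that is, $0<\alpha_*<\frac12$) and $\sigma>0$, and there is a constant $C$ depending only on $d$ such that, for all $r>0$ and $\lambda>0$, $$\limsup_{T\to\infty}\ \sup_{\sigma>0:\ \sigma^2\le r^2T}\Big\{\Big[\Big(1+\frac1\rho\Big)\Big(\frac r\sigma\Big)^{d\wedge2}+\Big(\frac r\sigma\Big)^{2d}\Big]^{-1}\phi_T^{-1}\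 \mathbb E\big[\Delta(\hat\sigma_*^2,\sigma^2)\big]^2\Big\}\le C,$$ where $\mathbb E[\Delta]^2$ means $\mathbb E[\Delta^2]$ and $$\phi_T=\begin{cases}\ln^2T/T,&d>2,\\ \ln^3T/T,&d=2,\\ \ln^2T/\sqrt T,&d=1.\end{cases}$$ -/

import Mathlib

open MeasureTheory ProbabilityTheory Filter
open scoped ENNReal NNReal

namespace Smoluchowski

/-- Homogeneous Poisson point process of rate `lam` on `ℝᵈ`, given through its points `ξ j`:
the point measure `∑ j, dirac (ξ j)` has Poisson counts with mean `lam * vol A` on Borel sets `A`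
of finite volume, and independent counts on pairwise disjoint Borel sets. -/
structure IsPoissonProcess {d : ℕ} {Ω : Type*} [MeasurableSpace Ω] (lam : ℝ≥0)
    (ξ : ℤ → Ω → EuclideanSpace ℝ (Fin d)) (P : Measure Ω) : Prop where
  measurable : ∀ j, Measurable (ξ j)
  poisson_counts : ∀ A : Set (EuclideanSpace ℝ (Fin d)), MeasurableSet A → volume A ≠ ∞ →
    HasLaw (fun ω => Measure.sum (fun j => Measure.dirac (ξ j ω)) A)
      ((poissonMeasure (lam * (volume A).toNNReal)).map (fun n : ℕ => (n : ℝ≥0∞))) P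
  indep_counts : ∀ (n : ℕ) (A : Fin n → Set (EuclideanSpace ℝ (Fin d))),
    (∀ i, MeasurableSet (A i)) → Pairwise (fun i j => Disjoint (A i) (A j)) →
    iIndepFun (fun i ω => Measure.sum (fun j => Measure.dirac (ξ j ω)) (A i)) P

/-- Standard Brownian motion in `ℝᵈ`: the coordinates are independent standard real Brownian
motions (started at `0`, with almost surely continuous paths). -/
structure IsBrownian {d : ℕ} {Ω : Type*} [MeasurableSpace Ω]
    (W : ℝ≥0 → Ω → EuclideanSpace ℝ (Fin d)) (P : Measure Ω) : Prop where
  measurable : ∀ t, Measurable (W t)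
  coord : ∀ i, IsBrownianReal (fun t ω => W t ω i) P
  indep_coord : iIndepFun (fun (i : Fin d) (ω : Ω) (t : ℝ≥0) => W t ω i) P

/-- The random input of the Brownian displacement model: the initial positions `ξ j` form a
homogeneous Poisson process of rate `lam`, the `W j` are independent standard Brownian motions,
and the two families are independent. -/
structure IsBrownianSystem {d : ℕ} {Ω : Type*} [MeasurableSpace Ω] (lam : ℝ≥0)
    (ξ : ℤ → Ω → EuclideanSpace ℝ (Fin d)) (W : ℤ → ℝ≥0 → Ω → EuclideanSpace ℝ (Fin d))
    (P : Measure Ω) : Prop where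
  poisson : IsPoissonProcess lam ξ P
  brownian : ∀ j, IsBrownian (W j) P
  indep_brownian : iIndepFun (fun (j : ℤ) (ω : Ω) (t : ℝ≥0) => W j t ω) P
  indep : IndepFun (fun (ω : Ω) (j : ℤ) => ξ j ω)
    (fun (ω : Ω) (j : ℤ) (t : ℝ≥0) => W j t ω) P

noncomputable section

/-- The Smoluchowski process `N(t) = ∑ j, 1{ξ j + σ W j t ∈ B}`, `B` the closed ball of radius `r`
centred at the origin (`N(t)` is almost surely finite for every `t ≥ 0`). -/
def count {d : ℕ} {Ω : Type*} (ξ : ℤ → Ω → EuclideanSpace ℝ (Fin d))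
    (W : ℤ → ℝ≥0 → Ω → EuclideanSpace ℝ (Fin d)) (r σ : ℝ) (ω : Ω) (t : ℝ) : ℝ :=
  (∑' j : ℤ, (Metric.closedBall (0 : EuclideanSpace ℝ (Fin d)) r).indicator
    (fun _ => (1 : ℝ≥0∞)) (ξ j ω + σ • W j t.toNNReal ω)).toReal

/-- `ρ = lam * vol B`, the mean of `N(t)`. -/
def rho (d : ℕ) (lam : ℝ≥0) (r : ℝ) : ℝ :=
  lam * volume.real (Metric.closedBall (0 : EuclideanSpace ℝ (Fin d)) r)

/-- The empirical covariance function of an observed path `N`. -/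
def covEst (ρ T : ℝ) (N : ℝ → ℝ) (t : ℝ) : ℝ :=
  1 / (T - t) * ∫ s in (0 : ℝ)..(T - t), (N s - ρ) * (N (s + t) - ρ)

/-- The estimator of the correlation function, `{R̂(t)}₊ / ρ`. -/
def corrEst (ρ T : ℝ) (N : ℝ → ℝ) (t : ℝ) : ℝ :=
  1 / ρ * max (covEst ρ T N t) 0

/-- `Ψ̂_{α,b}`. -/
def psiEst (ρ T α b : ℝ) (N : ℝ → ℝ) : ℝ :=
  ∫ t in (0 : ℝ)..b, corrEst ρ T N t / t ^ (1 - α)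

/-- The lower incomplete Gamma function `γ(s; x)`. -/
def lowerGamma (s x : ℝ) : ℝ :=
  ∫ u in (0 : ℝ)..x, u ^ (s - 1) * Real.exp (-u)

/-- The function `J`, for which `J(σ² t)` is the correlation function of the process. -/
def J (d : ℕ) (r t : ℝ) : ℝ :=
  1 / (beta (((d : ℝ) + 1) / 2) (1 / 2) * Real.Gamma ((d : ℝ) / 2)) *
    ∫ y in (0 : ℝ)..1, lowerGamma ((d : ℝ) / 2) (2 * r ^ 2 * y / t) *
      (1 - y) ^ (((d : ℝ) - 1) / 2) * y ^ (-(1 / 2) : ℝ)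

/-- `J_α = ∫₀^∞ J(t) t^{α - 1} dt`. -/
def Jalpha (d : ℕ) (r α : ℝ) : ℝ :=
  ∫ t in Set.Ioi (0 : ℝ), J d r t / t ^ (1 - α)

/-- The estimator `(J_α / Ψ̂_{α,b})^{1/α}` of `σ²`. Where `Ψ̂_{α,b} = 0` it takes the value `0`;
its relative loss there is `1`, the same as for the value `+∞`. -/
def sigmaSqEst (d : ℕ) (r ρ T α b : ℝ) (N : ℝ → ℝ) : ℝ :=
  (Jalpha d r α / psiEst ρ T α b N) ^ (1 / α)

/-- `α_* = 1 / ln T`. -/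
def alphaStar (T : ℝ) : ℝ := 1 / Real.log T

/-- The truncation level `b_*`. -/
def bStar (d : ℕ) (T : ℝ) : ℝ :=
  if 2 < d then (T / Real.log T ^ 2) ^ (1 / (d : ℝ))
  else if d = 2 then (T / Real.log T ^ 3) ^ (1 / 2 : ℝ)
  else Real.sqrt T / Real.log T ^ 2

/-- The estimator `σ̂²_*`. -/
def sigmaSqStar (d : ℕ) (r ρ T : ℝ) (N : ℝ → ℝ) : ℝ :=
  sigmaSqEst d r ρ T (alphaStar T) (bStar d T) N

/-- The relative loss `Δ(x, y)`. -/
def relLoss (x y : ℝ) : ℝ := |x - y| / (x + y)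

/-- The rate `φ_T`. -/
def phi (d : ℕ) (T : ℝ) : ℝ :=
  if 2 < d then Real.log T ^ 2 / T
  else if d = 2 then Real.log T ^ 3 / T
  else Real.log T ^ 2 / Real.sqrt T

end

end Smoluchowski

open Smoluchowski

/-!
The Laplace functional of the Poisson process marked by the Brownian paths gives all moments of the
sums of a weight over its points, and polarization gives the mixed moments of the centred process
`N - ρ`: at two times, `ρ` times the correlation `corr` of the time difference; at four times, the
three Gaussian pairings plus a fourth cumulant bounded by `ρ` times a correlation. Hence the
empirical covariance divided by `ρ` has mean `corr t` and variance at most a multiple of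
`(1 + 1 / ρ) / T * ∫₀ᵀ corr`, uniformly in `t ≤ T / 2`.

By Brownian scaling `corr t = J (σ² t)`, so `∫₀^∞ corr t / t ^ (1 - α) dt = σ ^ (-2 α) J_α`. The
statistic `Ψ̂` estimates this integral with a stochastic error governed by that variance and a
truncation error governed by the decay `corr t = O((r / σ) ^ d t ^ (-d / 2))`. By Bernoulli's
inequality the relative loss of `(J_α / Ψ̂) ^ (1 / α)` is at most `1 / α` times the relative error
of `Ψ̂`. For `α = 1 / ln T` and `σ² ≤ r² T` the integral is itself at least of order `1 / α`, which
cancels the factor `1 / α`, and the choice of `b_*` balances the two errors.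
-/

namespace Smoluchowski

section ExpNeg

/-- The function `x ↦ e^{-x}` on `[0, ∞]`, with value `0` at `∞`. The Laplace transform of a
`[0, ∞]`-valued variable `S`, which is not yet known to be finite, is `u ↦ 𝔼 (expNeg (u * S))`. -/
noncomputable def expNeg (x : ℝ≥0∞) : ℝ := (EReal.exp (-(x : EReal))).toReal

lemma expNeg_nonneg (x : ℝ≥0∞) : 0 ≤ expNeg x := ENNReal.toReal_nonneg

lemma expNeg_le_one (x : ℝ≥0∞) : expNeg x ≤ 1 := by
  refine ENNReal.toReal_mono ENNReal.one_ne_top ?_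
  rw [EReal.exp_le_one_iff]
  simpa using EReal.coe_ennreal_nonneg x

lemma norm_expNeg_le_one (x : ℝ≥0∞) : ‖expNeg x‖ ≤ 1 := by
  simpa only [Real.norm_of_nonneg (expNeg_nonneg x)] using expNeg_le_one x

lemma expNeg_coe (x : ℝ≥0) : expNeg x = Real.exp (-x) := by
  have hx : -((x : ℝ≥0∞) : EReal) = ((-(x : ℝ) : ℝ) : EReal) := rfl
  rw [expNeg, hx, EReal.exp_coe, ENNReal.toReal_ofReal (Real.exp_nonneg _)]

lemma expNeg_of_ne_top {x : ℝ≥0∞} (hx : x ≠ ∞) : expNeg x = Real.exp (-x.toReal) := by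
  lift x to ℝ≥0 using hx
  exact expNeg_coe x

lemma expNeg_top : expNeg ∞ = 0 := by simp [expNeg]

lemma expNeg_zero : expNeg 0 = 1 := by simp [expNeg]

lemma expNeg_add (x y : ℝ≥0∞) : expNeg (x + y) = expNeg x * expNeg y := by
  rw [expNeg, expNeg, expNeg, ← ENNReal.toReal_mul, ← EReal.exp_add, EReal.coe_ennreal_add,
    EReal.neg_add (.inl (EReal.coe_ennreal_ne_bot x)) (.inr (EReal.coe_ennreal_ne_bot y)),
    sub_eq_add_neg]

lemma expNeg_sum {ι : Type*} (s : Finset ι) (f : ι → ℝ≥0∞) :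
    expNeg (∑ i ∈ s, f i) = ∏ i ∈ s, expNeg (f i) := by
  classical
  induction s using Finset.induction_on with
  | empty => simp [expNeg_zero]
  | insert a s ha ih => rw [Finset.sum_insert ha, Finset.prod_insert ha, expNeg_add, ih]

lemma continuous_expNeg : Continuous expNeg := by
  rw [← continuousOn_univ]
  refine ENNReal.continuousOn_toReal.comp (t := {x | x ≠ ∞})
    (ENNReal.continuous_exp.comp
      (continuous_neg.comp continuous_coe_ennreal_ereal)).continuousOn fun x _ => ?_
  simp [EReal.exp_eq_top_iff, EReal.neg_eq_top_iff]

lemma measurable_expNeg : Measurable expNeg := continuous_expNeg.measurable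

lemma one_sub_expNeg_le {x : ℝ≥0∞} (hx : x ≠ ∞) : 1 - expNeg x ≤ x.toReal := by
  rw [expNeg_of_ne_top hx]
  linarith [Real.add_one_le_exp (-x.toReal)]

lemma norm_one_sub_expNeg_le {x : ℝ≥0∞} (hx : x ≠ ∞) : ‖1 - expNeg x‖ ≤ x.toReal := by
  rw [Real.norm_of_nonneg (sub_nonneg.2 (expNeg_le_one x))]
  exact one_sub_expNeg_le hx

lemma integrable_expNeg_comp {Ω : Type*} [MeasurableSpace Ω] {P : Measure Ω} [IsFiniteMeasure P]
    {S : Ω → ℝ≥0∞} (hS : AEMeasurable S P) : Integrable (fun ω => expNeg (S ω)) P :=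
  Integrable.of_bound (measurable_expNeg.comp_aemeasurable hS).aestronglyMeasurable 1
    (ae_of_all _ fun _ => norm_expNeg_le_one _)

lemma integral_expNeg_mul_poisson (m : ℝ≥0) (c : ℝ≥0∞) :
    ∫ x, expNeg (c * x) ∂((poissonMeasure m).map (fun n : ℕ => (n : ℝ≥0∞)))
      = Real.exp (-(m * (1 - expNeg c))) := by
  have hmeas : Measurable fun x : ℝ≥0∞ => expNeg (c * x) :=
    measurable_expNeg.comp (measurable_const.mul measurable_id)
  have hpow (n : ℕ) : expNeg (c * n) = expNeg c ^ n := by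
    induction n with
    | zero => simp [expNeg_zero]
    | succ n ih => rw [Nat.cast_succ, mul_add, expNeg_add, ih, mul_one, pow_succ]
  have hterm (n : ℕ) : (Real.exp (-(m : ℝ)) * (m : ℝ) ^ n / n.factorial) • expNeg (c * n)
      = Real.exp (-(m : ℝ)) * ((m * expNeg c) ^ n / n.factorial) := by
    rw [hpow, smul_eq_mul, mul_pow]
    ring
  rw [integral_map (measurable_of_countable _).aemeasurable hmeas.aestronglyMeasurable,
    integral_poissonMeasure]
  simp_rw [hterm]
  rw [tsum_mul_left, (NormedSpace.expSeries_div_hasSum_exp (m * expNeg c : ℝ)).tsum_eq,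
    ← Real.exp_eq_exp_ℝ, ← Real.exp_add]
  congr 1
  ring

end ExpNeg

section SimpleFunctions

variable {E : Type*} [MeasurableSpace E]

lemma tsum_simpleFunc_comp_eq_sum_counts {ι : Type*} (s : SimpleFunc E ℝ≥0∞) (x : ι → E) :
    ∑' j, s (x j)
      = ∑ c ∈ s.range with c ≠ 0, c * Measure.sum (fun j => Measure.dirac (x j)) (s ⁻¹' {c}) := by
  have hint : ∑' j, s (x j) = ∫⁻ y, s y ∂(Measure.sum fun j => Measure.dirac (x j)) := by
    simp only [lintegral_sum_measure, lintegral_dirac' _ s.measurable]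
  rw [hint, SimpleFunc.lintegral_eq_lintegral, SimpleFunc.lintegral,
    Finset.sum_filter_of_ne (p := (· ≠ 0)) fun c _ hc h0 => hc (by simp [h0])]

lemma integral_comp_simpleFunc {β : Type*} {μ : Measure E} (s : SimpleFunc E β)
    {F : β → ℝ} {R : Finset β} (hR : ∀ x, s x ∉ R → F (s x) = 0)
    (hfin : ∀ c ∈ R, μ (s ⁻¹' {c}) ≠ ∞) :
    ∫ x, F (s x) ∂μ = ∑ c ∈ R, μ.real (s ⁻¹' {c}) * F c := by
  classical
  have hdecomp (x : E) : F (s x) = ∑ c ∈ R, (s ⁻¹' {c}).indicator (fun _ => F c) x := by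
    simp only [Set.indicator_apply, Set.mem_preimage, Set.mem_singleton_iff, Finset.sum_ite_eq]
    split_ifs with h
    · rfl
    · exact hR x h
  simp_rw [hdecomp]
  rw [integral_finsetSum _ fun c hc => (integrable_indicator_iff (s.measurableSet_preimage _)).2
    (integrableOn_const (hfin c hc))]
  simp only [integral_indicator_const _ (s.measurableSet_preimage _), smul_eq_mul]

end SimpleFunctions

section LaplaceFunctional

variable {d : ℕ} {Ω : Type*} [MeasurableSpace Ω] {P : Measure Ω} {lam : ℝ≥0}
  {ξ : ℤ → Ω → EuclideanSpace ℝ (Fin d)}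

lemma IsPoissonProcess.iIndepFun_counts (h : IsPoissonProcess lam ξ P) {ι : Type*} [Finite ι]
    {A : ι → Set (EuclideanSpace ℝ (Fin d))} (hA : ∀ i, MeasurableSet (A i))
    (hd : Pairwise fun i j => Disjoint (A i) (A j)) :
    iIndepFun (fun i ω => Measure.sum (fun j => Measure.dirac (ξ j ω)) (A i)) P := by
  let e := Finite.equivFin ι
  have hfin := h.indep_counts _ (A ∘ e.symm) (fun i => hA _) fun i j hij =>
    hd (e.symm.injective.ne hij)
  simpa only [Function.comp_apply, Equiv.symm_apply_apply] using hfin.precomp e.injective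

lemma IsPoissonProcess.integral_expNeg_mul_count (h : IsPoissonProcess lam ξ P)
    {A : Set (EuclideanSpace ℝ (Fin d))} (hA : MeasurableSet A) (hfin : volume A ≠ ∞)
    (c : ℝ≥0∞) :
    ∫ ω, expNeg (c * Measure.sum (fun j => Measure.dirac (ξ j ω)) A) ∂P
      = Real.exp (-(lam * (volume.real A * (1 - expNeg c)))) := by
  have hm : Measurable fun x : ℝ≥0∞ => expNeg (c * x) :=
    measurable_expNeg.comp (measurable_const.mul measurable_id)
  refine ((h.poisson_counts A hA hfin).integral_comp hm.aestronglyMeasurable).trans ?_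
  rw [integral_expNeg_mul_poisson, NNReal.coe_mul, mul_assoc]
  rfl

lemma IsPoissonProcess.integral_expNeg_simpleFunc (h : IsPoissonProcess lam ξ P)
    (s : SimpleFunc (EuclideanSpace ℝ (Fin d)) ℝ≥0∞)
    (hfin : ∫⁻ x, s x ≠ ∞) :
    ∫ ω, expNeg (∑' j, s (ξ j ω)) ∂P = Real.exp (-(lam * ∫ x, (1 - expNeg (s x)))) := by
  set R := s.range.filter (· ≠ 0) with hR
  have hsupp : s.FinMeasSupp volume :=
    SimpleFunc.FinMeasSupp.of_lintegral_ne_top (by rwa [← SimpleFunc.lintegral_eq_lintegral])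
  have hvol : ∀ c ∈ R, volume (s ⁻¹' {c}) ≠ ∞ := fun c hc =>
    (SimpleFunc.finMeasSupp_iff.1 hsupp c (Finset.mem_filter.1 hc).2).ne
  have hA (c : R) : MeasurableSet (s ⁻¹' {(c : ℝ≥0∞)}) := s.measurableSet_preimage _
  have hindep := h.iIndepFun_counts hA fun c c' hcc' =>
    Disjoint.preimage _ (Set.disjoint_singleton.2 fun heq => hcc' (Subtype.ext heq))
  have hm (c : R) : Measurable fun x : ℝ≥0∞ => expNeg (c * x) :=
    measurable_expNeg.comp (measurable_const.mul measurable_id)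
  have hexponent : ∫ x, (1 - expNeg (s x))
      = ∑ c ∈ R, volume.real (s ⁻¹' {c}) * (1 - expNeg c) := by
    refine integral_comp_simpleFunc s (F := fun c => 1 - expNeg c) (fun x hx => ?_) hvol
    have hx0 : s x = 0 := by
      by_contra hne
      exact hx (Finset.mem_filter.2 ⟨s.mem_range_self x, hne⟩)
    rw [hx0, expNeg_zero, sub_self]
  simp_rw [tsum_simpleFunc_comp_eq_sum_counts s, ← hR, ← Finset.sum_coe_sort R, expNeg_sum]
  rw [hindep.integral_fun_prod_comp
    (fun c => (h.poisson_counts _ (hA c) (hvol c c.2)).aemeasurable)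
    (f := fun (c : R) x => expNeg (c * x)) fun c => (hm c).aestronglyMeasurable,
    Finset.prod_congr rfl fun c _ => h.integral_expNeg_mul_count (hA c) (hvol c c.2) c,
    ← Real.exp_sum, hexponent, ← Finset.sum_coe_sort R, Finset.sum_neg_distrib, Finset.mul_sum]

lemma tendsto_tsum_eapprox {E ι : Type*} [MeasurableSpace E] {f : E → ℝ≥0∞} (hf : Measurable f)
    (x : ι → E) :
    Tendsto (fun n => ∑' j, SimpleFunc.eapprox f n (x j)) atTop (nhds (∑' j, f (x j))) := by
  let _ : MeasurableSpace ι := ⊤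
  simp_rw [← lintegral_count]
  exact lintegral_tendsto_of_tendsto_of_monotone
    (fun n => measurable_from_top.aemeasurable)
    (ae_of_all _ fun j _ _ hmn => SimpleFunc.monotone_eapprox f hmn (x j))
    (ae_of_all _ fun j => SimpleFunc.tendsto_eapprox hf _)

theorem IsPoissonProcess.integral_expNeg [IsProbabilityMeasure P]
    (h : IsPoissonProcess lam ξ P) {f : EuclideanSpace ℝ (Fin d) → ℝ≥0∞} (hf : Measurable f)
    (hfin : ∫⁻ x, f x ≠ ∞) :
    ∫ ω, expNeg (∑' j, f (ξ j ω)) ∂P = Real.exp (-(lam * ∫ x, (1 - expNeg (f x)))) := by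
  set s := SimpleFunc.eapprox f
  have hsle (n : ℕ) (x) : s n x ≤ f x := by
    rw [← SimpleFunc.iSup_eapprox_apply hf x]
    exact le_iSup (fun n => s n x) n
  have hleft : Tendsto (fun n => ∫ ω, expNeg (∑' j, s n (ξ j ω)) ∂P) atTop
      (nhds (∫ ω, expNeg (∑' j, f (ξ j ω)) ∂P)) :=
    tendsto_integral_of_dominated_convergence (fun _ => 1)
      (fun n => (measurable_expNeg.comp (Measurable.tsum fun j =>
        (s n).measurable.comp (h.measurable j))).aestronglyMeasurable)
      (integrable_const _) (fun n => ae_of_all _ fun ω => norm_expNeg_le_one _)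
      (ae_of_all _ fun ω => (continuous_expNeg.tendsto _).comp (tendsto_tsum_eapprox hf _))
  have hexponent : Tendsto (fun n => ∫ x, (1 - expNeg (s n x))) atTop
      (nhds (∫ x, (1 - expNeg (f x)))) := by
    refine tendsto_integral_of_dominated_convergence (fun x => (f x).toReal)
      (fun n => (measurable_const.sub
        (measurable_expNeg.comp (s n).measurable)).aestronglyMeasurable)
      (integrable_toReal_of_lintegral_ne_top hf.aemeasurable hfin) (fun n => ?_)
      (ae_of_all _ fun x => tendsto_const_nhds.sub
        ((continuous_expNeg.tendsto _).comp (SimpleFunc.tendsto_eapprox hf x)))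
    filter_upwards [ae_lt_top hf hfin] with x hx
    exact (norm_one_sub_expNeg_le ((hsle n x).trans_lt hx).ne).trans
      (ENNReal.toReal_mono hx.ne (hsle n x))
  simp_rw [h.integral_expNeg_simpleFunc (s _)
    (ne_top_of_le_ne_top hfin (lintegral_mono (hsle _)))] at hleft
  exact tendsto_nhds_unique hleft
    ((Real.continuous_exp.tendsto _).comp (hexponent.const_mul _).neg)

end LaplaceFunctional

section Marks

variable {d : ℕ} {Ω : Type*} [MeasurableSpace Ω] {P : Measure Ω} {lam : ℝ≥0}
  {ξ : ℤ → Ω → EuclideanSpace ℝ (Fin d)} {M : Type*} [MeasurableSpace M] {Q : Measure M}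
  {Y : ℤ → Ω → M}

/-- A homogeneous Poisson process on `ℝᵈ` whose points carry independent marks of law `Q`. The
Smoluchowski process is of this kind, the mark of a particle being its Brownian path. -/
structure IsMarkedPoisson (lam : ℝ≥0) (ξ : ℤ → Ω → EuclideanSpace ℝ (Fin d)) (Y : ℤ → Ω → M)
    (Q : Measure M) (P : Measure Ω) : Prop where
  poisson : IsPoissonProcess lam ξ P
  measurable : ∀ j, Measurable (Y j)
  law : ∀ j, HasLaw (Y j) Q P
  iIndep : iIndepFun Y P
  indep : IndepFun (fun ω j => ξ j ω) (fun ω j => Y j ω) P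

lemma integral_expNeg_tsum_of_iIndepFun [IsProbabilityMeasure P] {ι : Type*} [Countable ι]
    {Y : ι → Ω → M} (hlaw : ∀ j, HasLaw (Y j) Q P) (hindep : iIndepFun Y P) {g : ι → M → ℝ≥0∞}
    (hg : ∀ j, Measurable (g j)) {f : ι → ℝ≥0∞}
    (hf : ∀ j, ∫ y, expNeg (g j y) ∂Q = expNeg (f j)) :
    ∫ ω, expNeg (∑' j, g j (Y j ω)) ∂P = expNeg (∑' j, f j) := by
  have hm (j) : Measurable fun y => expNeg (g j y) := measurable_expNeg.comp (hg j)
  have hfinite (s : Finset ι) :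
      ∫ ω, expNeg (∑ j ∈ s, g j (Y j ω)) ∂P = expNeg (∑ j ∈ s, f j) := by
    have hs : iIndepFun (fun j : s => Y j) P := hindep.precomp Subtype.val_injective
    simp_rw [← Finset.sum_coe_sort s, expNeg_sum]
    rw [hs.integral_fun_prod_comp (fun j => (hlaw j).aemeasurable)
      (f := fun (j : s) y => expNeg (g j y)) fun j => (hm j).aestronglyMeasurable]
    refine Finset.prod_congr rfl fun j _ => ?_
    rw [← hf]
    exact (hlaw j).integral_comp (hm j).aestronglyMeasurable
  have hlim : Tendsto (fun s : Finset ι => ∫ ω, expNeg (∑ j ∈ s, g j (Y j ω)) ∂P) atTop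
      (nhds (∫ ω, expNeg (∑' j, g j (Y j ω)) ∂P)) :=
    tendsto_integral_filter_of_dominated_convergence (fun _ => 1)
      (Eventually.of_forall fun s => (measurable_expNeg.comp_aemeasurable
        (Finset.aemeasurable_fun_sum _ fun j _ =>
          (hg j).comp_aemeasurable (hlaw j).aemeasurable)).aestronglyMeasurable)
      (Eventually.of_forall fun s => ae_of_all _ fun ω => norm_expNeg_le_one _)
      (integrable_const _)
      (ae_of_all _ fun ω => (continuous_expNeg.tendsto _).comp ENNReal.summable.hasSum)
  simp_rw [hfinite] at hlim
  exact tendsto_nhds_unique hlim ((continuous_expNeg.tendsto _).comp ENNReal.summable.hasSum)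

lemma integrable_one_sub_expNeg {E : Type*} [MeasurableSpace E] {μ : Measure E} {g : E → ℝ≥0∞}
    (hg : AEMeasurable g μ) (hfin : ∫⁻ x, g x ∂μ ≠ ∞) :
    Integrable (fun x => 1 - expNeg (g x)) μ := by
  refine (integrable_toReal_of_lintegral_ne_top hg hfin).mono'
    ((measurable_expNeg.comp_aemeasurable hg).const_sub 1).aestronglyMeasurable ?_
  filter_upwards [ae_lt_top' hg hfin] with x hx
  exact norm_one_sub_expNeg_le hx.ne

/-- The function `f` with `e^{-f(x)} = ∫ e^{-g(x, y)} Q(dy)`. Averaging over the marks replaces `g`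
by it, which reduces a marked Poisson process to an unmarked one. -/
noncomputable def markAverage {E : Type*} (Q : Measure M) (g : E × M → ℝ≥0∞) (x : E) : ℝ≥0∞ :=
  ENNReal.ofReal (-Real.log (∫ y, expNeg (g (x, y)) ∂Q))

section MarkAverage

variable {E : Type*} [MeasurableSpace E] {g : E × M → ℝ≥0∞} {c : ℝ≥0} [IsProbabilityMeasure Q]

lemma integrable_expNeg_section (hg : Measurable g) (x : E) :
    Integrable (fun y => expNeg (g (x, y))) Q :=
  integrable_expNeg_comp (hg.comp measurable_prodMk_left).aemeasurable

lemma exp_neg_le_integral_expNeg (hg : Measurable g) (hgc : ∀ z, g z ≤ c) (x : E) :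
    Real.exp (-c) ≤ ∫ y, expNeg (g (x, y)) ∂Q := by
  have hle (y) : Real.exp (-c) ≤ expNeg (g (x, y)) := by
    rw [expNeg_of_ne_top (ne_top_of_le_ne_top ENNReal.coe_ne_top (hgc _)), Real.exp_le_exp,
      neg_le_neg_iff]
    exact ENNReal.toReal_mono ENNReal.coe_ne_top (hgc _)
  simpa using integral_mono (integrable_const _) (integrable_expNeg_section (Q := Q) hg x) hle

lemma integral_expNeg_section_le_one (hg : Measurable g) (x : E) :
    ∫ y, expNeg (g (x, y)) ∂Q ≤ 1 := by
  simpa using integral_mono (integrable_expNeg_section (Q := Q) hg x) (integrable_const 1)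
    fun y => expNeg_le_one _

lemma measurable_markAverage (hg : Measurable g) : Measurable (markAverage Q g) :=
  have hint : Measurable fun x => ∫ y, expNeg (g (x, y)) ∂Q :=
    ((measurable_expNeg.comp hg).stronglyMeasurable.integral_prod_right' (ν := Q)).measurable
  (Real.measurable_log.comp hint).neg.ennreal_ofReal

lemma expNeg_markAverage (hg : Measurable g) (hgc : ∀ z, g z ≤ c) (x : E) :
    expNeg (markAverage Q g x) = ∫ y, expNeg (g (x, y)) ∂Q := by
  have hpos := (Real.exp_pos _).trans_le (exp_neg_le_integral_expNeg (Q := Q) hg hgc x)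
  rw [markAverage, expNeg_of_ne_top ENNReal.ofReal_ne_top, ENNReal.toReal_ofReal
    (neg_nonneg.2 (Real.log_nonpos hpos.le (integral_expNeg_section_le_one hg x))), neg_neg,
    Real.exp_log hpos]

lemma markAverage_le (hg : Measurable g) (hgc : ∀ z, g z ≤ c) (x : E) :
    markAverage Q g x ≤ ENNReal.ofReal (Real.exp c * ∫ y, (1 - expNeg (g (x, y))) ∂Q) := by
  set G := ∫ y, expNeg (g (x, y)) ∂Q with hG
  have hlower : Real.exp (-c) ≤ G := exp_neg_le_integral_expNeg hg hgc x
  have hpos : 0 < G := (Real.exp_pos _).trans_le hlower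
  have hinv : G⁻¹ ≤ Real.exp c := by
    rw [inv_le_comm₀ hpos (Real.exp_pos _), ← Real.exp_neg]
    exact hlower
  rw [markAverage, ← hG, integral_sub (integrable_const _) (integrable_expNeg_section hg x), ← hG]
  refine ENNReal.ofReal_le_ofReal ?_
  calc -Real.log G ≤ G⁻¹ - 1 := by linarith [Real.one_sub_inv_le_log_of_pos hpos]
    _ = G⁻¹ * (1 - G) := by rw [mul_sub, inv_mul_cancel₀ hpos.ne', mul_one]
    _ ≤ Real.exp c * (1 - G) := by
      have : G ≤ 1 := integral_expNeg_section_le_one hg x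
      gcongr
    _ = Real.exp c * (∫ _, 1 ∂Q - G) := by simp

lemma lintegral_markAverage_ne_top {μ : Measure E} (hg : Measurable g)
    (hgc : ∀ z, g z ≤ c) (hfin : ∫⁻ z, g z ∂(μ.prod Q) ≠ ∞) :
    ∫⁻ x, markAverage Q g x ∂μ ≠ ∞ :=
  ne_top_of_le_ne_top
    ((integrable_one_sub_expNeg
      hg.aemeasurable hfin).integral_prod_left.const_mul _).lintegral_lt_top.ne
    (lintegral_mono (markAverage_le hg hgc))

lemma integral_one_sub_expNeg_markAverage {μ : Measure E} [SFinite μ] (hg : Measurable g)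
    (hgc : ∀ z, g z ≤ c) (hfin : ∫⁻ z, g z ∂(μ.prod Q) ≠ ∞) :
    ∫ x, (1 - expNeg (markAverage Q g x)) ∂μ = ∫ z, (1 - expNeg (g z)) ∂(μ.prod Q) := by
  rw [integral_prod _ (integrable_one_sub_expNeg hg.aemeasurable hfin)]
  refine integral_congr_ae (ae_of_all _ fun x => ?_)
  simp only [expNeg_markAverage hg hgc,
    integral_sub (integrable_const _) (integrable_expNeg_section (Q := Q) hg x)]
  simp

end MarkAverage

lemma IsMarkedPoisson.integral_expNeg_eq_markAverage [IsProbabilityMeasure P]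
    [IsProbabilityMeasure Q] (H : IsMarkedPoisson lam ξ Y Q P)
    {g : EuclideanSpace ℝ (Fin d) × M → ℝ≥0∞} (hg : Measurable g) {c : ℝ≥0}
    (hgc : ∀ z, g z ≤ c) :
    ∫ ω, expNeg (∑' j, g (ξ j ω, Y j ω)) ∂P = ∫ ω, expNeg (∑' j, markAverage Q g (ξ j ω)) ∂P := by
  set F : (ℤ → EuclideanSpace ℝ (Fin d)) × (ℤ → M) → ℝ :=
    fun p => expNeg (∑' j, g (p.1 j, p.2 j))
  have hF : Measurable F := measurable_expNeg.comp (Measurable.tsum fun j =>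
    hg.comp (((measurable_pi_apply j).comp measurable_fst).prodMk
      ((measurable_pi_apply j).comp measurable_snd)))
  have hξ : Measurable fun ω j => ξ j ω := measurable_pi_lambda _ H.poisson.measurable
  have hY : Measurable fun ω j => Y j ω := measurable_pi_lambda _ H.measurable
  have := Measure.isProbabilityMeasure_map (μ := P) hξ.aemeasurable
  have := Measure.isProbabilityMeasure_map (μ := P) hY.aemeasurable
  have hsection (x : ℤ → EuclideanSpace ℝ (Fin d)) :
      ∫ y, F (x, y) ∂(P.map fun ω j => Y j ω) = expNeg (∑' j, markAverage Q g (x j)) := by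
    have hFx : Measurable fun y => F (x, y) := hF.comp measurable_prodMk_left
    rw [integral_map hY.aemeasurable hFx.aestronglyMeasurable]
    exact integral_expNeg_tsum_of_iIndepFun H.law H.iIndep (g := fun j y => g (x j, y))
      (fun j => hg.comp measurable_prodMk_left) fun j => (expNeg_markAverage hg hgc (x j)).symm
  calc ∫ ω, expNeg (∑' j, g (ξ j ω, Y j ω)) ∂P
      = ∫ p, F p ∂((P.map fun ω j => ξ j ω).prod (P.map fun ω j => Y j ω)) := by
        rw [← (indepFun_iff_map_prod_eq_prod_map_map hξ.aemeasurable hY.aemeasurable).1 H.indep,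
          integral_map (hξ.prodMk hY).aemeasurable hF.aestronglyMeasurable]
    _ = ∫ x, expNeg (∑' j, markAverage Q g (x j)) ∂(P.map fun ω j => ξ j ω) := by
        rw [integral_prod _ (Integrable.of_bound hF.aestronglyMeasurable 1
          (ae_of_all _ fun _ => norm_expNeg_le_one _))]
        simp_rw [hsection]
    _ = ∫ ω, expNeg (∑' j, markAverage Q g (ξ j ω)) ∂P :=
        integral_map hξ.aemeasurable (measurable_expNeg.comp (Measurable.tsum fun j =>
          (measurable_markAverage hg).comp (measurable_pi_apply j))).aestronglyMeasurable

theorem IsMarkedPoisson.integral_expNeg [IsProbabilityMeasure P] [IsProbabilityMeasure Q]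
    (H : IsMarkedPoisson lam ξ Y Q P) {g : EuclideanSpace ℝ (Fin d) × M → ℝ≥0∞}
    (hg : Measurable g) {c : ℝ≥0} (hgc : ∀ z, g z ≤ c)
    (hfin : ∫⁻ z, g z ∂(volume.prod Q) ≠ ∞) :
    ∫ ω, expNeg (∑' j, g (ξ j ω, Y j ω)) ∂P
      = Real.exp (-(lam * ∫ z, (1 - expNeg (g z)) ∂(volume.prod Q))) := by
  rw [H.integral_expNeg_eq_markAverage hg hgc, H.poisson.integral_expNeg
    (measurable_markAverage hg) (lintegral_markAverage_ne_top hg hgc hfin),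
    integral_one_sub_expNeg_markAverage hg hgc hfin]

end Marks

section Cumulants

variable {Z : Type*} [MeasurableSpace Z] {ν : Measure Z} {h : Z → ℝ} {c : ℝ}

/-- The `n`-th derivative at `u` of `u ↦ ∫ (e^{u h} - 1) dν`, the cumulant generating function of
the sum of `h` over the points of a Poisson process of intensity `ν`. The term `0 ^ n` is the `1`
for `n = 0`, and vanishes otherwise. -/
noncomputable def poissonCumulant (ν : Measure Z) (h : Z → ℝ) (n : ℕ) (u : ℝ) : ℝ :=
  ∫ z, (h z ^ n * Real.exp (u * h z) - 0 ^ n) ∂ν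

lemma poissonCumulant_zero_zero : poissonCumulant ν h 0 0 = 0 := by simp [poissonCumulant]

lemma poissonCumulant_zero {n : ℕ} (hn : n ≠ 0) : poissonCumulant ν h n 0 = ∫ z, h z ^ n ∂ν := by
  simp [poissonCumulant, hn]

lemma abs_exp_sub_one_le_abs_mul_exp (x : ℝ) : |Real.exp x - 1| ≤ |x| * Real.exp |x| := by
  have hexp : 1 ≤ Real.exp |x| := Real.one_le_exp (abs_nonneg x)
  rw [abs_le]
  constructor
  · nlinarith [Real.add_one_le_exp x, neg_abs_le x, abs_nonneg x]
  · calc Real.exp x - 1 = Real.exp x * (1 - Real.exp (-x)) := by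
          rw [mul_sub, ← Real.exp_add, add_neg_cancel, Real.exp_zero, mul_one]
      _ ≤ Real.exp x * x := by
          gcongr
          linarith [Real.add_one_le_exp (-x)]
      _ ≤ Real.exp x * |x| := by gcongr; exact le_abs_self x
      _ ≤ Real.exp |x| * |x| := by gcongr; exact le_abs_self x
      _ = |x| * Real.exp |x| := mul_comm _ _

lemma abs_pow_succ_mul_exp_le {x u v : ℝ} (hx : |x| ≤ c) (hu : |u| ≤ v) (n : ℕ) :
    |x ^ (n + 1) * Real.exp (u * x)| ≤ c ^ n * Real.exp (v * c) * |x| := by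
  have hc : 0 ≤ c := (abs_nonneg x).trans hx
  have hux : u * x ≤ v * c :=
    (le_abs_self _).trans ((abs_mul u x).trans_le (mul_le_mul hu hx (abs_nonneg x)
      ((abs_nonneg u).trans hu)))
  rw [abs_mul, abs_pow, pow_succ, Real.abs_exp, mul_right_comm]
  gcongr

lemma integrable_poissonCumulant (hm : AEStronglyMeasurable h ν) (hc : ∀ z, |h z| ≤ c)
    (hi : Integrable h ν) (n : ℕ) (u : ℝ) :
    Integrable (fun z => h z ^ n * Real.exp (u * h z) - 0 ^ n) ν := by
  have hmeas : AEStronglyMeasurable (fun z => h z ^ n * Real.exp (u * h z) - 0 ^ n) ν :=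
    ((hm.pow n).mul (Real.continuous_exp.comp_aestronglyMeasurable (hm.const_mul u))).sub
      aestronglyMeasurable_const
  cases n with
  | zero =>
    refine (hi.abs.const_mul (|u| * Real.exp (|u| * c))).mono' hmeas (ae_of_all _ fun z => ?_)
    rw [pow_zero, pow_zero, one_mul, Real.norm_eq_abs]
    refine (abs_exp_sub_one_le_abs_mul_exp _).trans ?_
    rw [abs_mul, mul_right_comm]
    gcongr
    exact hc z
  | succ n =>
    refine (hi.abs.const_mul (c ^ n * Real.exp (|u| * c))).mono' hmeas (ae_of_all _ fun z => ?_)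
    rw [zero_pow n.succ_ne_zero, sub_zero]
    exact abs_pow_succ_mul_exp_le (hc z) le_rfl n

lemma hasDerivAt_poissonCumulant (hm : AEStronglyMeasurable h ν) (hc : ∀ z, |h z| ≤ c)
    (hi : Integrable h ν) (n : ℕ) (u : ℝ) :
    HasDerivAt (poissonCumulant ν h n) (poissonCumulant ν h (n + 1) u) u := by
  have hint := integrable_poissonCumulant hm hc hi
  refine (hasDerivAt_integral_of_dominated_loc_of_deriv_le (Metric.ball_mem_nhds u one_pos)
    (Eventually.of_forall fun v => (hint n v).aestronglyMeasurable) (hint n u)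
    (hint (n + 1) u).aestronglyMeasurable
    (bound := fun z => c ^ n * Real.exp ((|u| + 1) * c) * |h z|)
    (F' := fun v z => h z ^ (n + 1) * Real.exp (v * h z) - 0 ^ (n + 1))
    (ae_of_all _ fun z v hv => ?_) (hi.abs.const_mul _) (ae_of_all _ fun z v _ => ?_)).2
  · have hvu : |v| ≤ |u| + 1 := by
      have hdist : |v - u| < 1 := hv
      linarith [abs_sub_abs_le_abs_sub v u]
    rw [zero_pow n.succ_ne_zero, sub_zero]
    exact abs_pow_succ_mul_exp_le (hc z) hvu n
  · refine (((hasDerivAt_mul_const (h z)).exp.const_mul (h z ^ n)).sub_const _).congr_deriv ?_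
    rw [zero_pow n.succ_ne_zero, sub_zero]
    ring

end Cumulants

section Moments

open Finset.HasAntidiagonal (antidiagonal mem_antidiagonal)

variable {Ω : Type*} [MeasurableSpace Ω] {P : Measure Ω}

lemma integral_add_const_pow {X : Ω → ℝ} (hX : ∀ n, Integrable (fun ω => X ω ^ n) P) (b : ℝ)
    (n : ℕ) :
    Integrable (fun ω => (X ω + b) ^ n) P ∧ ∫ ω, (X ω + b) ^ n ∂P
      = ∑ m ∈ Finset.range (n + 1), (∫ ω, X ω ^ m ∂P) * b ^ (n - m) * n.choose m := by
  have hint (m : ℕ) : Integrable (fun ω => X ω ^ m * b ^ (n - m) * n.choose m) P :=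
    ((hX m).mul_const _).mul_const _
  simp_rw [add_pow]
  refine ⟨integrable_finsetSum _ fun m _ => hint m, ?_⟩
  rw [integral_finsetSum _ fun m _ => hint m]
  simp_rw [integral_mul_const]

variable [IsProbabilityMeasure P]

lemma ae_ne_top_of_tendsto_laplace {S : Ω → ℝ≥0∞} (hS : AEMeasurable S P)
    (hlim : Tendsto (fun u => ∫ ω, expNeg (ENNReal.ofReal u * S ω) ∂P) (nhdsWithin 0 (Set.Ioi 0))
      (nhds 1)) :
    ∀ᵐ ω ∂P, S ω ≠ ∞ := by
  have hms : NullMeasurableSet {ω | S ω ≠ ∞} P :=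
    (hS.nullMeasurable (measurableSet_singleton ∞)).compl
  have hle : ∀ᶠ u in nhdsWithin (0 : ℝ) (Set.Ioi 0),
      ∫ ω, expNeg (ENNReal.ofReal u * S ω) ∂P ≤ P.real {ω | S ω ≠ ∞} := by
    filter_upwards [self_mem_nhdsWithin] with u hu
    have hreal : ∫ ω, {ω | S ω ≠ ∞}.indicator (fun _ => (1 : ℝ)) ω ∂P = P.real {ω | S ω ≠ ∞} := by
      rw [integral_indicator₀ hms, setIntegral_const, smul_eq_mul, mul_one]
    rw [← hreal]
    refine integral_mono (integrable_expNeg_comp (hS.const_mul _))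
      ((integrable_const (1 : ℝ)).indicator₀ hms) fun ω => ?_
    by_cases hω : S ω = ∞
    · rw [hω, ENNReal.mul_top (ENNReal.ofReal_pos.2 hu).ne', expNeg_top]
      exact Set.indicator_nonneg (fun _ _ => zero_le_one) ω
    · rw [Set.indicator_of_mem (s := {ω | S ω ≠ ∞}) hω]
      exact expNeg_le_one _
  have hone : P.real {ω | S ω ≠ ∞} = 1 := le_antisymm measureReal_le_one (le_of_tendsto hlim hle)
  rw [measureReal_def, ENNReal.toReal_eq_one_iff] at hone
  exact (prob_compl_eq_zero_iff₀ hms).2 hone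

section NonnegVariable

variable {X : Ω → ℝ} {K : ℕ → ℝ → ℝ}

lemma Iio_subset_interior_integrableExpSet (hX : AEMeasurable X P) (hX0 : ∀ ω, 0 ≤ X ω) :
    Set.Iio 0 ⊆ interior (integrableExpSet X P) := by
  refine interior_maximal (fun u hu => ?_) isOpen_Iio
  refine Integrable.of_bound (hX.const_mul u).exp.aestronglyMeasurable 1
    (ae_of_all _ fun ω => ?_)
  rw [Real.norm_of_nonneg (Real.exp_nonneg _), Real.exp_le_one_iff]
  exact mul_nonpos_of_nonpos_of_nonneg (le_of_lt hu) (hX0 ω)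

lemma integral_pow_succ_mul_exp (hX : AEMeasurable X P) (hX0 : ∀ ω, 0 ≤ X ω)
    (hK : ∀ n u, HasDerivAt (K n) (K (n + 1) u) u)
    (hmgf : ∀ u < 0, ∫ ω, Real.exp (u * X ω) ∂P = Real.exp (K 0 u)) (n : ℕ) :
    ∀ u < 0, ∫ ω, X ω ^ (n + 1) * Real.exp (u * X ω) ∂P
      = ∑ p ∈ antidiagonal n,
          (n.choose p.1 : ℝ) * ((∫ ω, X ω ^ p.1 * Real.exp (u * X ω) ∂P) * K (p.2 + 1) u) := by
  set M : ℕ → ℝ → ℝ := fun n u => ∫ ω, X ω ^ n * Real.exp (u * X ω) ∂P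
  have hM (n : ℕ) {u : ℝ} (hu : u < 0) : HasDerivAt (M n) (M (n + 1) u) u :=
    hasDerivAt_integral_pow_mul_exp_real (Iio_subset_interior_integrableExpSet hX hX0 hu) n
  have hM0 : ∀ u < 0, M 0 u = Real.exp (K 0 u) := fun u hu => by simp [M, hmgf u hu]
  change ∀ u < 0, M (n + 1) u
    = ∑ p ∈ antidiagonal n, (n.choose p.1 : ℝ) * (M p.1 u * K (p.2 + 1) u)
  induction n with
  | zero =>
    intro u hu
    have hexp : HasDerivAt (M 0) (Real.exp (K 0 u) * K 1 u) u :=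
      (hK 0 u).exp.congr_of_eventuallyEq (eventuallyEq_of_mem (Iio_mem_nhds hu) hM0)
    rw [(hM 0 hu).unique hexp]
    simp [hM0 u hu]
  | succ n ih =>
    intro u hu
    have hsum : HasDerivAt (M (n + 1)) (∑ p ∈ antidiagonal n, (n.choose p.1 : ℝ) *
        (M (p.1 + 1) u * K (p.2 + 1) u + M p.1 u * K (p.2 + 1 + 1) u)) u :=
      (HasDerivAt.fun_sum fun p _ => ((hM p.1 hu).mul (hK (p.2 + 1) u)).const_mul _)
        |>.congr_of_eventuallyEq (eventuallyEq_of_mem (Iio_mem_nhds hu) ih)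
    rw [(hM (n + 1) hu).unique hsum,
      Finset.sum_antidiagonal_choose_succ_mul (fun i j => M i u * K (j + 1) u),
      ← Finset.sum_add_distrib]
    refine Finset.sum_congr rfl fun p hp => ?_
    rw [Nat.choose_symm_of_eq_add (mem_antidiagonal.1 hp).symm]
    ring

lemma integrable_pow_of_tendsto (hX : AEMeasurable X P) (hX0 : ∀ ω, 0 ≤ X ω) {n : ℕ} {L : ℝ}
    (hlim : Tendsto (fun u => ∫ ω, X ω ^ n * Real.exp (u * X ω) ∂P) (nhdsWithin 0 (Set.Iio 0))
      (nhds L)) :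
    Integrable (fun ω => X ω ^ n) P ∧ ∫ ω, X ω ^ n ∂P = L := by
  have hmeas (u : ℝ) : AEMeasurable (fun ω => X ω ^ n * Real.exp (u * X ω)) P :=
    (hX.pow_const n).mul (hX.const_mul u).exp
  have hpos (u : ℝ) (ω) : 0 ≤ X ω ^ n * Real.exp (u * X ω) :=
    mul_nonneg (pow_nonneg (hX0 ω) n) (Real.exp_nonneg _)
  have hpt (ω) : Tendsto (fun u => X ω ^ n * Real.exp (u * X ω)) (nhdsWithin 0 (Set.Iio 0))
      (nhds (X ω ^ n)) := by
    have hcont : Continuous fun u => X ω ^ n * Real.exp (u * X ω) := by fun_prop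
    simpa using (hcont.tendsto 0).mono_left nhdsWithin_le_nhds
  obtain ⟨v, hv⟩ := exists_seq_tendsto (nhdsWithin (0 : ℝ) (Set.Iio 0))
  have hfatou : ∫⁻ ω, ENNReal.ofReal (X ω ^ n) ∂P ≤ ENNReal.ofReal L :=
    calc ∫⁻ ω, ENNReal.ofReal (X ω ^ n) ∂P
        = ∫⁻ ω, liminf (fun k => ENNReal.ofReal (X ω ^ n * Real.exp (v k * X ω))) atTop ∂P :=
          lintegral_congr fun ω => (ENNReal.tendsto_ofReal ((hpt ω).comp hv)).liminf_eq.symm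
      _ ≤ liminf (fun k => ∫⁻ ω, ENNReal.ofReal (X ω ^ n * Real.exp (v k * X ω)) ∂P) atTop :=
          lintegral_liminf_le' fun k => (hmeas _).ennreal_ofReal
      _ = liminf (fun k => ENNReal.ofReal (∫ ω, X ω ^ n * Real.exp (v k * X ω) ∂P)) atTop := by
          refine liminf_congr ((hv.eventually self_mem_nhdsWithin).mono fun k hk => ?_)
          rw [ofReal_integral_eq_lintegral_ofReal
            (integrable_pow_mul_exp_of_mem_interior_integrableExpSet
              (Iio_subset_interior_integrableExpSet hX hX0 hk) n) (ae_of_all _ (hpos _))]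
      _ = ENNReal.ofReal L := (ENNReal.tendsto_ofReal (hlim.comp hv)).liminf_eq
  have hint : Integrable (fun ω => X ω ^ n) P :=
    ⟨(hX.pow_const n).aestronglyMeasurable, (hasFiniteIntegral_iff_ofReal
      (ae_of_all _ fun ω => pow_nonneg (hX0 ω) n)).2 (hfatou.trans_lt ENNReal.ofReal_lt_top)⟩
  refine ⟨hint, tendsto_nhds_unique (tendsto_integral_filter_of_dominated_convergence _
    (Eventually.of_forall fun u => (hmeas u).aestronglyMeasurable) ?_ hint
    (ae_of_all _ hpt)) hlim⟩
  filter_upwards [self_mem_nhdsWithin] with u hu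
  refine ae_of_all _ fun ω => ?_
  rw [Real.norm_of_nonneg (hpos u ω)]
  exact mul_le_of_le_one_right (pow_nonneg (hX0 ω) n) (Real.exp_le_one_iff.2
    (mul_nonpos_of_nonpos_of_nonneg (le_of_lt hu) (hX0 ω)))

variable (hX : AEMeasurable X P) (hX0 : ∀ ω, 0 ≤ X ω)
  (hK : ∀ n u, HasDerivAt (K n) (K (n + 1) u) u)
  (hmgf : ∀ u < 0, ∫ ω, Real.exp (u * X ω) ∂P = Real.exp (K 0 u))
include hX hX0 hK hmgf

lemma tendsto_integral_pow_mul_exp (n : ℕ) :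
    Integrable (fun ω => X ω ^ n) P ∧
      Tendsto (fun u => ∫ ω, X ω ^ n * Real.exp (u * X ω) ∂P) (nhdsWithin 0 (Set.Iio 0))
        (nhds (∫ ω, X ω ^ n ∂P)) := by
  have hKlim (n : ℕ) : Tendsto (K n) (nhdsWithin 0 (Set.Iio 0)) (nhds (K n 0)) :=
    (hK n 0).continuousAt.tendsto.mono_left nhdsWithin_le_nhds
  suffices ∃ L, Tendsto (fun u => ∫ ω, X ω ^ n * Real.exp (u * X ω) ∂P)
      (nhdsWithin 0 (Set.Iio 0)) (nhds L) by
    obtain ⟨L, hL⟩ := this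
    obtain ⟨hint, rfl⟩ := integrable_pow_of_tendsto hX hX0 hL
    exact ⟨hint, hL⟩
  induction n using Nat.strong_induction_on with
  | _ n ih =>
    cases n with
    | zero =>
      refine ⟨Real.exp (K 0 0), ((Real.continuous_exp.tendsto _).comp (hKlim 0)).congr' ?_⟩
      filter_upwards [self_mem_nhdsWithin] with u hu
      simp [hmgf u hu]
    | succ n =>
      choose! L hL using ih
      have hterm (p : ℕ × ℕ) (hp : p ∈ antidiagonal n) :=
        ((hL p.1 (Finset.Nat.antidiagonal.fst_lt hp)).mul
          (hKlim (p.2 + 1))).const_mul (n.choose p.1 : ℝ)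
      refine ⟨_, (tendsto_finsetSum _ hterm).congr' ?_⟩
      filter_upwards [self_mem_nhdsWithin] with u hu
      exact (integral_pow_succ_mul_exp hX hX0 hK hmgf n u hu).symm

theorem integral_pow_succ_eq_sum_cumulants (n : ℕ) :
    ∫ ω, X ω ^ (n + 1) ∂P
      = ∑ p ∈ antidiagonal n, (n.choose p.1 : ℝ) * ((∫ ω, X ω ^ p.1 ∂P) * K (p.2 + 1) 0) := by
  have hlim := fun n => (tendsto_integral_pow_mul_exp hX hX0 hK hmgf n).2
  have hterm (p : ℕ × ℕ) := ((hlim p.1).mul ((hK (p.2 + 1) 0).continuousAt.tendsto.mono_left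
    nhdsWithin_le_nhds)).const_mul (n.choose p.1 : ℝ)
  refine tendsto_nhds_unique (hlim (n + 1)) ((tendsto_finsetSum _ fun p _ => hterm p).congr' ?_)
  filter_upwards [self_mem_nhdsWithin] with u hu
  exact (integral_pow_succ_mul_exp hX hX0 hK hmgf n u hu).symm

end NonnegVariable

theorem centralMoments_of_mgf {X : Ω → ℝ} {K : ℕ → ℝ → ℝ} (hX : AEMeasurable X P)
    (hX0 : ∀ ω, 0 ≤ X ω) (hK : ∀ n u, HasDerivAt (K n) (K (n + 1) u) u)
    (hmgf : ∀ u < 0, ∫ ω, Real.exp (u * X ω) ∂P = Real.exp (K 0 u)) :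
    (∀ n, Integrable (fun ω => (X ω - K 1 0) ^ n) P) ∧
      ∫ ω, (X ω - K 1 0) ^ 2 ∂P = K 2 0 ∧
      ∫ ω, (X ω - K 1 0) ^ 4 ∂P = K 4 0 + 3 * K 2 0 ^ 2 := by
  have hcentral := integral_add_const_pow
    (fun n => (tendsto_integral_pow_mul_exp hX hX0 hK hmgf n).1) (-K 1 0)
  have hmoment := integral_pow_succ_eq_sum_cumulants hX hX0 hK hmgf
  have hmean : ∫ ω, X ω ∂P = K 1 0 := by simpa using hmoment 0
  simp only [← sub_eq_add_neg] at hcentral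
  refine ⟨fun n => (hcentral n).1, ?_, ?_⟩
  · rw [(hcentral 2).2]
    simp [Finset.sum_range_succ, hmoment, hmean, Finset.Nat.antidiagonal_succ]
    ring
  · rw [(hcentral 4).2]
    simp [Finset.sum_range_succ, hmoment, hmean, Finset.Nat.antidiagonal_succ, Nat.choose]
    ring

end Moments

section Campbell

lemma univ_fin_four : (Finset.univ : Finset (Fin 4)) = {0, 1, 2, 3} := rfl

lemma sum_powerset_fin_four (f : Finset (Fin 4) → ℝ) :
    ∑ I : Finset (Fin 4), f I = f ∅ + f {3} + (f {2} + f {2, 3}) + (f {1} + f {1, 3} +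
      (f {1, 2} + f {1, 2, 3})) + (f {0} + f {0, 3} + (f {0, 2} + f {0, 2, 3}) +
      (f {0, 1} + f {0, 1, 3} + (f {0, 1, 2} + f {0, 1, 2, 3}))) := by
  have hthree : ({3} : Finset (Fin 4)) = insert 3 ∅ := rfl
  rw [← Finset.powerset_univ, univ_fin_four]
  repeat rw [Finset.sum_powerset_insert (by decide)]
  rw [hthree]
  repeat rw [Finset.sum_powerset_insert (by decide)]
  simp only [Finset.powerset_empty, Finset.sum_singleton]
  rfl

lemma sum_neg_one_pow_card_mul_sum_pow_four (x : Fin 4 → ℝ) :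
    ∑ I : Finset (Fin 4), (-1 : ℝ) ^ I.card * (∑ i ∈ I, x i) ^ 4 = 24 * ∏ i, x i := by
  rw [sum_powerset_fin_four]
  simp [Fin.prod_univ_four, Finset.sum_insert, Finset.card_insert_of_notMem]
  ring

lemma sum_neg_one_pow_card_mul_sum_sum_sq (c : Fin 4 → Fin 4 → ℝ) (hc : ∀ i j, c i j = c j i) :
    ∑ I : Finset (Fin 4), (-1 : ℝ) ^ I.card * (∑ i ∈ I, ∑ j ∈ I, c i j) ^ 2
      = 8 * (c 0 1 * c 2 3 + c 0 2 * c 1 3 + c 0 3 * c 1 2) := by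
  rw [sum_powerset_fin_four]
  simp only [Finset.card_empty, Finset.card_singleton, Finset.card_insert_of_notMem,
    Finset.sum_empty, Finset.sum_singleton, Finset.sum_insert, Finset.mem_insert,
    Finset.mem_singleton, Fin.isValue, Fin.reduceEq, zero_ne_one, or_self, not_false_eq_true]
  rw [hc 1 0, hc 2 0, hc 3 0, hc 2 1, hc 3 1, hc 3 2]
  ring

/-- A bounded integrable weight `h ≥ 0`: those for which the sum of `h` over the points of a Poisson
process of intensity `ν` has moments of all orders. -/
structure IsBoundedIntegrable {Z : Type*} [MeasurableSpace Z] (h : Z → ℝ≥0∞) (ν : Measure Z) :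
    Prop where
  measurable : Measurable h
  bounded : ∃ c : ℝ≥0, ∀ z, h z ≤ c
  lintegral_ne_top : ∫⁻ z, h z ∂ν ≠ ∞

namespace IsBoundedIntegrable

variable {Z : Type*} [MeasurableSpace Z] {ν : Measure Z} {h h' : Z → ℝ≥0∞}

lemma ne_top (hh : IsBoundedIntegrable h ν) (z : Z) : h z ≠ ∞ :=
  hh.bounded.elim fun _ hc => ne_top_of_le_ne_top ENNReal.coe_ne_top (hc z)

lemma exists_abs_toReal_le (hh : IsBoundedIntegrable h ν) : ∃ c : ℝ, ∀ z, |(h z).toReal| ≤ c := by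
  obtain ⟨c, hc⟩ := hh.bounded
  refine ⟨c, fun z => ?_⟩
  rw [abs_of_nonneg ENNReal.toReal_nonneg]
  exact ENNReal.toReal_mono ENNReal.coe_ne_top (hc z)

lemma integrable (hh : IsBoundedIntegrable h ν) : Integrable (fun z => (h z).toReal) ν :=
  integrable_toReal_of_lintegral_ne_top hh.measurable.aemeasurable hh.lintegral_ne_top

lemma integrable_pow (hh : IsBoundedIntegrable h ν) {n : ℕ} (hn : n ≠ 0) :
    Integrable (fun z => (h z).toReal ^ n) ν := by
  obtain ⟨c, hc⟩ := hh.exists_abs_toReal_le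
  simpa [hn] using integrable_poissonCumulant hh.integrable.aestronglyMeasurable hc
    hh.integrable n 0

lemma integrable_mul (hh : IsBoundedIntegrable h ν) (hh' : IsBoundedIntegrable h' ν) :
    Integrable (fun z => (h z).toReal * (h' z).toReal) ν := by
  obtain ⟨c, hc⟩ := hh'.exists_abs_toReal_le
  exact hh.integrable.mul_bdd hh'.integrable.aestronglyMeasurable (ae_of_all _ hc)

lemma finsetSum {ι : Type*} {h : ι → Z → ℝ≥0∞} (hh : ∀ i, IsBoundedIntegrable (h i) ν)
    (I : Finset ι) : IsBoundedIntegrable (fun z => ∑ i ∈ I, h i z) ν where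
  measurable := Finset.measurable_fun_sum _ fun i _ => (hh i).measurable
  bounded := by
    choose c hc using fun i => (hh i).bounded
    refine ⟨∑ i ∈ I, c i, fun z => ?_⟩
    push_cast
    exact Finset.sum_le_sum fun i _ => hc i z
  lintegral_ne_top := by
    rw [lintegral_finsetSum _ fun i _ => (hh i).measurable]
    exact ENNReal.sum_ne_top.2 fun i _ => (hh i).lintegral_ne_top

lemma indicator_one {D : Set Z} (hD : MeasurableSet D) (hfin : ν D ≠ ∞) :
    IsBoundedIntegrable (D.indicator 1) ν where
  measurable := measurable_one.indicator hD
  bounded := ⟨1, fun z => Set.indicator_le_self' (fun _ _ => zero_le) z⟩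
  lintegral_ne_top := by rwa [lintegral_indicator_one hD]

end IsBoundedIntegrable

variable {d : ℕ} {Ω : Type*} [MeasurableSpace Ω] {P : Measure Ω} {lam : ℝ≥0}
  {ξ : ℤ → Ω → EuclideanSpace ℝ (Fin d)} {M : Type*} [MeasurableSpace M] {Q : Measure M}
  {Y : ℤ → Ω → M}

/-- The sum of the weight `h` over the points of a marked Poisson process, minus its mean (which is
its mean only for integrable `h`). -/
noncomputable def centredSum (lam : ℝ≥0) (ξ : ℤ → Ω → EuclideanSpace ℝ (Fin d)) (Y : ℤ → Ω → M)
    (Q : Measure M) (h : EuclideanSpace ℝ (Fin d) × M → ℝ≥0∞) (ω : Ω) : ℝ :=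
  (∑' j, h (ξ j ω, Y j ω)).toReal - lam * ∫ z, (h z).toReal ∂(volume.prod Q)

namespace IsMarkedPoisson

lemma measurable_tsum (H : IsMarkedPoisson lam ξ Y Q P)
    {h : EuclideanSpace ℝ (Fin d) × M → ℝ≥0∞} (hh : Measurable h) :
    Measurable fun ω => ∑' j, h (ξ j ω, Y j ω) :=
  Measurable.tsum fun j => hh.comp ((H.poisson.measurable j).prodMk (H.measurable j))

variable [IsProbabilityMeasure P] [IsProbabilityMeasure Q]
  {h : EuclideanSpace ℝ (Fin d) × M → ℝ≥0∞}

lemma laplace_tsum (H : IsMarkedPoisson lam ξ Y Q P)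
    (hh : IsBoundedIntegrable h (volume.prod Q)) (u : ℝ) :
    ∫ ω, expNeg (ENNReal.ofReal u * ∑' j, h (ξ j ω, Y j ω)) ∂P
      = Real.exp (lam * poissonCumulant (volume.prod Q) (fun z => (h z).toReal) 0
          (-(u ⊔ 0))) := by
  obtain ⟨c, hc⟩ := hh.bounded
  simp_rw [← ENNReal.tsum_mul_left]
  rw [H.integral_expNeg (g := fun z => ENNReal.ofReal u * h z) (c := u.toNNReal * c)
    (hh.measurable.const_mul _), ← mul_neg, ← integral_neg]
  · congr 2
    refine integral_congr_ae (ae_of_all _ fun z => ?_)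
    simp [expNeg_of_ne_top (ENNReal.mul_ne_top ENNReal.ofReal_ne_top (hh.ne_top z)),
      ENNReal.toReal_ofReal']
  · exact fun z => mul_le_mul_right (hc z) _
  · rw [lintegral_const_mul _ hh.measurable]
    exact ENNReal.mul_ne_top ENNReal.ofReal_ne_top hh.lintegral_ne_top

lemma ae_tsum_ne_top (H : IsMarkedPoisson lam ξ Y Q P)
    (hh : IsBoundedIntegrable h (volume.prod Q)) :
    ∀ᵐ ω ∂P, ∑' j, h (ξ j ω, Y j ω) ≠ ∞ := by
  obtain ⟨c, hc⟩ := hh.exists_abs_toReal_le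
  refine ae_ne_top_of_tendsto_laplace (H.measurable_tsum hh.measurable).aemeasurable ?_
  simp_rw [H.laplace_tsum hh]
  have hcont : Continuous (poissonCumulant (volume.prod Q) (fun z => (h z).toReal) 0) :=
    continuous_iff_continuousAt.2 fun u => (hasDerivAt_poissonCumulant
      hh.integrable.aestronglyMeasurable hc hh.integrable 0 u).continuousAt
  have hlim : Continuous fun u : ℝ => Real.exp (lam * poissonCumulant (volume.prod Q)
      (fun z => (h z).toReal) 0 (-(u ⊔ 0))) := by fun_prop
  simpa [poissonCumulant_zero_zero] using (hlim.tendsto 0).mono_left nhdsWithin_le_nhds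

theorem centralMoments (H : IsMarkedPoisson lam ξ Y Q P)
    (hh : IsBoundedIntegrable h (volume.prod Q)) :
    (∀ n, Integrable (fun ω => centredSum lam ξ Y Q h ω ^ n) P) ∧
      ∫ ω, centredSum lam ξ Y Q h ω ^ 2 ∂P = lam * ∫ z, (h z).toReal ^ 2 ∂(volume.prod Q) ∧
      ∫ ω, centredSum lam ξ Y Q h ω ^ 4 ∂P = lam * ∫ z, (h z).toReal ^ 4 ∂(volume.prod Q)
        + 3 * (lam * ∫ z, (h z).toReal ^ 2 ∂(volume.prod Q)) ^ 2 := by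
  obtain ⟨c, hc⟩ := hh.exists_abs_toReal_le
  have hmgf (u : ℝ) (hu : u < 0) :
      ∫ ω, Real.exp (u * (∑' j, h (ξ j ω, Y j ω)).toReal) ∂P
        = Real.exp (lam * poissonCumulant (volume.prod Q) (fun z => (h z).toReal) 0 u) := by
    have hlaplace := H.laplace_tsum hh (-u)
    rw [max_eq_left (neg_nonneg.2 hu.le), neg_neg] at hlaplace
    rw [← hlaplace]
    refine integral_congr_ae ((H.ae_tsum_ne_top hh).mono fun ω hω => ?_)
    simp only [expNeg_of_ne_top (ENNReal.mul_ne_top ENNReal.ofReal_ne_top hω), ENNReal.toReal_mul,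
      ENNReal.toReal_ofReal (neg_nonneg.2 hu.le), neg_mul, neg_neg]
  have hmoments := centralMoments_of_mgf
    (K := fun n u => lam * poissonCumulant (volume.prod Q) (fun z => (h z).toReal) n u)
    (H.measurable_tsum hh.measurable).ennreal_toReal.aemeasurable
    (fun _ => ENNReal.toReal_nonneg)
    (fun n u => (hasDerivAt_poissonCumulant hh.integrable.aestronglyMeasurable hc hh.integrable n
      u).const_mul _) hmgf
  simpa only [poissonCumulant_zero one_ne_zero, poissonCumulant_zero two_ne_zero,
    poissonCumulant_zero four_ne_zero, pow_one] using! hmoments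

section Family

variable {ι : Type*} {h : ι → EuclideanSpace ℝ (Fin d) × M → ℝ≥0∞}

lemma ae_centredSum_finsetSum (H : IsMarkedPoisson lam ξ Y Q P)
    (hh : ∀ i, IsBoundedIntegrable (h i) (volume.prod Q)) (I : Finset ι) :
    ∀ᵐ ω ∂P, centredSum lam ξ Y Q (fun z => ∑ i ∈ I, h i z) ω
      = ∑ i ∈ I, centredSum lam ξ Y Q (h i) ω := by
  have hne : ∀ᵐ ω ∂P, ∀ i ∈ I, ∑' j, h i (ξ j ω, Y j ω) ≠ ∞ :=
    (ae_ball_iff I.countable_toSet).2 fun i _ => H.ae_tsum_ne_top (hh i)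
  filter_upwards [hne] with ω hω
  have hmean : ∫ z, (∑ i ∈ I, h i z).toReal ∂(volume.prod Q)
      = ∑ i ∈ I, ∫ z, (h i z).toReal ∂(volume.prod Q) := by
    simp_rw [ENNReal.toReal_sum fun i _ => (hh i).ne_top _]
    exact integral_finsetSum _ fun i _ => (hh i).integrable
  simp only [centredSum]
  rw [Summable.tsum_finsetSum fun _ _ => ENNReal.summable, ENNReal.toReal_sum hω, hmean,
    Finset.mul_sum, Finset.sum_sub_distrib]

omit [IsProbabilityMeasure Q] in
lemma integral_sum_sq (hh : ∀ i, IsBoundedIntegrable (h i) (volume.prod Q)) (I : Finset ι) :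
    lam * ∫ z, (∑ i ∈ I, h i z).toReal ^ 2 ∂(volume.prod Q)
      = ∑ i ∈ I, ∑ j ∈ I, lam * ∫ z, (h i z).toReal * (h j z).toReal ∂(volume.prod Q) := by
  simp_rw [ENNReal.toReal_sum fun i _ => (hh i).ne_top _, sq, Finset.sum_mul_sum]
  rw [integral_finsetSum _ fun i _ => integrable_finsetSum _ fun j _ =>
    (hh i).integrable_mul (hh j), Finset.mul_sum]
  refine Finset.sum_congr rfl fun i _ => ?_
  rw [integral_finsetSum _ fun j _ => (hh i).integrable_mul (hh j), Finset.mul_sum]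

lemma moments_sum (H : IsMarkedPoisson lam ξ Y Q P)
    (hh : ∀ i, IsBoundedIntegrable (h i) (volume.prod Q)) (I : Finset ι) :
    (∀ n, Integrable (fun ω => (∑ i ∈ I, centredSum lam ξ Y Q (h i) ω) ^ n) P) ∧
    ∫ ω, (∑ i ∈ I, centredSum lam ξ Y Q (h i) ω) ^ 2 ∂P
      = ∑ i ∈ I, ∑ j ∈ I, lam * ∫ z, (h i z).toReal * (h j z).toReal ∂(volume.prod Q) ∧
    ∫ ω, (∑ i ∈ I, centredSum lam ξ Y Q (h i) ω) ^ 4 ∂P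
      = lam * ∫ z, (∑ i ∈ I, (h i z).toReal) ^ 4 ∂(volume.prod Q) + 3 * (∑ i ∈ I, ∑ j ∈ I,
          lam * ∫ z, (h i z).toReal * (h j z).toReal ∂(volume.prod Q)) ^ 2 := by
  have hpow (n : ℕ) := (H.ae_centredSum_finsetSum hh I).mono fun ω hω => congrArg (· ^ n) hω
  obtain ⟨hint, hsq, hfour⟩ := H.centralMoments (.finsetSum hh I)
  rw [integral_sum_sq hh I] at hsq hfour
  simp_rw [ENNReal.toReal_sum fun i _ => (hh i).ne_top _] at hfour
  exact ⟨fun n => (hint n).congr (hpow n), (integral_congr_ae (hpow 2)).symm.trans hsq,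
    (integral_congr_ae (hpow 4)).symm.trans hfour⟩

end Family

theorem integral_centredSum_mul (H : IsMarkedPoisson lam ξ Y Q P)
    {h : Fin 2 → EuclideanSpace ℝ (Fin d) × M → ℝ≥0∞}
    (hh : ∀ i, IsBoundedIntegrable (h i) (volume.prod Q)) :
    Integrable (fun ω => centredSum lam ξ Y Q (h 0) ω * centredSum lam ξ Y Q (h 1) ω) P ∧
    ∫ ω, centredSum lam ξ Y Q (h 0) ω * centredSum lam ξ Y Q (h 1) ω ∂P
      = lam * ∫ z, (h 0 z).toReal * (h 1 z).toReal ∂(volume.prod Q) := by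
  obtain ⟨hint, hsq, -⟩ := H.moments_sum hh Finset.univ
  have hsq' (i) := (H.centralMoments (hh i)).2.1
  have hint' (i) := (H.centralMoments (hh i)).1 2
  simp only [Fin.sum_univ_two] at hint hsq
  have hpolar (x y : ℝ) : x * y = 2⁻¹ * ((x + y) ^ 2 - x ^ 2 - y ^ 2) := by ring
  simp_rw [hpolar (centredSum lam ξ Y Q (h 0) _)]
  have hdiff : Integrable (fun ω => (centredSum lam ξ Y Q (h 0) ω
      + centredSum lam ξ Y Q (h 1) ω) ^ 2 - centredSum lam ξ Y Q (h 0) ω ^ 2) P :=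
    (hint 2).sub (hint' 0)
  refine ⟨(hdiff.sub (hint' 1)).const_mul _, ?_⟩
  rw [integral_const_mul, integral_sub hdiff (hint' 1), integral_sub (hint 2) (hint' 0), hsq, hsq',
    hsq']
  simp_rw [sq, mul_comm (h 1 _).toReal (h 0 _).toReal]
  ring

theorem integral_centredSum_prod_four (H : IsMarkedPoisson lam ξ Y Q P)
    {h : Fin 4 → EuclideanSpace ℝ (Fin d) × M → ℝ≥0∞}
    (hh : ∀ i, IsBoundedIntegrable (h i) (volume.prod Q)) {κ : Fin 4 → Fin 4 → ℝ}
    (hκ : ∀ i j, lam * ∫ z, (h i z).toReal * (h j z).toReal ∂(volume.prod Q) = κ i j) :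
    Integrable (fun ω => ∏ i, centredSum lam ξ Y Q (h i) ω) P ∧
    ∫ ω, ∏ i, centredSum lam ξ Y Q (h i) ω ∂P
      = lam * ∫ z, ∏ i, (h i z).toReal ∂(volume.prod Q)
        + (κ 0 1 * κ 2 3 + κ 0 2 * κ 1 3 + κ 0 3 * κ 1 2) := by
  have hint (I : Finset (Fin 4)) (_ : I ∈ Finset.univ) :=
    ((H.moments_sum hh I).1 4).const_mul ((-1 : ℝ) ^ I.card)
  have hintensity (I : Finset (Fin 4)) (_ : I ∈ Finset.univ) :
      Integrable (fun z => (-1 : ℝ) ^ I.card * (∑ i ∈ I, (h i z).toReal) ^ 4)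
        (volume.prod Q) := by
    simp_rw [← ENNReal.toReal_sum fun i _ => (hh i).ne_top _]
    exact ((IsBoundedIntegrable.finsetSum hh I).integrable_pow four_ne_zero).const_mul _
  have hpolar (x : Fin 4 → ℝ) : ∏ i, x i
      = 24⁻¹ * ∑ I : Finset (Fin 4), (-1 : ℝ) ^ I.card * (∑ i ∈ I, x i) ^ 4 := by
    rw [sum_neg_one_pow_card_mul_sum_pow_four, inv_mul_cancel_left₀ (by norm_num)]
  have hsymm (i j : Fin 4) : κ i j = κ j i := by simp_rw [← hκ, mul_comm (h i _).toReal]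
  simp_rw [hpolar]
  refine ⟨(integrable_finsetSum _ hint).const_mul _, ?_⟩
  rw [integral_const_mul, integral_const_mul, integral_finsetSum _ hint,
    integral_finsetSum _ hintensity]
  simp_rw [integral_const_mul, (H.moments_sum hh _).2.2, hκ, mul_add, Finset.sum_add_distrib,
    mul_left_comm _ (3 : ℝ)]
  rw [← Finset.mul_sum (a := (3 : ℝ)), sum_neg_one_pow_card_mul_sum_sum_sq κ hsymm]
  simp_rw [mul_left_comm _ (lam : ℝ), ← Finset.mul_sum]
  ring

end IsMarkedPoisson

end Campbell

section Substitution

lemma integral_Ioi_comp_mul_sqrt {E : Type*} [NormedAddCommGroup E] [NormedSpace ℝ E] (F : ℝ → E)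
    {r c : ℝ} (hr : 0 < r) (hc : 0 ≤ c) :
    ∫ y in Set.Ioi c, (r / 2 * y ^ (-(1 / 2) : ℝ)) • F (r * √y)
      = ∫ x in Set.Ioi (r * √c), F x := by
  have hpow := integral_comp_rpow_Ioi_of_pos' (g := fun x => F (r * x)) (p := 1 / 2) (by norm_num)
    (Real.sqrt_nonneg c)
  have hsqrt : √c ^ (1 / 2 : ℝ)⁻¹ = c := by
    rw [one_div, inv_inv, Real.rpow_two, Real.sq_sqrt hc]
  rw [hsqrt] at hpow
  rw [← integral_comp_mul_left_Ioi' F _ hr, ← hpow, ← integral_smul]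
  simp_rw [← Real.sqrt_eq_rpow, smul_smul]
  norm_num [div_eq_mul_inv, mul_assoc]

end Substitution

section BetaWeight

/-- The weight of the beta function `B((d + 1) / 2, 1 / 2)`, which occurs in the definition of
`J`. -/
noncomputable def betaWeight (d : ℕ) (y : ℝ) : ℝ :=
  (1 - y) ^ (((d : ℝ) - 1) / 2) * y ^ (-(1 / 2) : ℝ)

lemma betaWeight_nonneg (d : ℕ) {y : ℝ} (hy : y ∈ Set.Ioo (0 : ℝ) 1) : 0 ≤ betaWeight d y :=
  mul_nonneg (Real.rpow_nonneg (sub_nonneg.2 hy.2.le) _) (Real.rpow_nonneg hy.1.le _)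

lemma measurable_betaWeight (d : ℕ) : Measurable (betaWeight d) := by
  unfold betaWeight
  fun_prop

lemma beta_symm (a b : ℝ) : beta a b = beta b a := by
  simp only [beta, mul_comm (Real.Gamma a), add_comm a]

lemma beta_pos_dim (d : ℕ) : 0 < beta (((d : ℝ) + 1) / 2) (1 / 2) :=
  beta_pos (by positivity) (by norm_num)

lemma ofReal_betaWeight {d : ℕ} {y : ℝ} (hy : y ∈ Set.Ioo (0 : ℝ) 1) :
    ENNReal.ofReal (betaWeight d y) = ENNReal.ofReal (beta (((d : ℝ) + 1) / 2) (1 / 2)) *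
      betaPDF (1 / 2) (((d : ℝ) + 1) / 2) y := by
  have hbeta := beta_pos_dim d
  rw [betaPDF_of_pos_lt_one hy.1 hy.2, ← ENNReal.ofReal_mul hbeta.le, beta_symm, betaWeight,
    show (1 / 2 : ℝ) - 1 = -(1 / 2) by norm_num,
    show ((d : ℝ) + 1) / 2 - 1 = ((d : ℝ) - 1) / 2 by ring]
  rw [beta_symm] at hbeta
  field_simp

lemma lintegral_betaWeight (d : ℕ) :
    ∫⁻ y in Set.Ioo (0 : ℝ) 1, ENNReal.ofReal (betaWeight d y)
      = ENNReal.ofReal (beta (((d : ℝ) + 1) / 2) (1 / 2)) := by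
  have hPDF := lintegral_betaPDF_eq_one (α := 1 / 2) (β := ((d : ℝ) + 1) / 2) (by norm_num)
    (by positivity)
  rw [lintegral_betaPDF, ← setLIntegral_congr_fun measurableSet_Ioo fun y hy =>
    betaPDF_of_pos_lt_one hy.1 hy.2] at hPDF
  rw [setLIntegral_congr_fun measurableSet_Ioo fun y hy => ofReal_betaWeight hy,
    lintegral_const_mul' _ _ ENNReal.ofReal_ne_top, hPDF, mul_one]

lemma integrableOn_betaWeight (d : ℕ) : IntegrableOn (betaWeight d) (Set.Ioo 0 1) := by
  refine ⟨(measurable_betaWeight d).aestronglyMeasurable, ?_⟩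
  rw [hasFiniteIntegral_iff_ofReal, lintegral_betaWeight]
  · exact ENNReal.ofReal_lt_top
  · exact (ae_restrict_mem measurableSet_Ioo).mono fun y hy => betaWeight_nonneg d hy

lemma integral_betaWeight (d : ℕ) :
    ∫ y in Set.Ioo (0 : ℝ) 1, betaWeight d y = beta (((d : ℝ) + 1) / 2) (1 / 2) := by
  rw [integral_eq_lintegral_of_nonneg_ae ((ae_restrict_mem measurableSet_Ioo).mono fun y hy =>
    betaWeight_nonneg d hy) (measurable_betaWeight d).aestronglyMeasurable, lintegral_betaWeight,
    ENNReal.toReal_ofReal (beta_pos_dim d).le]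

end BetaWeight

section Overlap

/-- The volume of the intersection of two balls of radius `r`, as a function of the vector between
the centres. -/
noncomputable def overlap {d : ℕ} (r : ℝ) (v : EuclideanSpace ℝ (Fin d)) : ℝ :=
  volume.real {y : EuclideanSpace ℝ (Fin d) | ‖y‖ ≤ r ∧ ‖y + v‖ ≤ r}

lemma overlap_zero {d : ℕ} (r : ℝ) : overlap r (0 : EuclideanSpace ℝ (Fin d))
    = volume.real (Metric.closedBall (0 : EuclideanSpace ℝ (Fin d)) r) := by
  unfold overlap
  congr 1
  ext y
  simp

lemma measurableSet_overlap {d : ℕ} (r : ℝ) :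
    MeasurableSet {p : EuclideanSpace ℝ (Fin d) × EuclideanSpace ℝ (Fin d) |
      ‖p.2‖ ≤ r ∧ ‖p.2 + p.1‖ ≤ r} := by
  measurability

lemma measurable_overlap {d : ℕ} (r : ℝ) :
    Measurable (overlap r : EuclideanSpace ℝ (Fin d) → ℝ) :=
  (measurable_measure_prodMk_left (ν := volume) (measurableSet_overlap r)).ennreal_toReal

lemma overlap_eq_of_norm_eq {d : ℕ} (r : ℝ) {v w : EuclideanSpace ℝ (Fin d)} (h : ‖v‖ = ‖w‖) :
    overlap r v = overlap r w := by
  let f := (Submodule.span ℝ {v - w})ᗮ.reflection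
  have hf : f v = w := Submodule.reflection_sub h
  have hpre : f ⁻¹' {y | ‖y‖ ≤ r ∧ ‖y + w‖ ≤ r} = {y | ‖y‖ ≤ r ∧ ‖y + v‖ ≤ r} := by
    ext y
    change ‖f y‖ ≤ r ∧ ‖f y + w‖ ≤ r ↔ ‖y‖ ≤ r ∧ ‖y + v‖ ≤ r
    rw [← hf, ← map_add, f.norm_map, f.norm_map]
  rw [overlap, overlap, ← hpre]
  exact f.measurePreserving.measureReal_preimage
    (measurable_prodMk_left (measurableSet_overlap r)).nullMeasurableSet

/-- The volume of the slice at height `x` of the ball of radius `r` in `ℝⁿ⁺¹`. -/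
noncomputable def sliceVolume (n : ℕ) (r x : ℝ) : ℝ :=
  volume.real {z : EuclideanSpace ℝ (Fin n) | x ^ 2 + ‖z‖ ^ 2 ≤ r ^ 2}

lemma sliceVolume_mul_sqrt (n : ℕ) {r : ℝ} (hr : 0 < r) {y : ℝ} (hy : 0 ≤ y) :
    sliceVolume n r (r * √y) = (Set.Iic 1).indicator (fun y => r ^ n *
      volume.real (Metric.ball (0 : EuclideanSpace ℝ (Fin n)) 1) * (1 - y) ^ ((n : ℝ) / 2)) y := by
  rw [sliceVolume, mul_pow, Real.sq_sqrt hy]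
  by_cases hy1 : y ≤ 1
  · have hball : {z : EuclideanSpace ℝ (Fin n) | r ^ 2 * y + ‖z‖ ^ 2 ≤ r ^ 2}
        = Metric.closedBall 0 (r * √(1 - y)) := by
      ext z
      rw [mem_closedBall_zero_iff, ← sq_le_sq₀ (norm_nonneg _) (by positivity), mul_pow,
        Real.sq_sqrt (sub_nonneg.2 hy1), mul_sub, mul_one, le_sub_iff_add_le']
      rfl
    have hsqrt : √(1 - y) ^ n = (1 - y) ^ ((n : ℝ) / 2) := by
      rw [Real.sqrt_eq_rpow, ← Real.rpow_mul_natCast (sub_nonneg.2 hy1)]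
      ring_nf
    rw [Set.indicator_of_mem (Set.mem_Iic.2 hy1), hball, measureReal_def,
      Measure.addHaar_closedBall _ _ (by positivity), ENNReal.toReal_mul,
      ENNReal.toReal_ofReal (by positivity), finrank_euclideanSpace_fin, mul_pow, hsqrt,
      mul_right_comm]
    rfl
  · have hempty : {z : EuclideanSpace ℝ (Fin n) | r ^ 2 * y + ‖z‖ ^ 2 ≤ r ^ 2} = ∅ := by
      refine Set.eq_empty_of_forall_notMem fun z (hz : r ^ 2 * y + ‖z‖ ^ 2 ≤ r ^ 2) => hy1 ?_
      have : 0 < r ^ 2 := by positivity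
      nlinarith [sq_nonneg ‖z‖]
    rw [hempty, measureReal_empty, Set.indicator_of_notMem (Set.notMem_Iic.2 (not_le.1 hy1))]

lemma volume_real_slice_inter (n : ℕ) (r t : ℝ) {a : ℝ} (ha : 0 ≤ a) :
    volume.real {z : EuclideanSpace ℝ (Fin n) |
      t ^ 2 + ‖z‖ ^ 2 ≤ r ^ 2 ∧ (t + a) ^ 2 + ‖z‖ ^ 2 ≤ r ^ 2}
      = sliceVolume n r (|t + a / 2| + a / 2) := by
  have hmax : (|t + a / 2| + a / 2) ^ 2 = max (t ^ 2) ((t + a) ^ 2) := by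
    rcases le_total 0 (t + a / 2) with h | h
    · rw [abs_of_nonneg h, max_eq_right (by nlinarith)]
      ring
    · rw [abs_of_nonpos h, max_eq_left (by nlinarith)]
      ring
  simp_rw [sliceVolume, hmax, ← le_sub_iff_add_le, max_le_iff]

lemma exists_measurePreserving_slice (n : ℕ) :
    ∃ Φ : EuclideanSpace ℝ (Fin (n + 1)) → ℝ × EuclideanSpace ℝ (Fin n),
      MeasurePreserving Φ volume volume ∧ (∀ y, ‖y‖ ^ 2 = (Φ y).1 ^ 2 + ‖(Φ y).2‖ ^ 2) ∧
      ∀ y a, Φ (y + EuclideanSpace.single 0 a) = ((Φ y).1 + a, (Φ y).2) := by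
  refine ⟨fun y => Prod.map id (WithLp.toLp 2)
      (MeasurableEquiv.piFinSuccAbove (fun _ => ℝ) 0 (WithLp.ofLp y)),
    ((MeasurePreserving.id volume).prod (PiLp.volume_preserving_toLp (Fin n))).comp
      ((volume_preserving_piFinSuccAbove (fun _ => ℝ) 0).comp
        (PiLp.volume_preserving_ofLp (Fin (n + 1)))), fun y => ?_, fun y a => ?_⟩
  · rw [EuclideanSpace.norm_sq_eq, EuclideanSpace.norm_sq_eq, Fin.sum_univ_succ]
    simp [MeasurableEquiv.piFinSuccAbove, Fin.tail]
  · refine Prod.ext ?_ ?_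
    · simp [MeasurableEquiv.piFinSuccAbove]
    · ext i
      simp [MeasurableEquiv.piFinSuccAbove, Fin.tail]

lemma overlap_single_eq_integral (n : ℕ) {r a : ℝ} (hr : 0 ≤ r) (ha : 0 ≤ a) :
    overlap r (EuclideanSpace.single (0 : Fin (n + 1)) a)
      = ∫ t : ℝ, sliceVolume n r (|t + a / 2| + a / 2) := by
  obtain ⟨Φ, hΦ, hnorm, hadd⟩ := exists_measurePreserving_slice n
  let S : Set (ℝ × EuclideanSpace ℝ (Fin n)) :=
    {p | p.1 ^ 2 + ‖p.2‖ ^ 2 ≤ r ^ 2 ∧ (p.1 + a) ^ 2 + ‖p.2‖ ^ 2 ≤ r ^ 2}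
  have hS : MeasurableSet S := by measurability
  have hpre : Φ ⁻¹' S = {y | ‖y‖ ≤ r ∧ ‖y + EuclideanSpace.single 0 a‖ ≤ r} := by
    ext y
    have hnorm_add := hnorm (y + EuclideanSpace.single 0 a)
    rw [hadd] at hnorm_add
    simp_rw [Set.mem_ofPred_eq, ← sq_le_sq₀ (norm_nonneg _) hr, hnorm_add, hnorm y]
    rfl
  have hvol := hΦ.measure_preimage hS.nullMeasurableSet
  rw [hpre, Measure.volume_eq_prod, Measure.prod_apply hS] at hvol
  rw [overlap, measureReal_def, hvol, ← integral_toReal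
    (measurable_measure_prodMk_left hS).aemeasurable (ae_of_all _ fun t => ?_)]
  · exact integral_congr_ae (ae_of_all _ fun t => volume_real_slice_inter n r t ha)
  · refine (measure_mono (t := Metric.closedBall 0 r) fun z hz => ?_).trans_lt
      measure_closedBall_lt_top
    rw [mem_closedBall_zero_iff, ← sq_le_sq₀ (norm_nonneg _) hr]
    exact (le_add_of_nonneg_left (sq_nonneg t)).trans hz.1

lemma overlap_single_eq_setIntegral (n : ℕ) {r a : ℝ} (hr : 0 ≤ r) (ha : 0 ≤ a) :
    overlap r (EuclideanSpace.single (0 : Fin (n + 1)) a)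
      = 2 * ∫ x in Set.Ioi (a / 2), sliceVolume n r x := by
  have hshift : ∫ x in Set.Ioi (a / 2), sliceVolume n r x
      = ∫ x in Set.Ioi (0 : ℝ), sliceVolume n r (x + a / 2) := by
    rw [← integral_indicator measurableSet_Ioi, ← integral_indicator measurableSet_Ioi,
      ← integral_add_right_eq_self _ (a / 2)]
    simp [Set.indicator_apply]
  rw [hshift, overlap_single_eq_integral n hr ha,
    integral_add_right_eq_self (fun t : ℝ => sliceVolume n r (|t| + a / 2)) (a / 2),
    integral_comp_abs (f := fun t => sliceVolume n r (t + a / 2))]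

lemma overlap_single_eq (n : ℕ) {r a : ℝ} (hr : 0 < r) (ha : 0 ≤ a) :
    overlap r (EuclideanSpace.single (0 : Fin (n + 1)) a)
      = r ^ (n + 1) * volume.real (Metric.ball (0 : EuclideanSpace ℝ (Fin n)) 1) *
        ∫ y in Set.Ioo (0 : ℝ) 1,
          (Set.Ioi (a ^ 2 / (4 * r ^ 2))).indicator (betaWeight (n + 1)) y := by
  set q := a ^ 2 / (4 * r ^ 2)
  have hq : 0 ≤ q := by positivity
  have hsqrt : r * √q = a / 2 := by
    rw [show q = (a / (2 * r)) ^ 2 by simp only [q]; ring, Real.sqrt_sq (by positivity)]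
    field_simp
  have hslice (y : ℝ) (hy : y ∈ Set.Ioi q) :
      (r / 2 * y ^ (-(1 / 2) : ℝ)) • sliceVolume n r (r * √y)
        = r ^ (n + 1) * volume.real (Metric.ball (0 : EuclideanSpace ℝ (Fin n)) 1) / 2 *
          (Set.Iic 1).indicator (betaWeight (n + 1)) y := by
    rw [sliceVolume_mul_sqrt n hr (hq.trans hy.le)]
    simp only [Set.indicator_apply, betaWeight, Nat.cast_add_one, add_sub_cancel_right, smul_eq_mul]
    split_ifs
    · ring
    · simp
  have hset : (Set.Ioi q ∩ Set.Iic 1 : Set ℝ) =ᵐ[volume] (Set.Ioo 0 1 ∩ Set.Ioi q : Set ℝ) := by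
    rw [Set.Ioi_inter_Iic, Set.Ioo_inter_Ioi, sup_eq_right.2 hq]
    exact Ioo_ae_eq_Ioc.symm
  rw [overlap_single_eq_setIntegral n hr.le ha, ← hsqrt, ← integral_Ioi_comp_mul_sqrt _ hr hq,
    setIntegral_congr_fun measurableSet_Ioi hslice, integral_const_mul,
    setIntegral_indicator measurableSet_Iic, setIntegral_indicator measurableSet_Ioi,
    setIntegral_congr_set hset]
  ring

theorem overlap_eq {d : ℕ} (hd : 1 ≤ d) {r : ℝ} (hr : 0 < r) (v : EuclideanSpace ℝ (Fin d)) :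
    overlap r v = volume.real (Metric.closedBall (0 : EuclideanSpace ℝ (Fin d)) r) /
      beta (((d : ℝ) + 1) / 2) (1 / 2) *
        ∫ y in Set.Ioo (0 : ℝ) 1, (Set.Ioi (‖v‖ ^ 2 / (4 * r ^ 2))).indicator (betaWeight d) y := by
  obtain ⟨n, rfl⟩ := Nat.exists_eq_add_of_le' hd
  have hball : overlap r (EuclideanSpace.single (0 : Fin (n + 1)) 0)
      = volume.real (Metric.closedBall (0 : EuclideanSpace ℝ (Fin (n + 1))) r) := by
    rw [← overlap_zero]
    congr 1
    ext i
    simp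
  have hbeta : ∫ y in Set.Ioo (0 : ℝ) 1,
      (Set.Ioi ((0 : ℝ) ^ 2 / (4 * r ^ 2))).indicator (betaWeight (n + 1)) y
        = beta (((n + 1 : ℕ) + 1) / 2) (1 / 2) := by
    rw [← integral_betaWeight, setIntegral_indicator measurableSet_Ioi, zero_pow two_ne_zero,
      zero_div, Set.inter_eq_left.2 Set.Ioo_subset_Ioi_self]
  rw [overlap_eq_of_norm_eq r (w := EuclideanSpace.single (0 : Fin (n + 1)) ‖v‖) (by simp),
    overlap_single_eq n hr (norm_nonneg v), ← hball, overlap_single_eq n hr le_rfl, hbeta,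
    mul_div_cancel_right₀ _ (beta_pos_dim (n + 1)).ne']

end Overlap

section GaussianNorm

/-- The centred Gaussian law on `ℝᵈ` with covariance `v` times the identity. -/
noncomputable def gaussE (d : ℕ) (v : ℝ≥0) : Measure (EuclideanSpace ℝ (Fin d)) :=
  (Measure.pi fun _ : Fin d => gaussianReal 0 v).map (WithLp.toLp 2)

instance (d : ℕ) (v : ℝ≥0) : IsProbabilityMeasure (gaussE d v) :=
  Measure.isProbabilityMeasure_map (PiLp.volume_preserving_toLp (Fin d)).measurable.aemeasurable

lemma pi_gaussianReal {ι : Type*} [Fintype ι] {v : ℝ≥0} (hv : v ≠ 0) :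
    (Measure.pi fun _ : ι => gaussianReal 0 v)
      = volume.withDensity fun x => ENNReal.ofReal (∏ i, gaussianPDFReal 0 v (x i)) := by
  refine Measure.pi_eq fun s hs => ?_
  have hint : Integrable (fun x : ι → ℝ => ∏ i, gaussianPDFReal 0 v (x i)) :=
    Integrable.fintype_prod fun _ => integrable_gaussianPDFReal 0 v
  have hindicator (x : ι → ℝ) : (Set.univ.pi s).indicator
      (fun x => ∏ i, gaussianPDFReal 0 v (x i)) x
      = ∏ i, (s i).indicator (gaussianPDFReal 0 v) (x i) := by
    by_cases hx : x ∈ Set.univ.pi s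
    · rw [Set.indicator_of_mem hx]
      exact Finset.prod_congr rfl fun i _ =>
        (Set.indicator_of_mem (hx i (Set.mem_univ i)) _).symm
    · obtain ⟨i, hi⟩ : ∃ i, x i ∉ s i := by simpa using hx
      rw [Set.indicator_of_notMem hx, Finset.prod_eq_zero (Finset.mem_univ i)
        (Set.indicator_of_notMem hi _)]
  rw [withDensity_apply _ (MeasurableSet.univ_pi hs), ← ofReal_integral_eq_lintegral_ofReal
    hint.integrableOn (ae_of_all _ fun x => Finset.prod_nonneg fun i _ =>
      gaussianPDFReal_nonneg _ _ _), ← integral_indicator (MeasurableSet.univ_pi hs)]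
  simp_rw [hindicator]
  rw [integral_fintype_prod_volume_eq_prod (fun i => (s i).indicator (gaussianPDFReal 0 v)),
    ENNReal.ofReal_prod_of_nonneg fun i _ => integral_nonneg fun x =>
      Set.indicator_nonneg (fun _ _ => gaussianPDFReal_nonneg _ _ _) x]
  refine Finset.prod_congr rfl fun i _ => ?_
  rw [gaussianReal_apply_eq_integral _ hv, integral_indicator (hs i)]

lemma gaussE_eq_withDensity (d : ℕ) {v : ℝ≥0} (hv : v ≠ 0) :
    gaussE d v = volume.withDensity fun z =>
      ENNReal.ofReal ((√(2 * Real.pi * v))⁻¹ ^ d * Real.exp (-‖z‖ ^ 2 / (2 * v))) := by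
  have htoLp := PiLp.volume_preserving_toLp (Fin d)
  ext A hA
  rw [gaussE, Measure.map_apply htoLp.measurable hA, pi_gaussianReal hv,
    withDensity_apply _ (htoLp.measurable hA), withDensity_apply _ hA,
    ← htoLp.setLIntegral_comp_preimage hA (by fun_prop)]
  refine setLIntegral_congr_fun (htoLp.measurable hA) fun x _ => ?_
  simp only [gaussianPDFReal]
  rw [Finset.prod_mul_distrib, Finset.prod_const, ← Real.exp_sum, EuclideanSpace.norm_sq_eq]
  simp [Finset.sum_div, Finset.sum_neg_distrib, neg_div]

lemma integral_comp_norm_sq {E F : Type*} [NormedAddCommGroup E] [NormedSpace ℝ E]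
    [FiniteDimensional ℝ E] [Nontrivial E] [MeasurableSpace E] [BorelSpace E]
    (μ : Measure E) [μ.IsAddHaarMeasure] [NormedAddCommGroup F] [NormedSpace ℝ F] (f : ℝ → F) :
    ∫ z, f (‖z‖ ^ 2) ∂μ = (Module.finrank ℝ E * μ.real (Metric.ball 0 1) / 2) •
      ∫ u in Set.Ioi (0 : ℝ), u ^ ((Module.finrank ℝ E : ℝ) / 2 - 1) • f u := by
  have hsubst := integral_Ioi_comp_mul_sqrt
    (fun y => y ^ (Module.finrank ℝ E - 1) • f (y ^ 2)) one_pos le_rfl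
  rw [integral_fun_norm_addHaar μ (fun y => f (y ^ 2))]
  rw [Real.sqrt_zero, mul_zero] at hsubst
  have hpow (u : ℝ) (hu : u ∈ Set.Ioi 0) :
      (1 / 2 * u ^ (-(1 / 2) : ℝ)) • (1 * √u) ^ (Module.finrank ℝ E - 1) • f ((1 * √u) ^ 2)
        = (2⁻¹ : ℝ) • u ^ ((Module.finrank ℝ E : ℝ) / 2 - 1) • f u := by
    have hu : 0 < u := hu
    rw [one_mul, Real.sq_sqrt hu.le, Real.sqrt_eq_rpow, ← Real.rpow_mul_natCast hu.le, smul_smul,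
      smul_smul, mul_assoc, ← Real.rpow_add hu, Nat.cast_sub Module.finrank_pos, one_div]
    congr 3
    push_cast
    ring
  rw [← hsubst, setIntegral_congr_fun measurableSet_Ioi hpow, integral_smul,
    ← Nat.cast_smul_eq_nsmul ℝ, smul_smul, smul_smul]
  rfl

lemma gammaMeasure_real {a r : ℝ} (ha : 0 < a) (hr : 0 < r) {s : Set ℝ} (hs : MeasurableSet s) :
    (gammaMeasure a r).real s = ∫ u in Set.Ioi (0 : ℝ), s.indicator
      (fun u => r ^ a / Real.Gamma a * u ^ (a - 1) * Real.exp (-(r * u))) u := by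
  rw [measureReal_def, gammaMeasure, withDensity_apply _ hs, ← integral_indicator measurableSet_Ioi]
  simp_rw [gammaPDF]
  rw [← integral_eq_lintegral_of_nonneg_ae (ae_of_all _ (gammaPDFReal_nonneg ha hr))
    (measurable_gammaPDFReal a r).aestronglyMeasurable, ← integral_indicator hs]
  refine integral_congr_ae ?_
  filter_upwards [measure_eq_zero_iff_ae_notMem.1 (measure_singleton (μ := volume) (0 : ℝ))]
    with u hu
  rcases lt_or_gt_of_ne hu with hneg | hpos
  · simp [gammaPDFReal, hneg.not_ge, hneg.not_gt]
  · rw [Set.indicator_of_mem (Set.mem_Ioi.2 hpos)]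
    by_cases hmem : u ∈ s <;> simp [gammaPDFReal, hpos.le, hmem]

lemma exists_gaussE_norm_sq_real_eq {d : ℕ} (hd : 1 ≤ d) {v : ℝ≥0} (hv : v ≠ 0) :
    ∃ c : ℝ, ∀ s, MeasurableSet s → ((gaussE d v).map fun z => ‖z‖ ^ 2).real s
      = c * (gammaMeasure (d / 2) (2 * v)⁻¹).real s := by
  have : Nonempty (Fin d) := ⟨⟨0, hd⟩⟩
  have ha : (0 : ℝ) < d / 2 := by positivity
  have hr : (0 : ℝ) < (2 * (v : ℝ))⁻¹ := by positivity
  refine ⟨d * volume.real (Metric.ball (0 : EuclideanSpace ℝ (Fin d)) 1) / 2 *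
    ((√(2 * Real.pi * v))⁻¹ ^ d / ((2 * (v : ℝ))⁻¹ ^ ((d : ℝ) / 2) / Real.Gamma (d / 2))),
    fun s hs => ?_⟩
  have hpre : MeasurableSet ((fun z : EuclideanSpace ℝ (Fin d) => ‖z‖ ^ 2) ⁻¹' s) :=
    (show Measurable fun z : EuclideanSpace ℝ (Fin d) => ‖z‖ ^ 2 by fun_prop) hs
  have hdensity : ((gaussE d v).map fun z => ‖z‖ ^ 2).real s
      = ∫ z : EuclideanSpace ℝ (Fin d), s.indicator
          (fun x => (√(2 * Real.pi * v))⁻¹ ^ d * Real.exp (-x / (2 * v))) (‖z‖ ^ 2) := by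
    rw [map_measureReal_apply (by fun_prop) hs, measureReal_def, gaussE_eq_withDensity d hv,
      withDensity_apply _ hpre, ← integral_eq_lintegral_of_nonneg_ae
        (f := fun z => (√(2 * Real.pi * v))⁻¹ ^ d * Real.exp (-‖z‖ ^ 2 / (2 * v)))
        (ae_of_all _ fun z => by positivity) (by fun_prop), ← integral_indicator hpre]
    rfl
  rw [hdensity, integral_comp_norm_sq, gammaMeasure_real ha hr hs, finrank_euclideanSpace_fin,
    smul_eq_mul, mul_assoc _ _ (∫ _ in _, _)]
  congr 1
  rw [← integral_const_mul]
  refine setIntegral_congr_fun measurableSet_Ioi fun u _ => ?_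
  rw [smul_eq_mul]
  by_cases hmem : u ∈ s
  · have hne : (2 * (v : ℝ))⁻¹ ^ ((d : ℝ) / 2) / Real.Gamma (d / 2) ≠ 0 :=
      (div_pos (Real.rpow_pos_of_pos hr _) (Real.Gamma_pos_of_pos ha)).ne'
    rw [Set.indicator_of_mem hmem, Set.indicator_of_mem hmem, mul_assoc (_ / _) (_ ^ _),
      ← mul_assoc (_ / (_ / _)), div_mul_cancel₀ _ hne, neg_div, div_eq_inv_mul u]
    ring
  · simp [hmem]

theorem map_norm_sq_gaussE {d : ℕ} (hd : 1 ≤ d) {v : ℝ≥0} (hv : v ≠ 0) :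
    ((gaussE d v).map fun z => ‖z‖ ^ 2) = gammaMeasure (d / 2) (2 * v)⁻¹ := by
  obtain ⟨c, hc⟩ := exists_gaussE_norm_sq_real_eq hd hv
  have := isProbabilityMeasure_gammaMeasure (a := d / 2) (r := (2 * v)⁻¹) (by positivity)
    (by positivity)
  have := Measure.isProbabilityMeasure_map (μ := gaussE d v)
    (show Measurable fun z : EuclideanSpace ℝ (Fin d) => ‖z‖ ^ 2 by fun_prop).aemeasurable
  have hone : c = 1 := by
    simpa only [probReal_univ, mul_one, eq_comm] using hc Set.univ MeasurableSet.univ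
  ext s hs
  rw [← measureReal_eq_measureReal_iff, hc s hs, hone, one_mul]

lemma gaussE_real_norm_sq_lt {d : ℕ} (hd : 1 ≤ d) {v : ℝ≥0} (hv : v ≠ 0) {q : ℝ} (hq : 0 ≤ q) :
    (gaussE d v).real {z | ‖z‖ ^ 2 < q} =
      lowerGamma ((d : ℝ) / 2) (q / (2 * v)) / Real.Gamma ((d : ℝ) / 2) := by
  have hv' : (0 : ℝ) < (2 * (v : ℝ))⁻¹ := by positivity
  have hmap : (gaussE d v).real {z | ‖z‖ ^ 2 < q}
      = (gammaMeasure (d / 2) (2 * v)⁻¹).real (Set.Iio q) := by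
    rw [← map_norm_sq_gaussE hd hv, map_measureReal_apply (by fun_prop) measurableSet_Iio]
    rfl
  rw [hmap, gammaMeasure_real (by positivity) hv' measurableSet_Iio,
    setIntegral_indicator measurableSet_Iio, Set.Ioi_inter_Iio, ← integral_Ioc_eq_integral_Ioo,
    ← intervalIntegral.integral_of_le hq, lowerGamma, div_eq_inv_mul q]
  have hsubst := intervalIntegral.mul_integral_comp_mul_left (a := 0) (b := q)
    (f := fun u : ℝ => u ^ ((d : ℝ) / 2 - 1) * Real.exp (-u)) (2 * (v : ℝ))⁻¹
  rw [mul_zero] at hsubst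
  rw [← hsubst, ← intervalIntegral.integral_const_mul, ← intervalIntegral.integral_div]
  refine intervalIntegral.integral_congr fun u hu => ?_
  rw [Set.uIcc_of_le hq] at hu
  rw [Real.mul_rpow hv'.le hu.1, Real.rpow_sub_one hv'.ne']
  field_simp

end GaussianNorm

section LowerGamma

variable {s : ℝ}

lemma intervalIntegrable_rpow_mul_exp_neg (hs : 0 < s) (a b : ℝ) :
    IntervalIntegrable (fun u : ℝ => u ^ (s - 1) * Real.exp (-u)) volume a b :=
  (intervalIntegral.intervalIntegrable_rpow' (by linarith)).mul_continuousOn (by fun_prop)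

lemma continuous_lowerGamma (hs : 0 < s) : Continuous (lowerGamma s) :=
  intervalIntegral.continuous_primitive (fun a b => intervalIntegrable_rpow_mul_exp_neg hs a b) 0

lemma lowerGamma_mono (hs : 0 < s) {x y : ℝ} (hx : 0 ≤ x) (hxy : x ≤ y) :
    lowerGamma s x ≤ lowerGamma s y := by
  refine intervalIntegral.integral_mono_interval le_rfl hx hxy ?_
    (intervalIntegrable_rpow_mul_exp_neg hs 0 y)
  filter_upwards [ae_restrict_mem measurableSet_Ioc] with u hu
  exact mul_nonneg (Real.rpow_nonneg hu.1.le _) (Real.exp_pos _).le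

lemma lowerGamma_nonneg (hs : 0 < s) {x : ℝ} (hx : 0 ≤ x) : 0 ≤ lowerGamma s x := by
  simpa [lowerGamma] using lowerGamma_mono hs le_rfl hx

lemma lowerGamma_pos (hs : 0 < s) {x : ℝ} (hx : 0 < x) : 0 < lowerGamma s x :=
  intervalIntegral.intervalIntegral_pos_of_pos_on (intervalIntegrable_rpow_mul_exp_neg hs 0 x)
    (fun _ hu => mul_pos (Real.rpow_pos_of_pos hu.1 _) (Real.exp_pos _)) hx

lemma lowerGamma_le_rpow (hs : 0 < s) {x : ℝ} (hx : 0 ≤ x) : lowerGamma s x ≤ x ^ s / s := by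
  have hprimitive : ∫ u in (0 : ℝ)..x, u ^ (s - 1) = x ^ s / s := by
    rw [integral_rpow (Or.inl (by linarith)), sub_add_cancel, Real.zero_rpow hs.ne', sub_zero]
  rw [← hprimitive]
  refine intervalIntegral.integral_mono_on hx (intervalIntegrable_rpow_mul_exp_neg hs 0 x)
    (intervalIntegral.intervalIntegrable_rpow' (by linarith)) fun u hu => ?_
  exact mul_le_of_le_one_right (Real.rpow_nonneg hu.1 _)
    (Real.exp_le_one_iff.2 (by linarith [hu.1]))

lemma lowerGamma_le_Gamma (hs : 0 < s) {x : ℝ} (hx : 0 ≤ x) : lowerGamma s x ≤ Real.Gamma s := by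
  rw [lowerGamma, intervalIntegral.integral_of_le hx, Real.Gamma_eq_integral hs]
  simp_rw [mul_comm (_ ^ (s - 1))]
  refine setIntegral_mono_set (Real.GammaIntegral_convergent hs) ?_
    Set.Ioc_subset_Ioi_self.eventuallyLE
  filter_upwards [ae_restrict_mem measurableSet_Ioi] with u hu
  exact mul_nonneg (Real.exp_pos _).le (Real.rpow_nonneg (le_of_lt hu) _)

end LowerGamma

section JFunction

variable {d : ℕ}

lemma J_eq (d : ℕ) (r t : ℝ) :
    J d r t = (beta (((d : ℝ) + 1) / 2) (1 / 2) * Real.Gamma ((d : ℝ) / 2))⁻¹ *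
      ∫ y in Set.Ioo (0 : ℝ) 1, lowerGamma ((d : ℝ) / 2) (2 * r ^ 2 * y / t) * betaWeight d y := by
  rw [J, intervalIntegral.integral_of_le zero_le_one, integral_Ioc_eq_integral_Ioo, one_div]
  simp_rw [mul_assoc, betaWeight]

lemma inv_beta_mul_Gamma_pos (hd : 1 ≤ d) :
    0 < (beta (((d : ℝ) + 1) / 2) (1 / 2) * Real.Gamma ((d : ℝ) / 2))⁻¹ :=
  inv_pos.2 (mul_pos (beta_pos_dim d) (Real.Gamma_pos_of_pos (by positivity)))

lemma two_mul_sq_mul_div_nonneg (r : ℝ) {t y : ℝ} (ht : 0 ≤ t) (hy : y ∈ Set.Ioo (0 : ℝ) 1) :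
    0 ≤ 2 * r ^ 2 * y / t :=
  div_nonneg (mul_nonneg (by positivity) hy.1.le) ht

lemma integrableOn_lowerGamma_mul_betaWeight (hd : 1 ≤ d) (r : ℝ) {t : ℝ} (ht : 0 ≤ t) :
    IntegrableOn (fun y => lowerGamma ((d : ℝ) / 2) (2 * r ^ 2 * y / t) * betaWeight d y)
      (Set.Ioo 0 1) := by
  have hs : (0 : ℝ) < d / 2 := by positivity
  refine (integrableOn_betaWeight d).bdd_mul (c := Real.Gamma ((d : ℝ) / 2)) ?_ ?_
  · exact ((continuous_lowerGamma hs).comp (by fun_prop)).aestronglyMeasurable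
  · filter_upwards [ae_restrict_mem measurableSet_Ioo] with y hy
    have harg := two_mul_sq_mul_div_nonneg r ht hy
    rw [Real.norm_eq_abs, abs_of_nonneg (lowerGamma_nonneg hs harg)]
    exact lowerGamma_le_Gamma hs harg

lemma J_nonneg (hd : 1 ≤ d) (r : ℝ) {t : ℝ} (ht : 0 ≤ t) : 0 ≤ J d r t := by
  rw [J_eq]
  exact mul_nonneg (inv_beta_mul_Gamma_pos hd).le (setIntegral_nonneg measurableSet_Ioo fun y hy =>
    mul_nonneg (lowerGamma_nonneg (by positivity) (two_mul_sq_mul_div_nonneg r ht hy))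
      (betaWeight_nonneg d hy))

lemma J_le_of_lowerGamma_le (hd : 1 ≤ d) {r t M : ℝ} (ht : 0 ≤ t)
    (hM : ∀ y ∈ Set.Ioo (0 : ℝ) 1, lowerGamma ((d : ℝ) / 2) (2 * r ^ 2 * y / t) ≤ M) :
    J d r t ≤ M / Real.Gamma ((d : ℝ) / 2) := by
  have hle : ∫ y in Set.Ioo (0 : ℝ) 1,
      lowerGamma ((d : ℝ) / 2) (2 * r ^ 2 * y / t) * betaWeight d y
      ≤ M * beta (((d : ℝ) + 1) / 2) (1 / 2) := by
    rw [← integral_betaWeight, ← integral_const_mul]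
    exact setIntegral_mono_on (integrableOn_lowerGamma_mul_betaWeight hd r ht)
      ((integrableOn_betaWeight d).const_mul _) measurableSet_Ioo fun y hy =>
        mul_le_mul_of_nonneg_right (hM y hy) (betaWeight_nonneg d hy)
  have hbeta := beta_pos_dim d
  rw [J_eq]
  refine (mul_le_mul_of_nonneg_left hle (inv_beta_mul_Gamma_pos hd).le).trans_eq ?_
  field_simp

lemma J_le_one (hd : 1 ≤ d) (r : ℝ) {t : ℝ} (ht : 0 ≤ t) : J d r t ≤ 1 := by
  have hs : (0 : ℝ) < d / 2 := by positivity
  refine (J_le_of_lowerGamma_le hd ht fun y hy =>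
    lowerGamma_le_Gamma hs (two_mul_sq_mul_div_nonneg r ht hy)).trans_eq ?_
  exact div_self (Real.Gamma_pos_of_pos hs).ne'

/-- The constant in the bound `J(t) ≤ decayConst d * (r² / t) ^ (d / 2)`. -/
noncomputable def decayConst (d : ℕ) : ℝ :=
  2 ^ ((d : ℝ) / 2) / ((d : ℝ) / 2 * Real.Gamma ((d : ℝ) / 2))

lemma decayConst_pos (hd : 1 ≤ d) : 0 < decayConst d :=
  div_pos (by positivity) (mul_pos (by positivity) (Real.Gamma_pos_of_pos (by positivity)))

lemma J_le_rpow (hd : 1 ≤ d) (r : ℝ) {t : ℝ} (ht : 0 < t) :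
    J d r t ≤ decayConst d * (r ^ 2 / t) ^ ((d : ℝ) / 2) := by
  have hs : (0 : ℝ) < d / 2 := by positivity
  refine (J_le_of_lowerGamma_le (M := (2 * (r ^ 2 / t)) ^ ((d : ℝ) / 2) / ((d : ℝ) / 2)) hd ht.le
    fun y hy => ?_).trans_eq ?_
  · have harg := two_mul_sq_mul_div_nonneg r ht.le hy
    have hle : 2 * r ^ 2 * y / t ≤ 2 * (r ^ 2 / t) := by
      rw [mul_div_assoc', div_le_div_iff_of_pos_right ht]
      exact mul_le_of_le_one_right (by positivity) hy.2.le
    refine (lowerGamma_le_rpow hs harg).trans ?_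
    gcongr
  · rw [Real.mul_rpow (by norm_num) (by positivity), decayConst]
    field_simp

lemma J_one_one_pos (hd : 1 ≤ d) : 0 < J d 1 1 := by
  have hs : (0 : ℝ) < d / 2 := by positivity
  have hpos (y : ℝ) (hy : y ∈ Set.Ioo (0 : ℝ) 1) :
      0 < lowerGamma ((d : ℝ) / 2) (2 * 1 ^ 2 * y / 1) * betaWeight d y :=
    mul_pos (lowerGamma_pos hs (by simpa using hy.1))
      (mul_pos (Real.rpow_pos_of_pos (by linarith [hy.2]) _) (Real.rpow_pos_of_pos hy.1 _))
  rw [J_eq]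
  refine mul_pos (inv_beta_mul_Gamma_pos hd) ?_
  rw [setIntegral_pos_iff_support_of_nonneg_ae
    ((ae_restrict_mem measurableSet_Ioo).mono fun y hy => (hpos y hy).le)
    (integrableOn_lowerGamma_mul_betaWeight hd 1 zero_le_one)]
  refine lt_of_lt_of_le ?_ (measure_mono fun y hy => ⟨(hpos y hy).ne', hy⟩)
  simp

lemma J_one_one_le (hd : 1 ≤ d) {r t : ℝ} (ht : 0 < t) (htr : t ≤ r ^ 2) :
    J d 1 1 ≤ J d r t := by
  rw [J_eq, J_eq]
  refine mul_le_mul_of_nonneg_left (setIntegral_mono_on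
    (integrableOn_lowerGamma_mul_betaWeight hd 1 zero_le_one)
    (integrableOn_lowerGamma_mul_betaWeight hd r ht.le) measurableSet_Ioo fun y hy => ?_)
    (inv_beta_mul_Gamma_pos hd).le
  refine mul_le_mul_of_nonneg_right (lowerGamma_mono (by positivity)
    (two_mul_sq_mul_div_nonneg 1 zero_le_one hy) ?_) (betaWeight_nonneg d hy)
  rw [div_one, le_div_iff₀ ht]
  nlinarith [hy.1]

lemma measurable_J (hd : 1 ≤ d) (r : ℝ) : Measurable (J d r) := by
  have hintegrand : Measurable fun p : ℝ × ℝ =>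
      lowerGamma ((d : ℝ) / 2) (2 * r ^ 2 * p.2 / p.1) * betaWeight d p.2 :=
    ((continuous_lowerGamma (by positivity)).measurable.comp (by fun_prop)).mul
      ((measurable_betaWeight d).comp measurable_snd)
  have hintegral := (hintegrand.stronglyMeasurable.integral_prod_right'
    (ν := volume.restrict (Set.Ioo 0 1))).measurable
  rw [funext (J_eq d r)]
  exact hintegral.const_mul _

end JFunction

section Corr

/-- The correlation function of `N`: the covariance of `N s` and `N (s + u)` is
`rho d lam r * corr d r σ u`. The value at `0` is set by hand since `J d r 0 = 0`. -/
noncomputable def corr (d : ℕ) (r σ u : ℝ) : ℝ := if u = 0 then 1 else J d r (σ ^ 2 * |u|)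

variable {d : ℕ}

lemma corr_zero (d : ℕ) (r σ : ℝ) : corr d r σ 0 = 1 := if_pos rfl

lemma corr_nonneg (hd : 1 ≤ d) (r σ u : ℝ) : 0 ≤ corr d r σ u := by
  unfold corr
  split_ifs
  · exact zero_le_one
  · exact J_nonneg hd r (by positivity)

lemma corr_le_one (hd : 1 ≤ d) (r σ u : ℝ) : corr d r σ u ≤ 1 := by
  unfold corr
  split_ifs
  · exact le_rfl
  · exact J_le_one hd r (by positivity)

lemma corr_neg (d : ℕ) (r σ u : ℝ) : corr d r σ (-u) = corr d r σ u := by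
  simp [corr]

lemma corr_of_pos (d : ℕ) (r σ : ℝ) {u : ℝ} (hu : 0 < u) : corr d r σ u = J d r (σ ^ 2 * u) := by
  rw [corr, if_neg hu.ne', abs_of_pos hu]

lemma measurable_corr (hd : 1 ≤ d) (r σ : ℝ) : Measurable (corr d r σ) := by
  unfold corr
  exact Measurable.ite (measurableSet_singleton 0) measurable_const
    ((measurable_J hd r).comp (by fun_prop))

lemma integrableOn_corr (hd : 1 ≤ d) (r σ : ℝ) {s : Set ℝ} (hs : volume s ≠ ∞) :
    IntegrableOn (corr d r σ) s :=
  Measure.integrableOn_of_bounded hs (measurable_corr hd r σ).aestronglyMeasurable (M := 1)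
    (ae_of_all _ fun u => by
      rw [Real.norm_eq_abs, abs_of_nonneg (corr_nonneg hd r σ u)]
      exact corr_le_one hd r σ u)

lemma corr_le_rpow (hd : 1 ≤ d) (r : ℝ) {σ u : ℝ} (hσ : 0 < σ) (hu : 0 < u) :
    corr d r σ u ≤ decayConst d * ((r / σ) ^ 2) ^ ((d : ℝ) / 2) * u ^ (-((d : ℝ) / 2)) := by
  rw [corr_of_pos d r σ hu, Real.rpow_neg hu.le, mul_assoc, ← div_eq_mul_inv,
    ← Real.div_rpow (by positivity) hu.le, div_pow, div_div]
  exact J_le_rpow hd r (by positivity)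

end Corr

section OverlapMean

lemma integral_indicator_betaWeight_gaussE {d : ℕ} (hd : 1 ≤ d) {r σ : ℝ} (hr : 0 < r)
    (hσ : 0 < σ) {v : ℝ≥0} (hv : v ≠ 0) {y : ℝ} (hy : 0 ≤ y) :
    ∫ z, (Set.Ioi (‖σ • z‖ ^ 2 / (4 * r ^ 2))).indicator (betaWeight d) y ∂(gaussE d v)
      = (Real.Gamma ((d : ℝ) / 2))⁻¹ *
        (lowerGamma ((d : ℝ) / 2) (2 * r ^ 2 * y / (σ ^ 2 * v)) * betaWeight d y) := by
  have : (0 : ℝ) < v := by positivity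
  have hset : ∀ z : EuclideanSpace ℝ (Fin d),
      y ∈ Set.Ioi (‖σ • z‖ ^ 2 / (4 * r ^ 2)) ↔ z ∈ {z | ‖z‖ ^ 2 < 4 * r ^ 2 * y / σ ^ 2} := by
    intro z
    rw [Set.mem_Ioi, Set.mem_ofPred_eq, norm_smul, mul_pow, Real.norm_eq_abs, sq_abs,
      div_lt_iff₀ (by positivity), lt_div_iff₀ (by positivity), mul_comm (σ ^ 2), mul_comm y]
  have hindicator (z : EuclideanSpace ℝ (Fin d)) :
      (Set.Ioi (‖σ • z‖ ^ 2 / (4 * r ^ 2))).indicator (betaWeight d) y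
        = {z | ‖z‖ ^ 2 < 4 * r ^ 2 * y / σ ^ 2}.indicator (fun _ => betaWeight d y) z := by
    simp only [Set.indicator_apply, hset]
  have harg : 4 * r ^ 2 * y / σ ^ 2 / (2 * v) = 2 * r ^ 2 * y / (σ ^ 2 * v) := by
    field_simp
    ring
  simp_rw [hindicator]
  rw [integral_indicator_const _ (measurableSet_lt (by fun_prop) (by fun_prop)),
    gaussE_real_norm_sq_lt hd hv (by positivity), smul_eq_mul, harg]
  ring

theorem integral_overlap_gaussE {d : ℕ} (hd : 1 ≤ d) {r σ : ℝ} (hr : 0 < r) (hσ : 0 < σ)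
    {v : ℝ≥0} (hv : v ≠ 0) :
    ∫ z, overlap r (σ • z) ∂(gaussE d v)
      = volume.real (Metric.closedBall (0 : EuclideanSpace ℝ (Fin d)) r) * J d r (σ ^ 2 * v) := by
  have hbeta := beta_pos_dim d
  set S : Set (EuclideanSpace ℝ (Fin d) × ℝ) := {p | ‖σ • p.1‖ ^ 2 / (4 * r ^ 2) < p.2}
  have hS : MeasurableSet S := measurableSet_lt (by fun_prop) (by fun_prop)
  have hint : Integrable (S.indicator fun p => betaWeight d p.2)
      ((gaussE d v).prod (volume.restrict (Set.Ioo 0 1))) :=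
    (Integrable.comp_snd (integrableOn_betaWeight d) (gaussE d v)).indicator hS
  have hswap : ∫ z, (∫ y in Set.Ioo (0 : ℝ) 1,
      (Set.Ioi (‖σ • z‖ ^ 2 / (4 * r ^ 2))).indicator (betaWeight d) y) ∂(gaussE d v)
      = ∫ y in Set.Ioo (0 : ℝ) 1, (∫ z,
        (Set.Ioi (‖σ • z‖ ^ 2 / (4 * r ^ 2))).indicator (betaWeight d) y ∂(gaussE d v)) :=
    integral_integral_swap (f := fun z y => S.indicator (fun p => betaWeight d p.2) (z, y)) hint
  simp_rw [overlap_eq hd hr]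
  rw [integral_const_mul, hswap, setIntegral_congr_fun measurableSet_Ioo fun y hy =>
    integral_indicator_betaWeight_gaussE hd hr hσ hv hy.1.le, integral_const_mul, J_eq]
  field_simp

end OverlapMean

section Brownian

variable {d : ℕ} {Ω : Type*} [MeasurableSpace Ω] {P : Measure Ω}
  {W W' : ℝ≥0 → Ω → EuclideanSpace ℝ (Fin d)}

lemma IsBrownian.measurable_path (h : IsBrownian W P) : Measurable fun ω t => W t ω :=
  measurable_pi_lambda _ h.measurable

lemma IsBrownian.measurable_coord (h : IsBrownian W P) (t : ℝ≥0) (i : Fin d) :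
    Measurable fun ω => W t ω i := by
  have := h.measurable t
  fun_prop

lemma IsBrownian.isProjectiveLimit_coord (h : IsBrownian W P) (i : Fin d) :
    IsProjectiveLimit (P.map fun ω t => W t ω i) BrownianReal.projectiveFamily := by
  intro I
  rw [Measure.map_map (Finset.measurable_restrict I)
    (measurable_pi_lambda _ fun t => h.measurable_coord t i)]
  exact ((h.coord i).hasLaw I).map_eq

variable [IsProbabilityMeasure P]

lemma IsBrownian.map_path_eq_map_pi (h : IsBrownian W P) :
    P.map (fun ω t => W t ω) = (Measure.pi fun i => P.map fun ω t => W t ω i).map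
      (fun x t => WithLp.toLp 2 fun i => x i t) := by
  have hcoord (i : Fin d) : Measurable fun ω t => W t ω i :=
    measurable_pi_lambda _ fun t => h.measurable_coord t i
  rw [← (iIndepFun_iff_map_fun_eq_pi_map fun i => (hcoord i).aemeasurable).1 h.indep_coord,
    Measure.map_map (by fun_prop) (measurable_pi_lambda _ hcoord)]
  rfl

theorem IsBrownian.map_path_eq (h : IsBrownian W P) (h' : IsBrownian W' P) :
    P.map (fun ω t => W t ω) = P.map (fun ω t => W' t ω) := by
  rw [h.map_path_eq_map_pi, h'.map_path_eq_map_pi]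
  congr 2
  ext1 i
  exact (h.isProjectiveLimit_coord i).unique (h'.isProjectiveLimit_coord i)

theorem IsBrownian.map_sub (h : IsBrownian W P) (s t : ℝ≥0) :
    P.map (fun ω => W t ω - W s ω) = gaussE d (nndist (t : ℝ) s) := by
  have hindep : iIndepFun (fun i ω => W t ω i - W s ω i) P :=
    h.indep_coord.comp (fun _ x => x t - x s) fun _ => by fun_prop
  have hmeas (i : Fin d) : Measurable fun ω => W t ω i - W s ω i :=
    (h.measurable_coord t i).sub (h.measurable_coord s i)
  have hmap := (iIndepFun_iff_map_fun_eq_pi_map fun i => (hmeas i).aemeasurable).1 hindep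
  have hlaw (i : Fin d) :
      P.map (fun ω => W t ω i - W s ω i) = gaussianReal 0 (nndist (t : ℝ) s) :=
    ((h.coord i).hasLaw_sub t s).map_eq
  simp_rw [hlaw] at hmap
  rw [gaussE, ← hmap, Measure.map_map (PiLp.volume_preserving_toLp (Fin d)).measurable
    (measurable_pi_lambda _ hmeas)]
  rfl

lemma IsBrownianSystem.isMarkedPoisson {lam : ℝ≥0} {ξ : ℤ → Ω → EuclideanSpace ℝ (Fin d)}
    {W : ℤ → ℝ≥0 → Ω → EuclideanSpace ℝ (Fin d)} (h : IsBrownianSystem lam ξ W P) :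
    IsMarkedPoisson lam ξ (fun j ω t => W j t ω) (P.map fun ω t => W 0 t ω) P where
  poisson := h.poisson
  measurable j := (h.brownian j).measurable_path
  law j := ⟨(h.brownian j).measurable_path.aemeasurable,
    (h.brownian j).map_path_eq (h.brownian 0)⟩
  iIndep := h.indep_brownian
  indep := h.indep

end Brownian

section VisitSet

variable {d : ℕ}

/-- The marked points `(x, w)`, a position and a path, that are in the ball of radius `r` at
time `t`. -/
def visitSet (d : ℕ) (r σ : ℝ) (t : ℝ≥0) :
    Set (EuclideanSpace ℝ (Fin d) × (ℝ≥0 → EuclideanSpace ℝ (Fin d))) :=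
  {p | p.1 + σ • p.2 t ∈ Metric.closedBall 0 r}

/-- The contribution of a marked point to the count at time `t`. -/
noncomputable def visitIndicator (d : ℕ) (r σ : ℝ) (t : ℝ≥0) :
    EuclideanSpace ℝ (Fin d) × (ℝ≥0 → EuclideanSpace ℝ (Fin d)) → ℝ≥0∞ :=
  (visitSet d r σ t).indicator 1

lemma measurableSet_visitSet (r σ : ℝ) (t : ℝ≥0) : MeasurableSet (visitSet d r σ t) := by
  have : Measurable fun p : EuclideanSpace ℝ (Fin d) × (ℝ≥0 → EuclideanSpace ℝ (Fin d)) =>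
      p.1 + σ • p.2 t := by fun_prop
  exact this measurableSet_closedBall

lemma volume_slice_visitSet_inter (r σ : ℝ) (s t : ℝ≥0) (w : ℝ≥0 → EuclideanSpace ℝ (Fin d)) :
    volume ((fun x => (x, w)) ⁻¹' (visitSet d r σ s ∩ visitSet d r σ t))
      = volume {y : EuclideanSpace ℝ (Fin d) | ‖y‖ ≤ r ∧ ‖y + σ • (w t - w s)‖ ≤ r} := by
  rw [← measure_preimage_add_right volume (σ • w s) {y : EuclideanSpace ℝ (Fin d) |
    ‖y‖ ≤ r ∧ ‖y + σ • (w t - w s)‖ ≤ r}]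
  congr 1
  ext x
  change (x + σ • w s ∈ Metric.closedBall 0 r ∧ x + σ • w t ∈ Metric.closedBall 0 r) ↔
    ‖x + σ • w s‖ ≤ r ∧ ‖x + σ • w s + σ • (w t - w s)‖ ≤ r
  rw [mem_closedBall_zero_iff, mem_closedBall_zero_iff, smul_sub, add_assoc,
    add_sub_cancel]

variable {Q : Measure (ℝ≥0 → EuclideanSpace ℝ (Fin d))} [IsProbabilityMeasure Q]

lemma prod_visitSet_ne_top (r σ : ℝ) (t : ℝ≥0) : (volume.prod Q) (visitSet d r σ t) ≠ ∞ := by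
  rw [← Set.inter_self (visitSet d r σ t), Measure.prod_apply_symm
    ((measurableSet_visitSet r σ t).inter (measurableSet_visitSet r σ t))]
  simp_rw [volume_slice_visitSet_inter]
  refine ne_top_of_le_ne_top ?_ (lintegral_mono fun w =>
    measure_mono (t := Metric.closedBall 0 r) fun y hy => mem_closedBall_zero_iff.2 hy.1)
  rw [lintegral_const, measure_univ, mul_one]
  exact measure_closedBall_lt_top.ne

lemma prod_real_visitSet_inter (r σ : ℝ) (s t : ℝ≥0) :
    (volume.prod Q).real (visitSet d r σ s ∩ visitSet d r σ t)
      = ∫ w, overlap r (σ • (w t - w s)) ∂Q := by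
  have hmeas := (measurableSet_visitSet (d := d) r σ s).inter (measurableSet_visitSet r σ t)
  have hsection := measurable_measure_prodMk_right (μ := volume) hmeas
  rw [measureReal_def, Measure.prod_apply_symm hmeas, ← integral_toReal hsection.aemeasurable]
  · simp_rw [volume_slice_visitSet_inter]
    rfl
  · refine ae_of_all _ fun w => ?_
    rw [volume_slice_visitSet_inter]
    exact (measure_mono fun y hy => mem_closedBall_zero_iff.2 hy.1).trans_lt
      (measure_closedBall_lt_top (x := 0) (r := r))

lemma isBoundedIntegrable_visitIndicator (r σ : ℝ) (t : ℝ≥0) :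
    IsBoundedIntegrable (visitIndicator d r σ t) (volume.prod Q) :=
  .indicator_one (measurableSet_visitSet r σ t) (prod_visitSet_ne_top r σ t)

lemma integral_toReal_visitIndicator (r σ : ℝ) (t : ℝ≥0) :
    ∫ z, (visitIndicator d r σ t z).toReal ∂(volume.prod Q)
      = volume.real (Metric.closedBall (0 : EuclideanSpace ℝ (Fin d)) r) := by
  have hreal := prod_real_visitSet_inter (Q := Q) r σ t t
  rw [Set.inter_self] at hreal
  have htoReal (z) : (visitIndicator d r σ t z).toReal
      = (visitSet d r σ t).indicator (fun _ => (1 : ℝ)) z := by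
    by_cases hz : z ∈ visitSet d r σ t <;> simp [visitIndicator, hz]
  simp_rw [htoReal]
  rw [integral_indicator_const _ (measurableSet_visitSet r σ t), hreal]
  simp [overlap_zero]

lemma integral_toReal_visitIndicator_mul (r σ : ℝ) (s t : ℝ≥0) :
    ∫ z, (visitIndicator d r σ s z).toReal * (visitIndicator d r σ t z).toReal ∂(volume.prod Q)
      = ∫ w, overlap r (σ • (w t - w s)) ∂Q := by
  have htoReal (z) : (visitIndicator d r σ s z).toReal * (visitIndicator d r σ t z).toReal
      = (visitSet d r σ s ∩ visitSet d r σ t).indicator (fun _ => (1 : ℝ)) z := by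
    by_cases hs : z ∈ visitSet d r σ s <;> by_cases ht : z ∈ visitSet d r σ t <;>
      simp [visitIndicator, hs, ht]
  simp_rw [htoReal]
  rw [integral_indicator_const _
    ((measurableSet_visitSet r σ s).inter (measurableSet_visitSet r σ t)),
    prod_real_visitSet_inter, smul_eq_mul, mul_one]

variable {Ω : Type*} [MeasurableSpace Ω] {P : Measure Ω} [IsProbabilityMeasure P]

lemma IsBrownian.integral_overlap (hd : 1 ≤ d) {W : ℝ≥0 → Ω → EuclideanSpace ℝ (Fin d)}
    (h : IsBrownian W P) {r σ : ℝ} (hr : 0 < r) (hσ : 0 < σ) (s t : ℝ≥0) :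
    ∫ w, overlap r (σ • (w t - w s)) ∂(P.map fun ω t => W t ω)
      = volume.real (Metric.closedBall (0 : EuclideanSpace ℝ (Fin d)) r) *
        corr d r σ (t - s) := by
  have hmeas : Measurable fun z : EuclideanSpace ℝ (Fin d) => overlap r (σ • z) :=
    (measurable_overlap r).comp (by fun_prop)
  rw [integral_map (f := fun w => overlap r (σ • (w t - w s))) h.measurable_path.aemeasurable
    (hmeas.comp (by fun_prop)).aestronglyMeasurable]
  by_cases hst : s = t
  · simp [hst, overlap_zero, corr_zero]
  have hne : nndist (t : ℝ) s ≠ 0 := by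
    rw [Ne, nndist_eq_zero]
    exact fun h => hst (NNReal.coe_injective h.symm)
  rw [← integral_map (μ := P) (φ := fun ω => W t ω - W s ω) (f := fun z => overlap r (σ • z))
    ((h.measurable t).sub (h.measurable s)).aemeasurable
    hmeas.aestronglyMeasurable, h.map_sub,
    integral_overlap_gaussE hd hr hσ hne, corr,
    if_neg (sub_ne_zero.2 fun h => hst (NNReal.coe_injective h.symm))]
  rfl

end VisitSet

section Moments

variable {d : ℕ} {Ω : Type*} [MeasurableSpace Ω] {P : Measure Ω} [IsProbabilityMeasure P]
  {lam : ℝ≥0} {ξ : ℤ → Ω → EuclideanSpace ℝ (Fin d)}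
  {W : ℤ → ℝ≥0 → Ω → EuclideanSpace ℝ (Fin d)} {r σ : ℝ}

lemma IsBrownianSystem.isProbabilityMeasure_map (h : IsBrownianSystem lam ξ W P) (j : ℤ) :
    IsProbabilityMeasure (P.map fun ω t => W j t ω) :=
  Measure.isProbabilityMeasure_map (h.brownian j).measurable_path.aemeasurable

lemma IsBrownianSystem.centredSum_visitIndicator (h : IsBrownianSystem lam ξ W P) (t : ℝ) (ω : Ω) :
    centredSum lam ξ (fun j ω t => W j t ω) (P.map fun ω t => W 0 t ω)
      (visitIndicator d r σ t.toNNReal) ω = count ξ W r σ ω t - rho d lam r := by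
  have := h.isProbabilityMeasure_map 0
  rw [centredSum, integral_toReal_visitIndicator]
  rfl

lemma IsBrownianSystem.mul_integral_visitIndicator (h : IsBrownianSystem lam ξ W P) (hd : 1 ≤ d)
    (hr : 0 < r) (hσ : 0 < σ) {s t : ℝ} (hs : 0 ≤ s) (ht : 0 ≤ t) :
    lam * ∫ z, (visitIndicator d r σ s.toNNReal z).toReal *
      (visitIndicator d r σ t.toNNReal z).toReal ∂(volume.prod (P.map fun ω t => W 0 t ω))
      = rho d lam r * corr d r σ (t - s) := by
  have := h.isProbabilityMeasure_map 0
  rw [integral_toReal_visitIndicator_mul, (h.brownian 0).integral_overlap hd hr hσ, ← mul_assoc,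
    Real.coe_toNNReal _ hs, Real.coe_toNNReal _ ht]
  rfl

theorem IsBrownianSystem.integral_mul (h : IsBrownianSystem lam ξ W P) (hd : 1 ≤ d) (hr : 0 < r)
    (hσ : 0 < σ) {s t : ℝ} (hs : 0 ≤ s) (ht : 0 ≤ t) :
    Integrable (fun ω => (count ξ W r σ ω s - rho d lam r) * (count ξ W r σ ω t - rho d lam r)) P ∧
    ∫ ω, (count ξ W r σ ω s - rho d lam r) * (count ξ W r σ ω t - rho d lam r) ∂P
      = rho d lam r * corr d r σ (t - s) := by
  have := h.isProbabilityMeasure_map 0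
  have hmoment := h.isMarkedPoisson.integral_centredSum_mul
    (h := fun i => visitIndicator d r σ (![s, t] i).toNNReal)
    fun i => isBoundedIntegrable_visitIndicator r σ _
  simpa only [h.centredSum_visitIndicator, h.mul_integral_visitIndicator hd hr hσ hs ht,
    Matrix.cons_val_zero, Matrix.cons_val_one] using! hmoment

/-- The fourth cumulant is the first summand, the Gaussian pairings form the second. -/
theorem IsBrownianSystem.integral_prod_four_le (h : IsBrownianSystem lam ξ W P) (hd : 1 ≤ d)
    (hr : 0 < r) (hσ : 0 < σ) {τ : Fin 4 → ℝ} (hτ : ∀ i, 0 ≤ τ i) :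
    Integrable (fun ω => ∏ i, (count ξ W r σ ω (τ i) - rho d lam r)) P ∧
    ∫ ω, ∏ i, (count ξ W r σ ω (τ i) - rho d lam r) ∂P
      ≤ rho d lam r * corr d r σ (τ 2 - τ 0) + rho d lam r ^ 2 *
        (corr d r σ (τ 1 - τ 0) * corr d r σ (τ 3 - τ 2) +
          corr d r σ (τ 2 - τ 0) * corr d r σ (τ 3 - τ 1) +
          corr d r σ (τ 3 - τ 0) * corr d r σ (τ 2 - τ 1)) := by
  have := h.isProbabilityMeasure_map 0
  have hvisit (i : Fin 4) := isBoundedIntegrable_visitIndicator (Q := P.map fun ω t => W 0 t ω) r σ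
    (τ i).toNNReal
  obtain ⟨hint, hmoment⟩ := h.isMarkedPoisson.integral_centredSum_prod_four hvisit
    (κ := fun i j => rho d lam r * corr d r σ (τ j - τ i))
    fun i j => h.mul_integral_visitIndicator hd hr hσ (hτ i) (hτ j)
  simp only [h.centredSum_visitIndicator] at hint hmoment
  have hle_one (i : Fin 4) (z) :
      (visitIndicator d r σ (τ i).toNNReal z).toReal ≤ 1 := by
    by_cases hz : z ∈ visitSet d r σ (τ i).toNNReal <;> simp [visitIndicator, hz]
  have hprod_le (z) : ∏ i, (visitIndicator d r σ (τ i).toNNReal z).toReal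
      ≤ (visitIndicator d r σ (τ 0).toNNReal z).toReal *
        (visitIndicator d r σ (τ 2).toNNReal z).toReal := by
    rw [Fin.prod_univ_four]
    refine (mul_le_of_le_one_right ?_ (hle_one 3 z)).trans (mul_le_mul_of_nonneg_right
      (mul_le_of_le_one_right ?_ (hle_one 1 z)) ?_) <;> positivity
  have hcumulant := mul_le_mul_of_nonneg_left (integral_mono_of_nonneg
    (ae_of_all _ fun z => Finset.prod_nonneg fun i _ => ENNReal.toReal_nonneg)
    ((hvisit 0).integrable_mul (hvisit 2)) (ae_of_all _ hprod_le)) lam.2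
  refine ⟨hint, hmoment.trans_le ((add_le_add_left (hcumulant.trans_eq
    (h.mul_integral_visitIndicator hd hr hσ (hτ 0) (hτ 2))) _).trans_eq ?_)⟩
  ring

end Moments

section Target

variable {d : ℕ}

lemma div_rpow_one_sub (x : ℝ) {t : ℝ} (ht : 0 < t) (α : ℝ) :
    x / t ^ (1 - α) = x * t ^ (α - 1) := by
  rw [div_eq_mul_inv, ← Real.rpow_neg ht.le, neg_sub]

lemma integrableOn_rpow_Ioc {α b : ℝ} (hα : 0 < α) (hb : 0 ≤ b) :
    IntegrableOn (fun t : ℝ => t ^ (α - 1)) (Set.Ioc 0 b) :=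
  (intervalIntegrable_iff_integrableOn_Ioc_of_le hb).1
    (intervalIntegral.intervalIntegrable_rpow' (by linarith))

lemma setIntegral_rpow_Ioc {α b : ℝ} (hα : 0 < α) (hb : 0 ≤ b) :
    ∫ t in Set.Ioc 0 b, t ^ (α - 1) = b ^ α / α := by
  rw [← intervalIntegral.integral_of_le hb, integral_rpow (Or.inl (by linarith)), sub_add_cancel,
    Real.zero_rpow hα.ne', sub_zero]

lemma measurable_corr_div (hd : 1 ≤ d) (r σ α : ℝ) :
    Measurable fun t : ℝ => corr d r σ t / t ^ (1 - α) :=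
  (measurable_corr hd r σ).div (by fun_prop)

lemma corr_div_nonneg (hd : 1 ≤ d) (r σ α : ℝ) {t : ℝ} (ht : 0 ≤ t) :
    0 ≤ corr d r σ t / t ^ (1 - α) :=
  div_nonneg (corr_nonneg hd r σ t) (Real.rpow_nonneg ht _)

lemma integrableOn_corr_div_Ioc (hd : 1 ≤ d) (r σ : ℝ) {α b : ℝ} (hα : 0 < α) (hb : 0 ≤ b) :
    IntegrableOn (fun t : ℝ => corr d r σ t / t ^ (1 - α)) (Set.Ioc 0 b) := by
  refine (integrableOn_rpow_Ioc hα hb).mono' (measurable_corr_div hd r σ α).aestronglyMeasurable ?_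
  filter_upwards [ae_restrict_mem measurableSet_Ioc] with t ht
  rw [Real.norm_eq_abs, abs_of_nonneg (corr_div_nonneg hd r σ α ht.1.le), div_rpow_one_sub _ ht.1]
  exact mul_le_of_le_one_left (Real.rpow_nonneg ht.1.le _) (corr_le_one hd r σ t)

lemma corr_div_le (hd : 1 ≤ d) (r : ℝ) {σ : ℝ} (hσ : 0 < σ) (α : ℝ) {t : ℝ} (ht : 0 < t) :
    corr d r σ t / t ^ (1 - α)
      ≤ decayConst d * ((r / σ) ^ 2) ^ ((d : ℝ) / 2) * t ^ (α - 1 - (d : ℝ) / 2) := by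
  rw [div_rpow_one_sub _ ht, sub_eq_add_neg (α - 1), add_comm (α - 1), Real.rpow_add ht,
    ← mul_assoc]
  exact mul_le_mul_of_nonneg_right (corr_le_rpow hd r hσ ht) (Real.rpow_nonneg ht.le _)

lemma integrableOn_corr_div_Ioi (hd : 1 ≤ d) (r : ℝ) {σ α b : ℝ} (hσ : 0 < σ)
    (hα : α < (d : ℝ) / 2) (hb : 0 < b) :
    IntegrableOn (fun t : ℝ => corr d r σ t / t ^ (1 - α)) (Set.Ioi b) := by
  refine ((integrableOn_Ioi_rpow_of_lt (show α - 1 - (d : ℝ) / 2 < -1 by linarith) hb).const_mul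
    (decayConst d * ((r / σ) ^ 2) ^ ((d : ℝ) / 2))).mono'
    (measurable_corr_div hd r σ α).aestronglyMeasurable ?_
  filter_upwards [ae_restrict_mem measurableSet_Ioi] with t ht
  have ht0 : 0 < t := hb.trans ht
  rw [Real.norm_eq_abs, abs_of_nonneg (corr_div_nonneg hd r σ α ht0.le)]
  exact corr_div_le hd r hσ α ht0

lemma integral_corr_div_Ioi_le (hd : 1 ≤ d) (r : ℝ) {σ α b : ℝ} (hσ : 0 < σ)
    (hα : α < (d : ℝ) / 2) (hb : 0 < b) :
    ∫ t in Set.Ioi b, corr d r σ t / t ^ (1 - α)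
      ≤ decayConst d * ((r / σ) ^ 2) ^ ((d : ℝ) / 2) *
        (b ^ (α - (d : ℝ) / 2) / ((d : ℝ) / 2 - α)) := by
  have hlt : α - 1 - (d : ℝ) / 2 < -1 := by linarith
  have hintegral : ∫ t in Set.Ioi b, t ^ (α - 1 - (d : ℝ) / 2)
      = b ^ (α - (d : ℝ) / 2) / ((d : ℝ) / 2 - α) := by
    rw [integral_Ioi_rpow_of_lt hlt hb, show α - 1 - (d : ℝ) / 2 + 1 = α - (d : ℝ) / 2 by ring,
      neg_div, ← div_neg, neg_sub]
  rw [← hintegral, ← integral_const_mul]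
  refine setIntegral_mono_on (integrableOn_corr_div_Ioi hd r hσ hα hb)
    ((integrableOn_Ioi_rpow_of_lt hlt hb).const_mul _) measurableSet_Ioi fun t ht => ?_
  exact corr_div_le hd r hσ α (hb.trans ht)

lemma integrableOn_corr_div (hd : 1 ≤ d) (r : ℝ) {σ α : ℝ} (hσ : 0 < σ) (hα0 : 0 < α)
    (hα : α < (d : ℝ) / 2) :
    IntegrableOn (fun t : ℝ => corr d r σ t / t ^ (1 - α)) (Set.Ioi 0) := by
  rw [← Set.Ioc_union_Ioi_eq_Ioi zero_le_one]
  exact (integrableOn_corr_div_Ioc hd r σ hα0 zero_le_one).union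
    (integrableOn_corr_div_Ioi hd r hσ hα one_pos)

/-- The target `∫₀^∞ corr(t) t^{α - 1} dt` of the estimator `psiEst`. -/
noncomputable def psi (d : ℕ) (r σ α : ℝ) : ℝ :=
  ∫ t in Set.Ioi (0 : ℝ), corr d r σ t / t ^ (1 - α)

lemma psi_eq (d : ℕ) (r : ℝ) {σ : ℝ} (hσ : 0 < σ) (α : ℝ) :
    psi d r σ α = (σ ^ 2) ^ (-α) * Jalpha d r α := by
  have hs : 0 < σ ^ 2 := by positivity
  have hcomp := integral_comp_mul_left_Ioi (fun t => J d r t / t ^ (1 - α)) 0 hs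
  rw [mul_zero, smul_eq_mul] at hcomp
  have hscale : psi d r σ α
      = ∫ t in Set.Ioi (0 : ℝ),
          (σ ^ 2) ^ (1 - α) * (J d r (σ ^ 2 * t) / (σ ^ 2 * t) ^ (1 - α)) := by
    refine setIntegral_congr_fun measurableSet_Ioi fun t (ht : 0 < t) => ?_
    have := Real.rpow_pos_of_pos hs (1 - α)
    have := Real.rpow_pos_of_pos ht (1 - α)
    rw [corr_of_pos d r σ ht, Real.mul_rpow hs.le ht.le]
    field_simp
  rw [hscale, integral_const_mul, hcomp, ← mul_assoc, Jalpha, ← Real.rpow_neg_one,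
    ← Real.rpow_add hs]
  congr 2
  ring

lemma le_psi (hd : 1 ≤ d) {r σ α : ℝ} (hr : 0 < r) (hσ : 0 < σ) (hα0 : 0 < α)
    (hα : α < (d : ℝ) / 2) : J d 1 1 * (((r / σ) ^ 2) ^ α / α) ≤ psi d r σ α := by
  have ha : 0 ≤ (r / σ) ^ 2 := by positivity
  rw [← setIntegral_rpow_Ioc hα0 ha, ← integral_const_mul, psi]
  calc ∫ t in Set.Ioc 0 ((r / σ) ^ 2), J d 1 1 * t ^ (α - 1)
      ≤ ∫ t in Set.Ioc 0 ((r / σ) ^ 2), corr d r σ t / t ^ (1 - α) := by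
        refine setIntegral_mono_on ((integrableOn_rpow_Ioc hα0 ha).const_mul _)
          (integrableOn_corr_div_Ioc hd r σ hα0 ha) measurableSet_Ioc fun t ht => ?_
        rw [div_rpow_one_sub _ ht.1, corr_of_pos d r σ ht.1]
        refine mul_le_mul_of_nonneg_right (J_one_one_le hd (mul_pos (by positivity) ht.1) ?_)
          (Real.rpow_nonneg ht.1.le _)
        have := ht.2
        rwa [div_pow, le_div_iff₀ (by positivity), mul_comm] at this
    _ ≤ ∫ t in Set.Ioi 0, corr d r σ t / t ^ (1 - α) := by
        refine setIntegral_mono_set (integrableOn_corr_div hd r hσ hα0 hα) ?_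
          Set.Ioc_subset_Ioi_self.eventuallyLE
        filter_upwards [ae_restrict_mem measurableSet_Ioi] with t ht
        exact corr_div_nonneg hd r σ α (le_of_lt ht)

lemma psi_eq_add (hd : 1 ≤ d) (r : ℝ) {σ α b : ℝ} (hσ : 0 < σ) (hα0 : 0 < α)
    (hα : α < (d : ℝ) / 2) (hb : 0 < b) :
    psi d r σ α = (∫ t in Set.Ioc 0 b, corr d r σ t / t ^ (1 - α)) +
      ∫ t in Set.Ioi b, corr d r σ t / t ^ (1 - α) := by
  rw [psi, ← Set.Ioc_union_Ioi_eq_Ioi hb.le]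
  exact setIntegral_union (Set.Ioc_disjoint_Ioi le_rfl) measurableSet_Ioi
    (integrableOn_corr_div_Ioc hd r σ hα0 hb.le) (integrableOn_corr_div_Ioi hd r hσ hα hb)

end Target

section StochRate

variable {d : ℕ}

/-- The rate of the stochastic error, `phi d T` without its factor `ln² T`. -/
noncomputable def stochRate (d : ℕ) (T : ℝ) : ℝ :=
  if 2 < d then 1 / T else if d = 2 then Real.log T / T else 1 / √T

lemma log_sq_mul_stochRate (d : ℕ) (T : ℝ) : Real.log T ^ 2 * stochRate d T = phi d T := by
  unfold stochRate phi
  split_ifs <;> ring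

lemma integral_corr_Ioc_le (hd : 1 ≤ d) (r σ : ℝ) {b : ℝ} (hb : 0 ≤ b) :
    ∫ u in Set.Ioc 0 b, corr d r σ u ≤ b := by
  have hle := setIntegral_mono_on (integrableOn_corr hd r σ measure_Ioc_lt_top.ne)
    (integrableOn_const (C := (1 : ℝ)) measure_Ioc_lt_top.ne)
    (measurableSet_Ioc (a := 0) (b := b)) fun u _ => corr_le_one hd r σ u
  simpa [hb] using hle

lemma integral_corr_le_of_two_lt (hd : 2 < d) {r σ : ℝ} (hr : 0 < r) (hσ : 0 < σ) (T : ℝ) :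
    ∫ u in Set.Ioc 0 T, corr d r σ u
      ≤ (1 + decayConst d / ((d : ℝ) / 2 - 1)) * (r / σ) ^ 2 := by
  have hd1 : 1 ≤ d := by omega
  have hd2 : (1 : ℝ) < d / 2 := by
    have : (2 : ℝ) < d := by exact_mod_cast hd
    linarith
  have ha : 0 < (r / σ) ^ 2 := by positivity
  have hint := integrableOn_corr_div hd1 r hσ one_pos hd2
  have htail := integral_corr_div_Ioi_le hd1 r hσ hd2 ha
  have hsplit := psi_eq_add hd1 r hσ one_pos hd2 ha
  rw [psi] at hsplit
  simp only [sub_self, Real.rpow_zero, div_one] at hint htail hsplit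
  have hexponent : ((r / σ) ^ 2) ^ ((d : ℝ) / 2) * ((r / σ) ^ 2) ^ (1 - (d : ℝ) / 2)
      = (r / σ) ^ 2 := by
    rw [← Real.rpow_add ha, add_sub_cancel, Real.rpow_one]
  calc ∫ u in Set.Ioc 0 T, corr d r σ u
      ≤ ∫ u in Set.Ioi 0, corr d r σ u :=
        setIntegral_mono_set hint (ae_of_all _ fun u => corr_nonneg hd1 r σ u)
          Set.Ioc_subset_Ioi_self.eventuallyLE
    _ ≤ _ := hsplit.trans_le (add_le_add (integral_corr_Ioc_le hd1 r σ ha.le) htail)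
    _ = (r / σ) ^ 2 + decayConst d / ((d : ℝ) / 2 - 1) *
        (((r / σ) ^ 2) ^ ((d : ℝ) / 2) * ((r / σ) ^ 2) ^ (1 - (d : ℝ) / 2)) := by ring
    _ = (1 + decayConst d / ((d : ℝ) / 2 - 1)) * (r / σ) ^ 2 := by rw [hexponent]; ring

lemma integral_corr_two_Ioc_le {r σ a b : ℝ} (hσ : 0 < σ) (ha : 0 < a) (hab : a ≤ b) :
    ∫ u in Set.Ioc a b, corr 2 r σ u ≤ decayConst 2 * (r / σ) ^ 2 * Real.log (b / a) := by
  have hint : IntegrableOn (fun u : ℝ => u⁻¹) (Set.Ioc a b) := by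
    refine (intervalIntegrable_iff_integrableOn_Ioc_of_le hab).1
      (intervalIntegral.intervalIntegrable_inv (fun u hu => ?_) (by fun_prop))
    rw [Set.uIcc_of_le hab] at hu
    exact (ha.trans_le hu.1).ne'
  rw [← integral_inv_of_pos ha (ha.trans_le hab), intervalIntegral.integral_of_le hab,
    ← integral_const_mul]
  refine setIntegral_mono_on (integrableOn_corr one_le_two r σ measure_Ioc_lt_top.ne)
    (hint.const_mul _) measurableSet_Ioc fun u hu => ?_
  simpa [Real.rpow_neg_one] using corr_le_rpow one_le_two r hσ (ha.trans hu.1)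

lemma integral_corr_two_le {r σ T : ℝ} (hσ : 0 < σ) (hT : Real.exp 1 ≤ T)
    (hσT : σ ^ 2 ≤ r ^ 2 * T) :
    ∫ u in Set.Ioc 0 T, corr 2 r σ u ≤ (1 + 2 * decayConst 2) * (r / σ) ^ 2 * Real.log T := by
  have hT0 : 0 < T := (Real.exp_pos 1).trans_le hT
  have hT1 : 1 ≤ T := (Real.one_le_exp zero_le_one).trans hT
  have hlog : 1 ≤ Real.log T := (Real.le_log_iff_exp_le hT0).2 hT
  have hTi0 : 0 < T⁻¹ := inv_pos.2 hT0
  have hTi : T⁻¹ ≤ T := (inv_le_one_of_one_le₀ hT1).trans hT1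
  have hnear : ∫ u in Set.Ioc 0 T⁻¹, corr 2 r σ u ≤ (r / σ) ^ 2 * Real.log T := by
    have hTσ : T⁻¹ ≤ (r / σ) ^ 2 := by
      rw [div_pow, le_div_iff₀ (by positivity), inv_mul_le_iff₀ hT0]
      linarith
    exact (integral_corr_Ioc_le one_le_two r σ hTi0.le).trans
      (hTσ.trans (le_mul_of_one_le_right (by positivity) hlog))
  have hfar := integral_corr_two_Ioc_le (r := r) hσ hTi0 hTi
  rw [div_inv_eq_mul, Real.log_mul hT0.ne' hT0.ne'] at hfar
  rw [← Set.Ioc_union_Ioc_eq_Ioc hTi0.le hTi, setIntegral_union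
    (Set.Ioc_disjoint_Ioc_of_le le_rfl) measurableSet_Ioc
    (integrableOn_corr one_le_two r σ measure_Ioc_lt_top.ne)
    (integrableOn_corr one_le_two r σ measure_Ioc_lt_top.ne)]
  linarith

lemma integral_corr_one_le {r σ T : ℝ} (hr : 0 < r) (hσ : 0 < σ) (hT : 0 < T) :
    ∫ u in Set.Ioc 0 T, corr 1 r σ u ≤ 2 * decayConst 1 * (r / σ) * √T := by
  have hrpow := setIntegral_rpow_Ioc (α := 1 / 2) (by norm_num) hT.le
  rw [← Real.sqrt_eq_rpow] at hrpow
  have hbound : 2 * decayConst 1 * (r / σ) * √T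
      = ∫ u in Set.Ioc 0 T, decayConst 1 * (r / σ) * u ^ ((1 : ℝ) / 2 - 1) := by
    rw [integral_const_mul, hrpow]
    ring
  rw [hbound]
  refine setIntegral_mono_on (integrableOn_corr le_rfl r σ measure_Ioc_lt_top.ne)
    ((integrableOn_rpow_Ioc (by norm_num) hT.le).const_mul _) measurableSet_Ioc fun u hu => ?_
  have hle := corr_le_rpow le_rfl r hσ hu.1
  rw [Nat.cast_one, ← Real.sqrt_eq_rpow, Real.sqrt_sq (by positivity)] at hle
  rwa [show (1 : ℝ) / 2 - 1 = -(1 / 2) by norm_num]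

lemma exists_integral_corr_le_stochRate (hd : 1 ≤ d) : ∃ C : ℝ, 0 < C ∧ ∀ r σ T : ℝ, 0 < r →
    0 < σ → Real.exp 1 ≤ T → σ ^ 2 ≤ r ^ 2 * T →
    1 / T * ∫ u in Set.Ioc 0 T, corr d r σ u ≤ C * (r / σ) ^ min d 2 * stochRate d T := by
  have hdecay := decayConst_pos hd
  rcases lt_trichotomy d 2 with hlt | rfl | hgt
  · obtain rfl : d = 1 := by omega
    refine ⟨2 * decayConst 1, by positivity, fun r σ T hr hσ hT _ => ?_⟩
    have hT0 : 0 < T := (Real.exp_pos 1).trans_le hT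
    have hsqrt : 1 / √T = 1 / T * √T := by
      rw [one_div, one_div, ← Real.sqrt_div_self, div_eq_inv_mul]
    refine (mul_le_mul_of_nonneg_left (integral_corr_one_le hr hσ hT0) (by positivity)).trans_eq ?_
    rw [stochRate, if_neg (by norm_num), if_neg (by norm_num), hsqrt, min_eq_left (by norm_num)]
    ring
  · refine ⟨1 + 2 * decayConst 2, by positivity, fun r σ T _ hσ hT hσT => ?_⟩
    have hT0 : 0 < T := (Real.exp_pos 1).trans_le hT
    refine (mul_le_mul_of_nonneg_left (integral_corr_two_le hσ hT hσT)
      (by positivity)).trans_eq ?_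
    rw [stochRate, if_neg (lt_irrefl 2), if_pos rfl, min_self]
    ring
  · have hd2 : 0 < (d : ℝ) / 2 - 1 := by
      have : (2 : ℝ) < d := by exact_mod_cast hgt
      linarith
    refine ⟨1 + decayConst d / ((d : ℝ) / 2 - 1), by positivity, fun r σ T hr hσ hT _ => ?_⟩
    have hT0 : 0 < T := (Real.exp_pos 1).trans_le hT
    refine (mul_le_mul_of_nonneg_left (integral_corr_le_of_two_lt hgt hr hσ T)
      (by positivity)).trans_eq ?_
    rw [stochRate, if_pos hgt, min_eq_right hgt.le]
    ring

end StochRate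

section Measurability

lemma measurable_intervalIntegral_prod {X : Type*} [MeasurableSpace X] {f : X → ℝ → ℝ}
    (hf : Measurable (Function.uncurry f)) {b : X → ℝ} (hb : Measurable b) :
    Measurable fun x => ∫ s in (0 : ℝ)..b x, f x s := by
  have hpos : MeasurableSet {p : X × ℝ | 0 < p.2 ∧ p.2 ≤ b p.1} :=
    (measurableSet_lt measurable_const measurable_snd).inter
      (measurableSet_le measurable_snd (hb.comp measurable_fst))
  have hneg : MeasurableSet {p : X × ℝ | b p.1 < p.2 ∧ p.2 ≤ 0} :=
    (measurableSet_lt (hb.comp measurable_fst) measurable_snd).inter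
      (measurableSet_le measurable_snd measurable_const)
  have hindicator {D : Set (X × ℝ)} (hD : MeasurableSet D) :
      Measurable fun x => ∫ s, D.indicator (Function.uncurry f) (x, s) :=
    ((hf.indicator hD).stronglyMeasurable.integral_prod_right' (ν := volume)).measurable
  convert (hindicator hpos).sub (hindicator hneg) using 1
  ext x
  rw [intervalIntegral, ← integral_indicator measurableSet_Ioc,
    ← integral_indicator measurableSet_Ioc]
  rfl

variable {Ω : Type*} [MeasurableSpace Ω] {N : Ω → ℝ → ℝ}

lemma measurable_covEst (hN : Measurable (Function.uncurry N)) (ρ T : ℝ) :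
    Measurable fun p : Ω × ℝ => covEst ρ T (N p.1) p.2 := by
  unfold covEst
  refine Measurable.mul (by fun_prop) (measurable_intervalIntegral_prod ?_ (by fun_prop))
  have hpath : Measurable fun q : (Ω × ℝ) × ℝ => N q.1.1 q.2 :=
    hN.comp (by fun_prop : Measurable fun q : (Ω × ℝ) × ℝ => (q.1.1, q.2))
  have hshift : Measurable fun q : (Ω × ℝ) × ℝ => N q.1.1 (q.2 + q.1.2) :=
    hN.comp (by fun_prop : Measurable fun q : (Ω × ℝ) × ℝ => (q.1.1, q.2 + q.1.2))
  exact (hpath.sub_const ρ).mul (hshift.sub_const ρ)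

lemma measurable_corrEst (hN : Measurable (Function.uncurry N)) (ρ T : ℝ) :
    Measurable fun p : Ω × ℝ => corrEst ρ T (N p.1) p.2 :=
  ((measurable_covEst hN ρ T).max measurable_const).const_mul _

lemma measurable_psiEst (hN : Measurable (Function.uncurry N)) (ρ T α b : ℝ) :
    Measurable fun ω => psiEst ρ T α b (N ω) := by
  refine measurable_intervalIntegral_prod (b := fun _ => b) ?_ measurable_const
  exact (measurable_corrEst hN ρ T).div (by fun_prop)

lemma measurable_sigmaSqStar (hN : Measurable (Function.uncurry N)) (d : ℕ) (r ρ T : ℝ) :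
    Measurable fun ω => sigmaSqStar d r ρ T (N ω) :=
  (measurable_const.div (measurable_psiEst hN ρ T _ _)).pow_const _

end Measurability

section Version

variable {d : ℕ} {Ω : Type*} [MeasurableSpace Ω] {P : Measure Ω}

lemma IsBrownian.ae_continuous {W : ℝ≥0 → Ω → EuclideanSpace ℝ (Fin d)} (h : IsBrownian W P) :
    ∀ᵐ ω ∂P, Continuous fun t => W t ω := by
  filter_upwards [ae_all_iff.2 fun i => (h.coord i).cont] with ω hω
  exact (PiLp.continuous_toLp 2 _).comp (continuous_pi hω)

lemma IsBrownian.exists_measurable_version {W : ℝ≥0 → Ω → EuclideanSpace ℝ (Fin d)}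
    (h : IsBrownian W P) :
    ∃ V : ℝ≥0 → Ω → EuclideanSpace ℝ (Fin d), Measurable (Function.uncurry V) ∧
      ∀ᵐ ω ∂P, ∀ t, W t ω = V t ω := by
  obtain ⟨S, hS, hSm, hS0⟩ := exists_measurable_superset_of_null h.ae_continuous
  refine ⟨fun t => Sᶜ.indicator (W t), measurable_uncurry_of_continuous_of_measurable
    (fun ω => ?_) fun t => (h.measurable t).indicator hSm.compl, ?_⟩
  · by_cases hω : ω ∈ S
    · simpa [hω] using continuous_const
    · simpa [hω] using not_not.1 fun hcont => hω (hS hcont)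
  · filter_upwards [measure_eq_zero_iff_ae_notMem.1 hS0] with ω hω t
    rw [Set.indicator_of_mem hω]

theorem IsBrownianSystem.exists_measurable_count {lam : ℝ≥0}
    {ξ : ℤ → Ω → EuclideanSpace ℝ (Fin d)} {W : ℤ → ℝ≥0 → Ω → EuclideanSpace ℝ (Fin d)}
    (h : IsBrownianSystem lam ξ W P) (r σ : ℝ) :
    ∃ N : Ω → ℝ → ℝ, Measurable (Function.uncurry N) ∧
      ∀ᵐ ω ∂P, count ξ W r σ ω = N ω := by
  choose V hV hVW using fun j => (h.brownian j).exists_measurable_version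
  refine ⟨count ξ V r σ, ?_, ?_⟩
  · refine (Measurable.tsum fun j => ?_).ennreal_toReal
    have hpos : Measurable fun p : Ω × ℝ => ξ j p.1 + σ • V j p.2.toNNReal p.1 :=
      ((h.poisson.measurable j).comp measurable_fst).add
        (((hV j).comp (by fun_prop : Measurable fun p : Ω × ℝ => (p.2.toNNReal, p.1))).const_smul σ)
    exact (measurable_const.indicator measurableSet_closedBall).comp hpos
  · filter_upwards [ae_all_iff.2 hVW] with ω hω
    ext t
    simp only [count, hω]

end Version

section SecondMoment

variable {Ω S : Type*} [MeasurableSpace Ω] [MeasurableSpace S] {P : Measure Ω} {ν : Measure S}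

lemma integral_norm_mul_le {f g : Ω → ℝ} (hf : Integrable (fun ω => f ω ^ 2) P)
    (hg : Integrable (fun ω => g ω ^ 2) P) :
    ∫ ω, ‖f ω * g ω‖ ∂P ≤ (∫ ω, f ω ^ 2 ∂P + ∫ ω, g ω ^ 2 ∂P) / 2 := by
  rw [← integral_add hf hg, ← integral_div]
  refine integral_mono_of_nonneg (ae_of_all _ fun ω => norm_nonneg _) ((hf.add hg).div_const 2)
    (ae_of_all _ fun ω => ?_)
  simp only [norm_mul, Real.norm_eq_abs]
  rw [← sq_abs (f ω), ← sq_abs (g ω)]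
  linarith [two_mul_le_add_sq |f ω| |g ω|]

lemma integrable_prod_of_ae_integral_norm_le [SFinite P] [IsFiniteMeasure ν] {f : Ω × S → ℝ}
    {K : ℝ} (hf : Measurable f)
    (hK : ∀ᵐ s ∂ν, Integrable (fun ω => f (ω, s)) P ∧ ∫ ω, ‖f (ω, s)‖ ∂P ≤ K) :
    Integrable f (P.prod ν) := by
  refine (integrable_prod_iff' hf.aestronglyMeasurable).2 ⟨hK.mono fun s hs => hs.1,
    Integrable.of_bound (C := K) ?_ (hK.mono fun s hs => ?_)⟩
  · exact (hf.norm.comp measurable_swap).stronglyMeasurable.integral_prod_right'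
      |>.aestronglyMeasurable
  · rw [Real.norm_eq_abs, abs_of_nonneg (integral_nonneg fun ω => norm_nonneg _)]
    exact hs.2

variable {Y : Ω → S → ℝ} {K : ℝ}

lemma ae_integrable_mul_and_integral_norm_mul_le (hY : Measurable (Function.uncurry Y))
    (hK : ∀ᵐ s ∂ν, Integrable (fun ω => Y ω s ^ 2) P ∧ ∫ ω, Y ω s ^ 2 ∂P ≤ K) :
    ∀ᵐ q ∂ν.prod ν, Integrable (fun ω => Y ω q.1 * Y ω q.2) P ∧
      ∫ ω, ‖Y ω q.1 * Y ω q.2‖ ∂P ≤ K := by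
  have hmem {s : S} (hs : Integrable (fun ω => Y ω s ^ 2) P) : MemLp (fun ω => Y ω s) 2 P :=
    (memLp_two_iff_integrable_sq (hY.comp measurable_prodMk_right).aestronglyMeasurable).2 hs
  filter_upwards [Measure.quasiMeasurePreserving_fst.ae hK,
    Measure.quasiMeasurePreserving_snd.ae hK] with q ⟨hint₁, hle₁⟩ ⟨hint₂, hle₂⟩
  exact ⟨(hmem hint₁).integrable_mul (hmem hint₂),
    (integral_norm_mul_le hint₁ hint₂).trans (by linarith)⟩

lemma ae_integrable_of_integral_sq_le [IsFiniteMeasure P] [IsFiniteMeasure ν]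
    (hY : Measurable (Function.uncurry Y))
    (hK : ∀ᵐ s ∂ν, Integrable (fun ω => Y ω s ^ 2) P ∧ ∫ ω, Y ω s ^ 2 ∂P ≤ K) :
    ∀ᵐ ω ∂P, Integrable (Y ω) ν := by
  have hsq : Integrable (fun p => Function.uncurry Y p ^ 2) (P.prod ν) :=
    integrable_prod_of_ae_integral_norm_le (hY.pow_const 2) (by simpa using hK)
  exact (((memLp_two_iff_integrable_sq hY.aestronglyMeasurable).2 hsq).integrable
    one_le_two).prod_right_ae

variable [SFinite P] [IsFiniteMeasure ν]

lemma integrable_mul_prod (hY : Measurable (Function.uncurry Y))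
    (hK : ∀ᵐ s ∂ν, Integrable (fun ω => Y ω s ^ 2) P ∧ ∫ ω, Y ω s ^ 2 ∂P ≤ K) :
    Integrable (fun p : Ω × S × S => Y p.1 p.2.1 * Y p.1 p.2.2) (P.prod (ν.prod ν)) :=
  integrable_prod_of_ae_integral_norm_le
    ((hY.comp (by fun_prop : Measurable fun p : Ω × S × S => (p.1, p.2.1))).mul
      (hY.comp (by fun_prop : Measurable fun p : Ω × S × S => (p.1, p.2.2))))
    (ae_integrable_mul_and_integral_norm_mul_le hY hK)

lemma integrable_sq_integral (hY : Measurable (Function.uncurry Y))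
    (hK : ∀ᵐ s ∂ν, Integrable (fun ω => Y ω s ^ 2) P ∧ ∫ ω, Y ω s ^ 2 ∂P ≤ K) :
    Integrable (fun ω => (∫ s, Y ω s ∂ν) ^ 2) P := by
  simp_rw [sq, ← integral_prod_mul]
  exact (integrable_mul_prod hY hK).integral_prod_left

lemma integral_sq_integral (hY : Measurable (Function.uncurry Y))
    (hK : ∀ᵐ s ∂ν, Integrable (fun ω => Y ω s ^ 2) P ∧ ∫ ω, Y ω s ^ 2 ∂P ≤ K) :
    ∫ ω, (∫ s, Y ω s ∂ν) ^ 2 ∂P = ∫ q, (∫ ω, Y ω q.1 * Y ω q.2 ∂P) ∂(ν.prod ν) := by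
  simp_rw [sq, ← integral_prod_mul]
  exact integral_integral_swap (f := fun ω (q : S × S) => Y ω q.1 * Y ω q.2)
    (integrable_mul_prod hY hK)

theorem integral_sq_integral_le (hY : Measurable (Function.uncurry Y))
    (hK : ∀ᵐ s ∂ν, Integrable (fun ω => Y ω s ^ 2) P ∧ ∫ ω, Y ω s ^ 2 ∂P ≤ K) :
    ∫ ω, (∫ s, Y ω s ∂ν) ^ 2 ∂P ≤ K * ν.real Set.univ ^ 2 := by
  rw [integral_sq_integral hY hK]
  have hle : ∀ᵐ q ∂ν.prod ν, ∫ ω, Y ω q.1 * Y ω q.2 ∂P ≤ K :=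
    (ae_integrable_mul_and_integral_norm_mul_le hY hK).mono fun q hq =>
      (integral_mono hq.1 hq.1.norm fun ω => Real.le_norm_self _).trans hq.2
  refine (integral_mono_ae (integrable_mul_prod hY hK).integral_prod_right
    (integrable_const K) hle).trans_eq ?_
  rw [integral_const, smul_eq_mul, ← Set.univ_prod_univ, measureReal_prod_prod]
  ring

theorem integral_sq_integral_le_of_ae_integral_le (hY : Measurable (Function.uncurry Y))
    (hK : ∀ᵐ s ∂ν, Integrable (fun ω => Y ω s ^ 2) P ∧ ∫ ω, Y ω s ^ 2 ∂P ≤ K) {k : S → S → ℝ}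
    {M : ℝ} (hk : ∀ᵐ s ∂ν, ∀ᵐ s' ∂ν, ∫ ω, Y ω s * Y ω s' ∂P ≤ k s s')
    (hM : ∀ᵐ s ∂ν, Integrable (k s) ν ∧ ∫ s', k s s' ∂ν ≤ M) :
    ∫ ω, (∫ s, Y ω s ∂ν) ^ 2 ∂P ≤ M * ν.real Set.univ := by
  have hint := (integrable_mul_prod hY hK).integral_prod_right
  rw [integral_sq_integral hY hK, integral_prod _ hint]
  have hle : ∀ᵐ s ∂ν, ∫ s', (∫ ω, Y ω s * Y ω s' ∂P) ∂ν ≤ M := by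
    filter_upwards [hk, hM, hint.prod_right_ae] with s hks hMs hs
    exact (integral_mono_ae hs hMs.1 hks).trans hMs.2
  refine (integral_mono_ae hint.integral_prod_left (integrable_const M) hle).trans_eq ?_
  rw [integral_const, smul_eq_mul, mul_comm]

end SecondMoment

section CovarianceEstimate

variable {d : ℕ}

lemma rho_nonneg (d : ℕ) (lam : ℝ≥0) (r : ℝ) : 0 ≤ rho d lam r :=
  mul_nonneg lam.2 measureReal_nonneg

/-- The deviation from `c` of the lag-`t` product of a path `N` centred at `ρ`. The error of the
empirical covariance at lag `t` is the time average of the deviations from the true covariance. -/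
noncomputable def lagError (ρ c : ℝ) (N : ℝ → ℝ) (t s : ℝ) : ℝ :=
  (N s - ρ) * (N (s + t) - ρ) - c

lemma covEst_sub {ρ c T t : ℝ} {N : ℝ → ℝ} (ht : t < T)
    (hN : IntegrableOn (lagError ρ c N t) (Set.Ioc 0 (T - t))) :
    covEst ρ T N t - c = 1 / (T - t) * ∫ s in Set.Ioc 0 (T - t), lagError ρ c N t s := by
  have hL : 0 < T - t := sub_pos.2 ht
  have hc : IntegrableOn (fun _ : ℝ => c) (Set.Ioc 0 (T - t)) :=
    integrableOn_const measure_Ioc_lt_top.ne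
  have hprod : ∫ s in Set.Ioc 0 (T - t), (N s - ρ) * (N (s + t) - ρ)
      = (∫ s in Set.Ioc 0 (T - t), lagError ρ c N t s) + (T - t) * c := by
    have hadd := integral_add hN hc
    rw [setIntegral_const, Real.volume_real_Ioc_of_le hL.le, sub_zero, smul_eq_mul] at hadd
    simpa only [lagError, sub_add_cancel] using hadd
  rw [covEst, intervalIntegral.integral_of_le hL.le, hprod]
  field_simp
  ring

lemma measurable_lagError {Ω : Type*} [MeasurableSpace Ω] {N : Ω → ℝ → ℝ}
    (hN : Measurable (Function.uncurry N)) (ρ c t : ℝ) :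
    Measurable (Function.uncurry fun ω => lagError ρ c (N ω) t) := by
  have hshift : Measurable fun p : Ω × ℝ => N p.1 (p.2 + t) :=
    hN.comp (by fun_prop : Measurable fun p : Ω × ℝ => (p.1, p.2 + t))
  exact ((hN.sub_const ρ).mul (hshift.sub_const ρ)).sub_const c

/-- The bound on the covariance of two lag-`t` products at times differing by `u` that comes from
the fourth moments of the process; `ρ` is the mean of the process. -/
noncomputable def lagCovBound (d : ℕ) (ρ r σ t u : ℝ) : ℝ :=
  (ρ + ρ ^ 2) * corr d r σ u + ρ ^ 2 / 2 * (corr d r σ (u + t) + corr d r σ (u - t))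

section Moments

variable {Ω : Type*} [MeasurableSpace Ω] {P : Measure Ω} [IsProbabilityMeasure P] {lam : ℝ≥0}
  {ξ : ℤ → Ω → EuclideanSpace ℝ (Fin d)} {W : ℤ → ℝ≥0 → Ω → EuclideanSpace ℝ (Fin d)}
  {r σ s s' t : ℝ}

lemma IsBrownianSystem.memLp_mul (h : IsBrownianSystem lam ξ W P) (hd : 1 ≤ d) (hr : 0 < r)
    (hσ : 0 < σ) (hs : 0 ≤ s) (ht : 0 ≤ t) :
    MemLp (fun ω => (count ξ W r σ ω s - rho d lam r) * (count ξ W r σ ω t - rho d lam r)) 2 P := by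
  refine (memLp_two_iff_integrable_sq
    (h.integral_mul hd hr hσ hs ht).1.aestronglyMeasurable).2 ?_
  have hτ : ∀ i, 0 ≤ (![s, t, s, t] : Fin 4 → ℝ) i := by simp [Fin.forall_fin_succ, hs, ht]
  refine (h.integral_prod_four_le hd hr hσ hτ).1.congr (ae_of_all _ fun ω => ?_)
  simp only [Fin.prod_univ_four, Matrix.cons_val]
  ring

lemma IsBrownianSystem.memLp_lagError (h : IsBrownianSystem lam ξ W P) (hd : 1 ≤ d) (hr : 0 < r)
    (hσ : 0 < σ) (hs : 0 ≤ s) (ht : 0 ≤ t) (c : ℝ) :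
    MemLp (fun ω => lagError (rho d lam r) c (count ξ W r σ ω) t s) 2 P :=
  (h.memLp_mul hd hr hσ hs (add_nonneg hs ht)).sub (memLp_const c)

lemma IsBrownianSystem.integral_lagError_mul_le (h : IsBrownianSystem lam ξ W P) (hd : 1 ≤ d)
    (hr : 0 < r) (hσ : 0 < σ) (hs : 0 ≤ s) (hs' : 0 ≤ s') (ht : 0 ≤ t) :
    ∫ ω, lagError (rho d lam r) (rho d lam r * corr d r σ t) (count ξ W r σ ω) t s *
        lagError (rho d lam r) (rho d lam r * corr d r σ t) (count ξ W r σ ω) t s' ∂P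
      ≤ lagCovBound d (rho d lam r) r σ t (s' - s) := by
  set ρ := rho d lam r
  set Z : ℝ → Ω → ℝ := fun u ω => (count ξ W r σ ω u - ρ) * (count ξ W r σ ω (u + t) - ρ)
  have hmean {u : ℝ} (hu : 0 ≤ u) : ∫ ω, Z u ω ∂P = ρ * corr d r σ t := by
    rw [(h.integral_mul hd hr hσ hu (add_nonneg hu ht)).2, add_sub_cancel_left]
  have hcov : ∫ ω, lagError ρ (ρ * corr d r σ t) (count ξ W r σ ω) t s *
        lagError ρ (ρ * corr d r σ t) (count ξ W r σ ω) t s' ∂P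
      = ∫ ω, Z s ω * Z s' ω ∂P - ρ * corr d r σ t * (ρ * corr d r σ t) := by
    have hsub := covariance_eq_sub (h.memLp_mul hd hr hσ hs (add_nonneg hs ht))
      (h.memLp_mul hd hr hσ hs' (add_nonneg hs' ht))
    change cov[Z s, Z s'; P] = ∫ ω, Z s ω * Z s' ω ∂P - (∫ ω, Z s ω ∂P) * ∫ ω, Z s' ω ∂P at hsub
    rwa [covariance, hmean hs, hmean hs'] at hsub
  have hτ : ∀ i, 0 ≤ (![s, s + t, s', s' + t] : Fin 4 → ℝ) i := by
    simp [Fin.forall_fin_succ, hs, hs', add_nonneg hs ht, add_nonneg hs' ht]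
  have hfour := (h.integral_prod_four_le hd hr hσ hτ).2
  simp only [Fin.prod_univ_four, Matrix.cons_val, mul_assoc, add_sub_cancel_left,
    add_sub_add_right_eq_sub] at hfour
  rw [add_sub_right_comm, ← sub_sub] at hfour
  have hsq : corr d r σ (s' - s) * corr d r σ (s' - s) ≤ corr d r σ (s' - s) :=
    mul_le_of_le_one_right (corr_nonneg hd r σ _) (corr_le_one hd r σ _)
  have hcross : corr d r σ (s' - s + t) * corr d r σ (s' - s - t)
      ≤ (corr d r σ (s' - s + t) + corr d r σ (s' - s - t)) / 2 := by
    linarith [mul_le_of_le_one_right (corr_nonneg hd r σ (s' - s + t))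
        (corr_le_one hd r σ (s' - s - t)),
      mul_le_of_le_one_left (corr_nonneg hd r σ (s' - s - t)) (corr_le_one hd r σ (s' - s + t))]
  have hsum := mul_le_mul_of_nonneg_left (add_le_add hsq hcross) (sq_nonneg ρ)
  rw [hcov, lagCovBound]
  simp only [Z, mul_assoc]
  linarith

end Moments

section CorrIntegrals

variable {L T x : ℝ}

lemma integrableOn_corr_add (hd : 1 ≤ d) (r σ L x : ℝ) :
    IntegrableOn (fun u => corr d r σ (u + x)) (Set.Ioc 0 L) :=
  Measure.integrableOn_of_bounded measure_Ioc_lt_top.ne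
    ((measurable_corr hd r σ).comp (measurable_add_const x)).aestronglyMeasurable (M := 1)
    (ae_of_all _ fun u => by
      rw [Real.norm_eq_abs, abs_of_nonneg (corr_nonneg hd r σ _)]
      exact corr_le_one hd r σ _)

lemma setIntegral_corr_add_le (hd : 1 ≤ d) (r σ : ℝ) (hL : 0 ≤ L) (hx : -T ≤ x)
    (hxL : x + L ≤ T) :
    ∫ u in Set.Ioc 0 L, corr d r σ (u + x) ≤ 2 * ∫ u in Set.Ioc 0 T, corr d r σ u := by
  have hint (a b : ℝ) : IntervalIntegrable (corr d r σ) volume a b :=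
    ⟨integrableOn_corr hd r σ measure_Ioc_lt_top.ne,
      integrableOn_corr hd r σ measure_Ioc_lt_top.ne⟩
  have heven : ∫ u in -T..0, corr d r σ u = ∫ u in (0 : ℝ)..T, corr d r σ u := by
    simpa only [corr_neg, neg_zero] using
      (intervalIntegral.integral_comp_neg (a := 0) (b := T) (corr d r σ)).symm
  rw [← intervalIntegral.integral_of_le hL, ← intervalIntegral.integral_of_le (by linarith),
    intervalIntegral.integral_comp_add_right (corr d r σ), zero_add]
  calc ∫ u in x..L + x, corr d r σ u
      ≤ ∫ u in -T..T, corr d r σ u :=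
        intervalIntegral.integral_mono_interval hx (by linarith) (by linarith)
          (ae_of_all _ fun u => corr_nonneg hd r σ u) (hint _ _)
    _ = 2 * ∫ u in (0 : ℝ)..T, corr d r σ u := by
        rw [← intervalIntegral.integral_add_adjacent_intervals (hint (-T) 0) (hint 0 T), heven]
        ring

lemma integral_lagCovBound_le (hd : 1 ≤ d) {ρ : ℝ} (hρ : 0 ≤ ρ) (r σ : ℝ) {t s : ℝ} (ht : 0 ≤ t)
    (hs : s ∈ Set.Ioc 0 (T - t)) :
    IntegrableOn (fun s' => lagCovBound d ρ r σ t (s' - s)) (Set.Ioc 0 (T - t)) ∧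
      ∫ s' in Set.Ioc 0 (T - t), lagCovBound d ρ r σ t (s' - s)
        ≤ 4 * (ρ + ρ ^ 2) * ∫ u in Set.Ioc 0 T, corr d r σ u := by
  obtain ⟨hs0, hsL⟩ := hs
  have hL : 0 ≤ T - t := hs0.le.trans hsL
  have hshift (s' : ℝ) : lagCovBound d ρ r σ t (s' - s) = (ρ + ρ ^ 2) * corr d r σ (s' + -s) +
      ρ ^ 2 / 2 * (corr d r σ (s' + (t - s)) + corr d r σ (s' + (-s - t))) := by
    rw [lagCovBound]
    ring_nf
  simp_rw [hshift]
  have hint (x : ℝ) := integrableOn_corr_add hd r σ (T - t) x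
  have hcross : IntegrableOn (fun s' => ρ ^ 2 / 2 *
      (corr d r σ (s' + (t - s)) + corr d r σ (s' + (-s - t)))) (Set.Ioc 0 (T - t)) :=
    ((hint (t - s)).add (hint (-s - t))).const_mul (ρ ^ 2 / 2)
  refine ⟨((hint _).const_mul _).add hcross, ?_⟩
  rw [integral_add ((hint _).const_mul _) hcross, integral_const_mul, integral_const_mul,
    integral_add (hint _) (hint _)]
  set I := ∫ u in Set.Ioc 0 T, corr d r σ u
  have hI : 0 ≤ I := integral_nonneg fun u => corr_nonneg hd r σ u
  calc _ ≤ (ρ + ρ ^ 2) * (2 * I) + ρ ^ 2 / 2 * (2 * I + 2 * I) := by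
        gcongr <;> exact setIntegral_corr_add_le hd r σ hL (by linarith) (by linarith)
    _ ≤ 4 * (ρ + ρ ^ 2) * I := by linarith [mul_nonneg hρ hI]

end CorrIntegrals

section MeanSquare

variable {Ω : Type*} [MeasurableSpace Ω] {P : Measure Ω} {N : Ω → ℝ → ℝ} {t T : ℝ}

lemma integral_covEst_sub_sq_le_of_lagError [IsFiniteMeasure P]
    (hN : Measurable (Function.uncurry N)) {ρ c : ℝ} (htT : t < T) {K M : ℝ} {k : ℝ → ℝ → ℝ}
    (hK : ∀ s ∈ Set.Ioc 0 (T - t), Integrable (fun ω => lagError ρ c (N ω) t s ^ 2) P ∧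
      ∫ ω, lagError ρ c (N ω) t s ^ 2 ∂P ≤ K)
    (hk : ∀ s ∈ Set.Ioc 0 (T - t), ∀ s' ∈ Set.Ioc 0 (T - t),
      ∫ ω, lagError ρ c (N ω) t s * lagError ρ c (N ω) t s' ∂P ≤ k s s')
    (hM : ∀ s ∈ Set.Ioc 0 (T - t), IntegrableOn (k s) (Set.Ioc 0 (T - t)) ∧
      ∫ s' in Set.Ioc 0 (T - t), k s s' ≤ M) :
    Integrable (fun ω => (covEst ρ T (N ω) t - c) ^ 2) P ∧
      ∫ ω, (covEst ρ T (N ω) t - c) ^ 2 ∂P ≤ M / (T - t) := by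
  have hL : 0 < T - t := sub_pos.2 htT
  have hY := measurable_lagError hN ρ c t
  have hmem : ∀ᵐ s ∂volume.restrict (Set.Ioc 0 (T - t)), s ∈ Set.Ioc 0 (T - t) :=
    ae_restrict_mem measurableSet_Ioc
  have hKae := hmem.mono hK
  have hest : ∀ᵐ ω ∂P, (1 / (T - t)) ^ 2 * (∫ s in Set.Ioc 0 (T - t), lagError ρ c (N ω) t s) ^ 2
      = (covEst ρ T (N ω) t - c) ^ 2 := by
    filter_upwards [ae_integrable_of_integral_sq_le hY hKae] with ω hω
    rw [covEst_sub htT hω, mul_pow]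
  have hsq := integral_sq_integral_le_of_ae_integral_le hY hKae
    (hmem.mono fun s hs => hmem.mono fun s' hs' => hk s hs s' hs') (hmem.mono hM)
  rw [measureReal_restrict_apply_univ, Real.volume_real_Ioc_of_le hL.le, sub_zero] at hsq
  refine ⟨((integrable_sq_integral hY hKae).const_mul _).congr hest, ?_⟩
  rw [← integral_congr_ae hest, integral_const_mul]
  refine (mul_le_mul_of_nonneg_left hsq (sq_nonneg _)).trans_eq ?_
  field_simp

theorem IsBrownianSystem.integral_covEst_sub_sq_le [IsProbabilityMeasure P] {lam : ℝ≥0}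
    {ξ : ℤ → Ω → EuclideanSpace ℝ (Fin d)} {W : ℤ → ℝ≥0 → Ω → EuclideanSpace ℝ (Fin d)} {r σ : ℝ}
    (h : IsBrownianSystem lam ξ W P) (hd : 1 ≤ d) (hr : 0 < r) (hσ : 0 < σ)
    (hN : Measurable (Function.uncurry N)) (hcount : ∀ᵐ ω ∂P, count ξ W r σ ω = N ω)
    (ht : 0 ≤ t) (hT : 0 < T) (htT : t ≤ T / 2) :
    Integrable (fun ω => (covEst (rho d lam r) T (N ω) t - rho d lam r * corr d r σ t) ^ 2) P ∧
    ∫ ω, (covEst (rho d lam r) T (N ω) t - rho d lam r * corr d r σ t) ^ 2 ∂P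
      ≤ 8 / T * (rho d lam r + rho d lam r ^ 2) * ∫ u in Set.Ioc 0 T, corr d r σ u := by
  set ρ := rho d lam r
  have hρ : 0 ≤ ρ := rho_nonneg d lam r
  have hL : 0 < T - t := by linarith
  have hlag : ∀ᵐ ω ∂P, lagError ρ (ρ * corr d r σ t) (count ξ W r σ ω) t
      = lagError ρ (ρ * corr d r σ t) (N ω) t :=
    hcount.mono fun ω hω => by rw [hω]
  have hcov (s : ℝ) (hs : s ∈ Set.Ioc 0 (T - t)) (s' : ℝ) (hs' : s' ∈ Set.Ioc 0 (T - t)) :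
      ∫ ω, lagError ρ (ρ * corr d r σ t) (N ω) t s * lagError ρ (ρ * corr d r σ t) (N ω) t s' ∂P
        ≤ lagCovBound d ρ r σ t (s' - s) := by
    refine (integral_congr_ae ?_).trans_le
      (h.integral_lagError_mul_le hd hr hσ hs.1.le hs'.1.le ht)
    filter_upwards [hlag] with ω hω
    rw [hω]
  have hmem (s : ℝ) (hs : s ∈ Set.Ioc 0 (T - t)) :=
    (h.memLp_lagError hd hr hσ hs.1.le ht _).ae_eq (hlag.mono fun ω hω => congrFun hω s)
  obtain ⟨hint, hle⟩ := integral_covEst_sub_sq_le_of_lagError hN (sub_pos.1 hL)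
    (K := lagCovBound d ρ r σ t 0) (k := fun s s' => lagCovBound d ρ r σ t (s' - s))
    (fun s hs => ⟨(hmem s hs).integrable_sq, by simpa only [sq, sub_self] using hcov s hs s hs⟩)
    hcov (fun s hs => integral_lagCovBound_le hd hρ r σ ht hs)
  refine ⟨hint, hle.trans ?_⟩
  have hI : 0 ≤ ∫ u in Set.Ioc 0 T, corr d r σ u := integral_nonneg fun u => corr_nonneg hd r σ u
  calc 4 * (ρ + ρ ^ 2) * (∫ u in Set.Ioc 0 T, corr d r σ u) / (T - t)
      ≤ 4 * (ρ + ρ ^ 2) * (∫ u in Set.Ioc 0 T, corr d r σ u) / (T / 2) := by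
        gcongr
        linarith
    _ = 8 / T * (ρ + ρ ^ 2) * ∫ u in Set.Ioc 0 T, corr d r σ u := by ring

end MeanSquare

end CovarianceEstimate

section RelativeLoss

lemma relLoss_nonneg {x y : ℝ} (hx : 0 ≤ x) (hy : 0 ≤ y) : 0 ≤ relLoss x y :=
  div_nonneg (abs_nonneg _) (add_nonneg hx hy)

lemma relLoss_self_mul {s : ℝ} (hs : 0 < s) (x : ℝ) : relLoss (s * x) s = relLoss x 1 := by
  rw [relLoss, relLoss, ← mul_sub_one, ← mul_add_one, abs_mul, abs_of_pos hs,
    mul_div_mul_left _ _ hs.ne']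

lemma one_sub_rpow_le {v p : ℝ} (hv : 0 ≤ v) (hp : 1 ≤ p) : 1 - v ^ p ≤ p * (1 - v) := by
  have hbernoulli := one_add_mul_self_le_rpow_one_add (s := v - 1) (by linarith) hp
  rw [add_sub_cancel] at hbernoulli
  linarith

lemma relLoss_rpow_one_le {u p : ℝ} (hu : 0 < u) (hp : 1 ≤ p) :
    relLoss (u ^ p) 1 ≤ p * |u⁻¹ - 1| := by
  have hpow : 0 < u ^ p := Real.rpow_pos_of_pos hu p
  have hp0 : 0 ≤ p := zero_le_one.trans hp
  rw [relLoss]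
  rcases le_total 1 u with h | h
  · have hpow1 : 1 ≤ u ^ p := Real.one_le_rpow h hp0
    rw [abs_of_nonneg (sub_nonneg.2 hpow1), abs_of_nonpos (sub_nonpos.2 (inv_le_one_of_one_le₀ h)),
      neg_sub]
    calc (u ^ p - 1) / (u ^ p + 1) ≤ (u ^ p - 1) / u ^ p := by
          gcongr
          linarith
      _ = 1 - u⁻¹ ^ p := by rw [sub_div, div_self hpow.ne', one_div, Real.inv_rpow hu.le]
      _ ≤ p * (1 - u⁻¹) := one_sub_rpow_le (inv_nonneg.2 hu.le) hp
  · have hpow1 : u ^ p ≤ 1 := Real.rpow_le_one hu.le h hp0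
    rw [abs_of_nonpos (sub_nonpos.2 hpow1), abs_of_nonneg (sub_nonneg.2 ((one_le_inv₀ hu).2 h)),
      neg_sub]
    have hinv : 1 - u ≤ u⁻¹ - 1 := by
      simpa only [mul_one_sub, inv_mul_cancel₀ hu.ne'] using
        le_mul_of_one_le_left (sub_nonneg.2 h) ((one_le_inv₀ hu).2 h)
    calc (1 - u ^ p) / (u ^ p + 1) ≤ 1 - u ^ p := div_le_self (by linarith) (by linarith)
      _ ≤ p * (1 - u) := one_sub_rpow_le hu.le hp
      _ ≤ p * (u⁻¹ - 1) := mul_le_mul_of_nonneg_left hinv hp0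

lemma relLoss_rpow_div_le {x m s α : ℝ} (hx : 0 ≤ x) (hm : 0 < m) (hs : 0 < s) (hα0 : 0 < α)
    (hα1 : α ≤ 1) : relLoss ((s ^ α * m / x) ^ (1 / α)) s ≤ 1 / α * (|x - m| / m) := by
  have hp : 1 ≤ 1 / α := (one_le_div hα0).2 hα1
  rcases hx.eq_or_lt with rfl | hx
  · rw [div_zero, Real.zero_rpow (by positivity), relLoss, zero_sub, zero_add, zero_sub, abs_neg,
      abs_neg, abs_of_pos hs, abs_of_pos hm, div_self hs.ne', div_self hm.ne', mul_one]
    exact hp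
  · have hscale : (s ^ α * m / x) ^ (1 / α) = s * (m / x) ^ (1 / α) := by
      rw [mul_div_assoc, Real.mul_rpow (by positivity) (by positivity), ← Real.rpow_mul hs.le,
        mul_one_div_cancel hα0.ne', Real.rpow_one]
    have hrel : |x - m| / m = |(m / x)⁻¹ - 1| := by
      rw [inv_div, ← div_self hm.ne', ← sub_div, abs_div, abs_of_pos hm]
    rw [hscale, relLoss_self_mul hs, hrel]
    exact relLoss_rpow_one_le (by positivity) hp

end RelativeLoss

section Tuning

variable {d : ℕ} {T : ℝ}

lemma bStar_pos (d : ℕ) (hT : 1 < T) : 0 < bStar d T := by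
  have := Real.log_pos hT
  unfold bStar
  split_ifs <;> positivity

lemma phi_pos (d : ℕ) (hT : 1 < T) : 0 < phi d T := by
  have := Real.log_pos hT
  unfold phi
  split_ifs <;> positivity

lemma inv_bStar_pow (hd : 1 ≤ d) (hT : 1 < T) : (bStar d T ^ d)⁻¹ = phi d T := by
  have := Real.log_pos hT
  unfold bStar phi
  split_ifs with hd2 hd2
  · rw [one_div, Real.rpow_inv_natCast_pow (by positivity) (by lia), inv_div]
  · rw [hd2, ← Real.sqrt_eq_rpow, Real.sq_sqrt (by positivity), inv_div]
  · obtain rfl : d = 1 := by lia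
    rw [pow_one, inv_div]

lemma bStar_le_sqrt (d : ℕ) (hT : Real.exp 1 ≤ T) : bStar d T ≤ √T := by
  have hT1 : 1 ≤ T := (Real.one_le_exp zero_le_one).trans hT
  have hT0 : 0 ≤ T := zero_le_one.trans hT1
  have hlog : 1 ≤ Real.log T := (Real.le_log_iff_exp_le (by linarith)).2 hT
  have hdiv (k : ℕ) : T / Real.log T ^ k ≤ T := div_le_self hT0 (one_le_pow₀ hlog)
  unfold bStar
  split_ifs with hd2
  · have hexp : 1 / (d : ℝ) ≤ 1 / 2 := one_div_le_one_div_of_le two_pos (by exact_mod_cast hd2.le)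
    rw [Real.sqrt_eq_rpow]
    exact (Real.rpow_le_rpow (by positivity) (hdiv 2) (by positivity)).trans
      (Real.rpow_le_rpow_of_exponent_le hT1 hexp)
  · rw [Real.sqrt_eq_rpow]
    exact Real.rpow_le_rpow (by positivity) (hdiv 3) (by norm_num)
  · exact div_le_self (Real.sqrt_nonneg T) (one_le_pow₀ hlog)

lemma bStar_le_half (d : ℕ) (hT : 4 ≤ T) : bStar d T ≤ T / 2 := by
  refine (bStar_le_sqrt d (by linarith [Real.exp_one_lt_d9])).trans ?_
  rw [Real.sqrt_le_left (by linarith)]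
  nlinarith

lemma one_div_alphaStar (T : ℝ) : 1 / alphaStar T = Real.log T := by
  rw [alphaStar, one_div_one_div]

lemma alphaStar_pos (hT : 1 < T) : 0 < alphaStar T :=
  one_div_pos.2 (Real.log_pos hT)

lemma alphaStar_le_quarter (hT : Real.exp 4 ≤ T) : alphaStar T ≤ 1 / 4 :=
  one_div_le_one_div_of_le (by norm_num)
    ((Real.le_log_iff_exp_le ((Real.exp_pos 4).trans_le hT)).2 hT)

lemma rpow_alphaStar_self (hT : 1 < T) : T ^ alphaStar T = Real.exp 1 := by
  rw [Real.rpow_def_of_pos (zero_lt_one.trans hT), alphaStar,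
    mul_one_div_cancel (Real.log_pos hT).ne']

lemma bStar_rpow_alphaStar_le (d : ℕ) (hT : 4 ≤ T) : bStar d T ^ alphaStar T ≤ Real.exp 1 := by
  have hT1 : 1 < T := by linarith
  rw [← rpow_alphaStar_self hT1]
  exact Real.rpow_le_rpow (bStar_pos d hT1).le (by linarith [bStar_le_half d hT])
    (alphaStar_pos hT1).le

lemma inv_exp_one_le_rpow_alphaStar {x : ℝ} (hT : 1 < T) (hx : T⁻¹ ≤ x) :
    (Real.exp 1)⁻¹ ≤ x ^ alphaStar T := by
  have hT0 : 0 < T := zero_lt_one.trans hT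
  rw [← rpow_alphaStar_self hT, ← Real.inv_rpow hT0.le]
  exact Real.rpow_le_rpow (inv_nonneg.2 hT0.le) hx (alphaStar_pos hT).le

end Tuning

section PowerMeasure

/-- The measure `t ^ (α - 1) dt` on `(0, b]`, integration against which turns the estimated
correlation function into the statistic `psiEst`. -/
noncomputable def powerMeasure (α b : ℝ) : Measure ℝ :=
  (volume.restrict (Set.Ioc 0 b)).withDensity fun t => ENNReal.ofReal (t ^ (α - 1))

variable {α b : ℝ}

lemma isFiniteMeasure_powerMeasure (hα : 0 < α) (hb : 0 ≤ b) :
    IsFiniteMeasure (powerMeasure α b) :=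
  isFiniteMeasure_withDensity_ofReal (integrableOn_rpow_Ioc hα hb).2

lemma ae_powerMeasure_mem (α b : ℝ) : ∀ᵐ t ∂powerMeasure α b, t ∈ Set.Ioc 0 b :=
  (withDensity_absolutelyContinuous _ _).ae_le (ae_restrict_mem measurableSet_Ioc)

lemma ofReal_rpow_smul_ae_eq (α b : ℝ) (f : ℝ → ℝ) :
    (fun t => (ENNReal.ofReal (t ^ (α - 1))).toReal • f t)
      =ᵐ[volume.restrict (Set.Ioc 0 b)] fun t => f t / t ^ (1 - α) := by
  filter_upwards [ae_restrict_mem measurableSet_Ioc] with t ht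
  rw [ENNReal.toReal_ofReal (Real.rpow_nonneg ht.1.le _), smul_eq_mul, div_rpow_one_sub _ ht.1,
    mul_comm]

lemma integrable_powerMeasure_iff {f : ℝ → ℝ} :
    Integrable f (powerMeasure α b) ↔ IntegrableOn (fun t => f t / t ^ (1 - α)) (Set.Ioc 0 b) := by
  rw [powerMeasure, integrable_withDensity_iff_integrable_smul' (by fun_prop)
    (ae_of_all _ fun _ => ENNReal.ofReal_lt_top)]
  exact integrable_congr (ofReal_rpow_smul_ae_eq α b f)

lemma integral_powerMeasure (f : ℝ → ℝ) :
    ∫ t, f t ∂powerMeasure α b = ∫ t in Set.Ioc 0 b, f t / t ^ (1 - α) := by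
  rw [powerMeasure, integral_withDensity_eq_integral_toReal_smul (by fun_prop)
    (ae_of_all _ fun _ => ENNReal.ofReal_lt_top)]
  exact integral_congr_ae (ofReal_rpow_smul_ae_eq α b f)

lemma powerMeasure_real_univ (hα : 0 < α) (hb : 0 ≤ b) :
    (powerMeasure α b).real Set.univ = b ^ α / α := by
  calc (powerMeasure α b).real Set.univ = ∫ t in Set.Ioc 0 b, 1 / t ^ (1 - α) := by
        rw [← integral_powerMeasure fun _ => 1, integral_const, smul_eq_mul, mul_one]
    _ = ∫ t in Set.Ioc 0 b, t ^ (α - 1) :=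
        setIntegral_congr_fun measurableSet_Ioc fun t ht => by
          rw [div_rpow_one_sub 1 ht.1, one_mul]
    _ = b ^ α / α := setIntegral_rpow_Ioc hα hb

lemma psiEst_eq_integral_powerMeasure (hb : 0 ≤ b) (ρ T : ℝ) (N : ℝ → ℝ) :
    psiEst ρ T α b N = ∫ t, corrEst ρ T N t ∂powerMeasure α b := by
  rw [psiEst, intervalIntegral.integral_of_le hb, integral_powerMeasure]

end PowerMeasure

section IntegralEstimate

lemma psiEst_nonneg {ρ T α b : ℝ} (hρ : 0 ≤ ρ) (hb : 0 ≤ b) (N : ℝ → ℝ) :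
    0 ≤ psiEst ρ T α b N :=
  intervalIntegral.integral_nonneg hb fun _ ht =>
    div_nonneg (mul_nonneg (one_div_nonneg.2 hρ) (le_max_right _ _)) (Real.rpow_nonneg ht.1 _)

lemma corrEst_sub_sq_le {ρ c : ℝ} (hρ : 0 < ρ) (hc : 0 ≤ c) (T : ℝ) (N : ℝ → ℝ) (t : ℝ) :
    (corrEst ρ T N t - c) ^ 2 ≤ (1 / ρ) ^ 2 * (covEst ρ T N t - ρ * c) ^ 2 := by
  have hmax : |max (covEst ρ T N t) 0 - ρ * c| ≤ |covEst ρ T N t - ρ * c| := by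
    simpa only [max_eq_left (mul_nonneg hρ.le hc)] using
      abs_max_sub_max_le_abs (covEst ρ T N t) (ρ * c) 0
  calc (corrEst ρ T N t - c) ^ 2 = (1 / ρ) ^ 2 * (max (covEst ρ T N t) 0 - ρ * c) ^ 2 := by
        rw [corrEst]
        field_simp
    _ ≤ (1 / ρ) ^ 2 * (covEst ρ T N t - ρ * c) ^ 2 :=
        mul_le_mul_of_nonneg_left (sq_le_sq.2 hmax) (sq_nonneg _)

variable {d : ℕ} {T α b r σ : ℝ}

lemma psiEst_sub_psi_sq_le (hd : 1 ≤ d) (hσ : 0 < σ) (hα0 : 0 < α) (hα : α < (d : ℝ) / 2)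
    (hb : 0 < b) {ρ : ℝ} {N : ℝ → ℝ}
    (hN : Integrable (fun t => corrEst ρ T N t - corr d r σ t) (powerMeasure α b)) :
    (psiEst ρ T α b N - psi d r σ α) ^ 2
      ≤ 2 * (∫ t, (corrEst ρ T N t - corr d r σ t) ∂powerMeasure α b) ^ 2 +
        2 * (∫ t in Set.Ioi b, corr d r σ t / t ^ (1 - α)) ^ 2 := by
  have hcorr : Integrable (corr d r σ) (powerMeasure α b) :=
    integrable_powerMeasure_iff.2 (integrableOn_corr_div_Ioc hd r σ hα0 hb.le)
  have hest : ∫ t, corrEst ρ T N t ∂powerMeasure α b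
      = (∫ t in Set.Ioc 0 b, corr d r σ t / t ^ (1 - α)) +
        ∫ t, (corrEst ρ T N t - corr d r σ t) ∂powerMeasure α b := by
    rw [← integral_powerMeasure, ← integral_add hcorr hN]
    simp only [add_sub_cancel]
  rw [psiEst_eq_integral_powerMeasure hb.le, hest, psi_eq_add hd r hσ hα0 hα hb,
    add_sub_add_left_eq_sub, sub_eq_add_neg, ← mul_add, ← neg_sq (∫ t in Set.Ioi b, _)]
  exact add_sq_le

variable {Ω : Type*} [MeasurableSpace Ω] {P : Measure Ω} [IsProbabilityMeasure P] {lam : ℝ≥0}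
  {ξ : ℤ → Ω → EuclideanSpace ℝ (Fin d)} {W : ℤ → ℝ≥0 → Ω → EuclideanSpace ℝ (Fin d)}
  {N : Ω → ℝ → ℝ}

lemma rho_pos (d : ℕ) (hlam : 0 < lam) (hr : 0 < r) : 0 < rho d lam r :=
  mul_pos hlam (ENNReal.toReal_pos (Metric.measure_closedBall_pos volume _ hr).ne'
    measure_closedBall_lt_top.ne)

lemma IsBrownianSystem.integral_corrEst_sub_sq_le (h : IsBrownianSystem lam ξ W P) (hd : 1 ≤ d)
    (hr : 0 < r) (hσ : 0 < σ) (hlam : 0 < lam) (hN : Measurable (Function.uncurry N))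
    (hcount : ∀ᵐ ω ∂P, count ξ W r σ ω = N ω) {t : ℝ} (ht : 0 ≤ t) (hT : 0 < T)
    (htT : t ≤ T / 2) :
    Integrable (fun ω => (corrEst (rho d lam r) T (N ω) t - corr d r σ t) ^ 2) P ∧
      ∫ ω, (corrEst (rho d lam r) T (N ω) t - corr d r σ t) ^ 2 ∂P
        ≤ 8 / T * (1 + 1 / rho d lam r) * ∫ u in Set.Ioc 0 T, corr d r σ u := by
  have hρ : 0 < rho d lam r := rho_pos d hlam hr
  obtain ⟨hcov, hcov_le⟩ := h.integral_covEst_sub_sq_le hd hr hσ hN hcount ht hT htT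
  have hle (ω : Ω) := corrEst_sub_sq_le hρ (corr_nonneg hd r σ t) T (N ω) t
  have hmeas : Measurable fun ω => (corrEst (rho d lam r) T (N ω) t - corr d r σ t) ^ 2 :=
    (((measurable_corrEst hN _ T).comp measurable_prodMk_right).sub_const _).pow_const 2
  have hint : Integrable (fun ω => (corrEst (rho d lam r) T (N ω) t - corr d r σ t) ^ 2) P := by
    refine (hcov.const_mul ((1 / rho d lam r) ^ 2)).mono' hmeas.aestronglyMeasurable
      (ae_of_all _ fun ω => ?_)
    rw [Real.norm_eq_abs, abs_of_nonneg (sq_nonneg _)]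
    exact hle ω
  refine ⟨hint, (integral_mono hint (hcov.const_mul _) hle).trans ?_⟩
  rw [integral_const_mul]
  refine (mul_le_mul_of_nonneg_left hcov_le (sq_nonneg _)).trans_eq ?_
  field_simp
  ring

theorem IsBrownianSystem.integral_psiEst_sub_sq_le (h : IsBrownianSystem lam ξ W P) (hd : 1 ≤ d)
    (hr : 0 < r) (hσ : 0 < σ) (hlam : 0 < lam) (hN : Measurable (Function.uncurry N))
    (hcount : ∀ᵐ ω ∂P, count ξ W r σ ω = N ω) (hα0 : 0 < α) (hα : α < (d : ℝ) / 2) (hb : 0 < b)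
    (hbT : b ≤ T / 2) :
    Integrable (fun ω => (psiEst (rho d lam r) T α b (N ω) - psi d r σ α) ^ 2) P ∧
    ∫ ω, (psiEst (rho d lam r) T α b (N ω) - psi d r σ α) ^ 2 ∂P
      ≤ 2 * (8 / T * (1 + 1 / rho d lam r) * (∫ u in Set.Ioc 0 T, corr d r σ u) *
        (b ^ α / α) ^ 2) + 2 * (∫ t in Set.Ioi b, corr d r σ t / t ^ (1 - α)) ^ 2 := by
  have hT : 0 < T := by linarith
  have := isFiniteMeasure_powerMeasure hα0 hb.le
  let Y : Ω → ℝ → ℝ := fun ω t => corrEst (rho d lam r) T (N ω) t - corr d r σ t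
  have hY : Measurable (Function.uncurry Y) :=
    (measurable_corrEst hN _ T).sub ((measurable_corr hd r σ).comp measurable_snd)
  have hK : ∀ᵐ t ∂powerMeasure α b, Integrable (fun ω => Y ω t ^ 2) P ∧ ∫ ω, Y ω t ^ 2 ∂P
      ≤ 8 / T * (1 + 1 / rho d lam r) * ∫ u in Set.Ioc 0 T, corr d r σ u := by
    filter_upwards [ae_powerMeasure_mem α b] with t ht
    exact h.integral_corrEst_sub_sq_le hd hr hσ hlam hN hcount ht.1.le hT (ht.2.trans hbT)
  have hsq := integrable_sq_integral hY hK
  have hsq_le := integral_sq_integral_le hY hK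
  rw [powerMeasure_real_univ hα0 hb.le] at hsq_le
  have hle : ∀ᵐ ω ∂P, (psiEst (rho d lam r) T α b (N ω) - psi d r σ α) ^ 2
      ≤ 2 * (∫ t, Y ω t ∂powerMeasure α b) ^ 2 +
        2 * (∫ t in Set.Ioi b, corr d r σ t / t ^ (1 - α)) ^ 2 :=
    (ae_integrable_of_integral_sq_le hY hK).mono fun ω hω =>
      psiEst_sub_psi_sq_le hd hσ hα0 hα hb hω
  have hbound := (hsq.const_mul 2).add
    (integrable_const (μ := P) (2 * (∫ t in Set.Ioi b, corr d r σ t / t ^ (1 - α)) ^ 2))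
  have hint : Integrable (fun ω => (psiEst (rho d lam r) T α b (N ω) - psi d r σ α) ^ 2) P := by
    refine hbound.mono' (((measurable_psiEst hN _ T α b).sub_const _).pow_const
      2).aestronglyMeasurable (hle.mono fun ω hω => ?_)
    rwa [Real.norm_eq_abs, abs_of_nonneg (sq_nonneg _)]
  refine ⟨hint, (integral_mono_ae hint hbound hle).trans ?_⟩
  rw [integral_add' (hsq.const_mul 2) (integrable_const _), integral_const_mul, integral_const,
    probReal_univ, one_smul]
  gcongr

end IntegralEstimate

section Risk

variable {d : ℕ} {r σ T α : ℝ}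

lemma four_le_of_exp_four_le (hT : Real.exp 4 ≤ T) : 4 ≤ T := by
  linarith [Real.add_one_le_exp (4 : ℝ)]

lemma quarter_le_sub_alphaStar (hd : 1 ≤ d) (hT : Real.exp 4 ≤ T) :
    1 / 4 ≤ (d : ℝ) / 2 - alphaStar T := by
  have hd' : (1 : ℝ) ≤ d := by exact_mod_cast hd
  linarith [alphaStar_le_quarter hT]

lemma Jalpha_eq (d : ℕ) (r : ℝ) (hσ : 0 < σ) (α : ℝ) :
    Jalpha d r α = (σ ^ 2) ^ α * psi d r σ α := by
  have hs : 0 < σ ^ 2 := by positivity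
  rw [psi_eq d r hσ, ← mul_assoc, ← Real.rpow_add hs, add_neg_cancel, Real.rpow_zero, one_mul]

lemma le_psi_alphaStar (hd : 1 ≤ d) (hr : 0 < r) (hσ : 0 < σ) (hT : Real.exp 4 ≤ T)
    (hσT : σ ^ 2 ≤ r ^ 2 * T) :
    J d 1 1 / Real.exp 1 * Real.log T ≤ psi d r σ (alphaStar T) := by
  have hT1 : 1 < T := by linarith [four_le_of_exp_four_le hT]
  have hα0 := alphaStar_pos hT1
  have hα : alphaStar T < (d : ℝ) / 2 := by linarith [quarter_le_sub_alphaStar hd hT]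
  have hratio : T⁻¹ ≤ (r / σ) ^ 2 := by
    rw [div_pow, le_div_iff₀ (by positivity), inv_mul_le_iff₀ (by positivity), mul_comm]
    exact hσT
  have hJ := J_one_one_pos hd
  calc J d 1 1 / Real.exp 1 * Real.log T
      = J d 1 1 * ((Real.exp 1)⁻¹ / alphaStar T) := by
        rw [← one_div_alphaStar]
        ring
    _ ≤ J d 1 1 * (((r / σ) ^ 2) ^ alphaStar T / alphaStar T) := by
        gcongr
        exact inv_exp_one_le_rpow_alphaStar hT1 hratio
    _ ≤ psi d r σ (alphaStar T) := le_psi hd hr hσ hα0 hα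

lemma relLoss_sigmaSqStar_sq_le (hd : 1 ≤ d) (hr : 0 < r) (hσ : 0 < σ) {ρ : ℝ} (hρ : 0 ≤ ρ)
    (hT : Real.exp 4 ≤ T) (hσT : σ ^ 2 ≤ r ^ 2 * T) (N : ℝ → ℝ) :
    relLoss (sigmaSqStar d r ρ T N) (σ ^ 2) ^ 2 ≤ Real.exp 1 ^ 2 / J d 1 1 ^ 2 *
      (psiEst ρ T (alphaStar T) (bStar d T) N - psi d r σ (alphaStar T)) ^ 2 := by
  have hT1 : 1 < T := by linarith [four_le_of_exp_four_le hT]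
  have hlog : 0 < Real.log T := Real.log_pos hT1
  have hs : 0 < σ ^ 2 := by positivity
  have hJ := J_one_one_pos hd
  have hpsi_le := le_psi_alphaStar hd hr hσ hT hσT
  have hpsi : 0 < psi d r σ (alphaStar T) := lt_of_lt_of_le (by positivity) hpsi_le
  have hest := psiEst_nonneg (T := T) (α := alphaStar T) hρ (bStar_pos d hT1).le N
  have hα1 : alphaStar T ≤ 1 := by linarith [alphaStar_le_quarter hT]
  have hloss : relLoss (sigmaSqStar d r ρ T N) (σ ^ 2)
      ≤ Real.exp 1 / J d 1 1 *
        |psiEst ρ T (alphaStar T) (bStar d T) N - psi d r σ (alphaStar T)| := by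
    rw [sigmaSqStar, sigmaSqEst, Jalpha_eq d r hσ]
    refine (relLoss_rpow_div_le hest hpsi hs (alphaStar_pos hT1) hα1).trans ?_
    rw [one_div_alphaStar, mul_div_assoc', div_le_iff₀ hpsi, mul_right_comm]
    refine mul_le_mul_of_nonneg_right ?_ (abs_nonneg _)
    calc Real.log T = Real.exp 1 / J d 1 1 * (J d 1 1 / Real.exp 1 * Real.log T) := by field_simp
      _ ≤ Real.exp 1 / J d 1 1 * psi d r σ (alphaStar T) := by gcongr
  have hloss0 : 0 ≤ relLoss (sigmaSqStar d r ρ T N) (σ ^ 2) := by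
    refine relLoss_nonneg (Real.rpow_nonneg (div_nonneg ?_ hest) _) hs.le
    rw [Jalpha_eq d r hσ]
    positivity
  refine (pow_le_pow_left₀ hloss0 hloss 2).trans_eq ?_
  rw [mul_pow, div_pow, sq_abs]

lemma sq_integral_corr_div_Ioi_bStar_le (hd : 1 ≤ d) (hr : 0 ≤ r) (hσ : 0 < σ)
    (hT : Real.exp 4 ≤ T) :
    (∫ t in Set.Ioi (bStar d T), corr d r σ t / t ^ (1 - alphaStar T)) ^ 2
      ≤ 16 * decayConst d ^ 2 * Real.exp 1 ^ 2 * ((r / σ) ^ (2 * d) * phi d T) := by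
  have hT4 := four_le_of_exp_four_le hT
  have hT1 : 1 < T := by linarith
  have hb := bStar_pos d hT1
  have hgap := quarter_le_sub_alphaStar hd hT
  have hinv : ((d : ℝ) / 2 - alphaStar T)⁻¹ ≤ 4 := by
    rw [inv_le_comm₀ (by linarith) (by norm_num), ← one_div]
    exact hgap
  have hD := (decayConst_pos hd).le
  have htail0 : 0 ≤ ∫ t in Set.Ioi (bStar d T), corr d r σ t / t ^ (1 - alphaStar T) :=
    setIntegral_nonneg measurableSet_Ioi fun t ht => corr_div_nonneg hd r σ _ (hb.trans ht).le
  have htail : ∫ t in Set.Ioi (bStar d T), corr d r σ t / t ^ (1 - alphaStar T)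
      ≤ decayConst d * (r / σ) ^ d *
        (Real.exp 1 * bStar d T ^ (-((d : ℝ) / 2)) * 4) := by
    refine (integral_corr_div_Ioi_le hd r hσ (by linarith) hb).trans ?_
    rw [Real.rpow_div_two_eq_sqrt _ (sq_nonneg _), Real.sqrt_sq (by positivity), Real.rpow_natCast,
      sub_eq_add_neg (alphaStar T), Real.rpow_add hb,
      div_eq_mul_inv (bStar d T ^ alphaStar T * _)]
    gcongr
    exact bStar_rpow_alphaStar_le d hT4
  have hphi : (bStar d T ^ (-((d : ℝ) / 2))) ^ 2 = phi d T := by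
    rw [← inv_bStar_pow hd hT1, ← Real.rpow_natCast _ 2, ← Real.rpow_mul hb.le,
      ← Real.rpow_natCast _ d, ← Real.rpow_neg hb.le]
    congr 1
    push_cast
    ring
  refine (pow_le_pow_left₀ htail0 htail 2).trans_eq ?_
  rw [← hphi, pow_mul']
  ring

lemma mul_integral_corr_mul_bStar_sq_le (hd : 1 ≤ d) {ρ C : ℝ} (hρ : 0 ≤ ρ)
    (hT : Real.exp 4 ≤ T)
    (hcorr : 1 / T * ∫ u in Set.Ioc 0 T, corr d r σ u ≤ C * (r / σ) ^ min d 2 * stochRate d T) :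
    8 / T * (1 + 1 / ρ) * (∫ u in Set.Ioc 0 T, corr d r σ u) *
        (bStar d T ^ alphaStar T / alphaStar T) ^ 2
      ≤ 8 * C * Real.exp 1 ^ 2 * ((1 + 1 / ρ) * (r / σ) ^ min d 2 * phi d T) := by
  have hT4 := four_le_of_exp_four_le hT
  have hT1 : 1 < T := by linarith
  have hb : 0 ≤ bStar d T ^ alphaStar T := Real.rpow_nonneg (bStar_pos d hT1).le _
  have hmass : (bStar d T ^ alphaStar T / alphaStar T) ^ 2 ≤ Real.exp 1 ^ 2 * Real.log T ^ 2 := by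
    rw [div_eq_mul_one_div, one_div_alphaStar, mul_pow]
    gcongr
    exact bStar_rpow_alphaStar_le d hT4
  have hmean : 0 ≤ 1 / T * ∫ u in Set.Ioc 0 T, corr d r σ u :=
    mul_nonneg (by positivity) (integral_nonneg fun u => corr_nonneg hd r σ u)
  calc _ = 8 * (1 + 1 / ρ) * (1 / T * ∫ u in Set.Ioc 0 T, corr d r σ u) *
        (bStar d T ^ alphaStar T / alphaStar T) ^ 2 := by ring
    _ ≤ 8 * (1 + 1 / ρ) * (C * (r / σ) ^ min d 2 * stochRate d T) *
        (Real.exp 1 ^ 2 * Real.log T ^ 2) :=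
      mul_le_mul (mul_le_mul_of_nonneg_left hcorr (by positivity)) hmass (sq_nonneg _)
        (mul_nonneg (by positivity) (hmean.trans hcorr))
    _ = _ := by
      rw [← log_sq_mul_stochRate]
      ring

theorem exists_integral_relLoss_sq_le (hd : 1 ≤ d) : ∃ C : ℝ, 0 < C ∧
    ∀ {Ω : Type*} [MeasurableSpace Ω] {P : Measure Ω} [IsProbabilityMeasure P]
      {lam : ℝ≥0} {ξ : ℤ → Ω → EuclideanSpace ℝ (Fin d)}
      {W : ℤ → ℝ≥0 → Ω → EuclideanSpace ℝ (Fin d)}, IsBrownianSystem lam ξ W P →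
      ∀ {r σ T : ℝ}, 0 < r → 0 < lam → 0 < σ → Real.exp 4 ≤ T → σ ^ 2 ≤ r ^ 2 * T →
      ∫ ω, relLoss (sigmaSqStar d r (rho d lam r) T (count ξ W r σ ω)) (σ ^ 2) ^ 2 ∂P
        ≤ C * (((1 + 1 / rho d lam r) * (r / σ) ^ min d 2 + (r / σ) ^ (2 * d)) * phi d T) := by
  obtain ⟨C, hC, hcorr⟩ := exists_integral_corr_le_stochRate hd
  have hJ := J_one_one_pos hd
  set K := Real.exp 1 ^ 2 / J d 1 1 ^ 2
  refine ⟨K * (Real.exp 1 ^ 2 * (16 * C + 32 * decayConst d ^ 2)), by positivity, ?_⟩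
  intro Ω _ P _ lam ξ W h r σ T hr hlam hσ hT hσT
  have hT4 := four_le_of_exp_four_le hT
  have hT1 : 1 < T := by linarith
  have hTexp : Real.exp 1 ≤ T := by linarith [Real.exp_one_lt_d9]
  have hρ := rho_pos d hlam hr
  have hphi := phi_pos d hT1
  have hα : alphaStar T < (d : ℝ) / 2 := by linarith [quarter_le_sub_alphaStar hd hT]
  obtain ⟨N, hN, hcount⟩ := h.exists_measurable_count r σ
  obtain ⟨hint, hmse⟩ := h.integral_psiEst_sub_sq_le hd hr hσ hlam hN hcount (alphaStar_pos hT1) hα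
    (bStar_pos d hT1) (bStar_le_half d hT4)
  have hvar := mul_integral_corr_mul_bStar_sq_le hd hρ.le hT (hcorr r σ T hr hσ hTexp hσT)
  have htail := sq_integral_corr_div_Ioi_bStar_le hd hr.le hσ hT
  have hloss : ∀ᵐ ω ∂P, relLoss (sigmaSqStar d r (rho d lam r) T (count ξ W r σ ω)) (σ ^ 2) ^ 2
      ≤ K * (psiEst (rho d lam r) T (alphaStar T) (bStar d T) (N ω) -
        psi d r σ (alphaStar T)) ^ 2 := by
    filter_upwards [hcount] with ω hω
    rw [hω]
    exact relLoss_sigmaSqStar_sq_le hd hr hσ hρ.le hT hσT (N ω)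
  refine (integral_mono_of_nonneg (ae_of_all _ fun ω => sq_nonneg _) (hint.const_mul K)
    hloss).trans ?_
  rw [integral_const_mul, mul_assoc K]
  refine mul_le_mul_of_nonneg_left (hmse.trans ?_) (by positivity)
  set A := (1 + 1 / rho d lam r) * (r / σ) ^ min d 2
  set B := (r / σ) ^ (2 * d)
  have hcrossB : 0 ≤ Real.exp 1 ^ 2 * C * (B * phi d T) := by positivity
  have hcrossA : 0 ≤ Real.exp 1 ^ 2 * decayConst d ^ 2 * (A * phi d T) := by positivity
  linarith

end Risk

end Smoluchowski

theorem mainTheorem4 (d : ℕ) (hd : 1 ≤ d) :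
    ∃ C : ℝ, 0 < C ∧ ∀ (r : ℝ) (lam : ℝ≥0), 0 < r → 0 < lam →
      ∀ {Ω : Type*} [MeasurableSpace Ω] (P : Measure Ω) [IsProbabilityMeasure P]
        (ξ : ℤ → Ω → EuclideanSpace ℝ (Fin d))
        (W : ℤ → ℝ≥0 → Ω → EuclideanSpace ℝ (Fin d)),
        IsBrownianSystem lam ξ W P →
        (∀ T σ : ℝ, Real.exp 2 < T → 0 < σ →
          AEMeasurable (fun ω => sigmaSqStar d r (rho d lam r) T (count ξ W r σ ω)) P) ∧
        limsup (fun T : ℝ => ⨆ (σ : ℝ) (_ : 0 < σ) (_ : σ ^ 2 ≤ r ^ 2 * T),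
          ENNReal.ofReal
            (((1 + 1 / rho d lam r) * (r / σ) ^ (min d 2) + (r / σ) ^ (2 * d))⁻¹ * (phi d T)⁻¹ *
              ∫ ω, relLoss (sigmaSqStar d r (rho d lam r) T (count ξ W r σ ω)) (σ ^ 2) ^ 2 ∂P))
          atTop ≤ ENNReal.ofReal C := by
  obtain ⟨C, hC, hrisk⟩ := exists_integral_relLoss_sq_le hd
  refine ⟨C, hC, fun r lam hr hlam Ω _ P _ ξ W h => ⟨fun T σ _ _ => ?_, ?_⟩⟩
  · obtain ⟨N, hN, hcount⟩ := h.exists_measurable_count r σ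
    exact ⟨_, measurable_sigmaSqStar hN d r (rho d lam r) T,
      hcount.mono fun ω hω => by simp only [hω]⟩
  · refine limsup_le_of_le (h := ?_)
    filter_upwards [eventually_ge_atTop (Real.exp 4)] with T hT
    refine iSup_le fun σ => iSup_le fun hσ => iSup_le fun hσT => ENNReal.ofReal_le_ofReal ?_
    have hρ := rho_pos d hlam hr
    have hphi : 0 < phi d T := phi_pos d (by linarith [four_le_of_exp_four_le hT])
    rw [← mul_inv, inv_mul_le_iff₀ (by positivity), mul_comm _ C]
    exact hrisk h hr hlam hσ hT hσT
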